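/- Let $a(n,t)>0$ and $b(n,t)\in\mathbb{R}$, $(n,t)\in\mathbb{Z}\times\mathbb{R}$, be a solution of the Toda lattice $$\dot b(n,t) = 2\big(a(n,t)^2-a(n-1,t)^2\big),\qquad \dot a(n,t)=a(n,t)\big(b(n+1,t)-b(n,t)\big),$$ bounded in $n$ locally uniformly in $t$, such that $\sum_{n\in\mathbb{Z}}|n|^l\big(|a(n,t)-\tfrac12|+|b(n,t)|\big)<\infty$ for every $l\in\mathbb{N}$ holds for one $t=t_0$ (and hence for all $t$). Let $$(H(t)u)(n)=a(n,t)u(n+1)+a(n-1,t)u(n-1)+b(n,t)u(n)$$ be the associated Jacobi operator in $\ell^2(\mathbb{Z})$. For $0<|z|\le 1$ let the Jost function $\psi_\pm(z,\cdot,t)$ be the unique solution of $H(t)\psi=\tfrac12(z+z^{-1})\psi$ with $\lim_{n\to\pm\infty}z^{\mp n}\psi_\pm(z,n,t)=1$. Put $$W(z,t)=a(n,t)\big(\psi_+(z,n,t)\psi_-(z,n+1,t)-\psi_+(z,n+1,t)\psi_-(z,n,t)\big),$$ which does not depend on $n$, and let $T(z)=\frac{z^{-1}-z}{2W(z,t)}$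 be the transmission coefficient (which does not depend on $t$). For $|z|=1$, $z\ne\pm1$, let the right reflection coefficient $R(z,t)$ be determined by the scattering relation $T(z)\psi_-(z,n,t)=\overline{\psi_+(z,n,t)}+R(z,t)\psi_+(z,n,t)$ for all $n\in\mathbb{Z}$, and extend it continuously to $z=\pm1$; put $R(z)=R(z,0)$. Let $\zeta_k\in(-1,0)\cup(0,1)$ be the points for which $\tfrac12(\zeta_k+\zeta_k^{-1})$ is an eigenvalue of $H(0)$, and let $\gamma_k=\big(\sum_{n\in\mathbb{Z}}|\psi_+(\zeta_k,n,0)|^2\big)^{-1}$. Write $\mathrm{e}^{t\Phi(z)}=z^{2n}\mathrm{e}^{t(z-z^{-1})}$, and define $$m(z,n,t)=\begin{cases}\begin{pmatrix}T(z)\psi_-(z,n,t)z^n & \psi_+(z,n,t)z^{-n}\end{pmatrix}, & |z|<1,\\[1mm] \begin{pmatrix}\psi_+(z^{-1},n,t)z^n & T(z^{-1})\psi_-(z^{-1},n,t)z^{-n}\end{pmatrix}, & |z|>1,\end{cases}$$ where the value at the removable singularity $z=0$ is the limit. Then for every $n\in\mathbb{Z}$ and $t\in\mathbb{R}$ the function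 $m(\cdot)=m(\cdot,n,t)$ is a solution of the following vector Riemann--Hilbert problem, and every solution coincides with it on $\mathbb{C}\setminus(\{|z|=1\}\cup\{\zeta_k,\zeta_k^{-1}\}_k)$: find a row vector $m(z)=(m_1(z)\ \ m_2(z))$, holomorphic in $\mathbb{C}\setminus(\{|z|=1\}\cup\{\zeta_k,\zeta_k^{-1}\}_k)$, such that 1. $m$ extends continuously to the unit circle from the inside (boundary values $m_+$) and from the outside (boundary values $m_-$), and for $|z|=1$ $$m_+(z)=m_-(z)\begin{pmatrix}1-|R(z)|^2 & -\overline{R(z)}\,\mathrm{e}^{-t\Phi(z)}\\ R(z)\,\mathrm{e}^{t\Phi(z)} & 1\end{pmatrix};$$ 2. $m$ has at most simple poles at the points $\zeta_k,\zeta_k^{-1}$, and for every $k$ the limits on the right exist and $$\operatorname{Res}_{\zeta_k}m=\lim_{z\to\zeta_k}m(z)\begin{pmatrix}0&0\\-\zeta_k\gamma_k\mathrm{e}^{t\Phi(\zeta_k)}&0\end{pmatrix},\qquad \operatorname{Res}_{\zeta_k^{-1}}m=\lim_{z\to\zeta_k^{-1}}m(z)\begin{pmatrix}0&\zeta_k^{-1}\gamma_k\mathrm{e}^{t\Phi(\zeta_k)}\\0&0\end{pmatrix};$$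 3. $m(z^{-1})=m(z)\begin{pmatrix}0&1\\1&0\end{pmatrix}$ for $z\ne0$ off the unit circle and off the points $\zeta_k,\zeta_k^{-1}$; 4. $m(0)=(m_1\ \ m_2)$ with $m_1m_2=1$ and $m_1>0$. -/

import Mathlib

open Filter Topology
open scoped Matrix ComplexConjugate

noncomputable section

namespace TodaRHP

/-- A classical solution of the doubly infinite Toda lattice in Flaschka variables,
`b' = 2 (a(n)^2 - a(n-1)^2)`, `a' = a(n) (b(n+1) - b(n))`, with `a > 0`, defined for all times and
bounded in `n` locally uniformly in time, that is, a trajectory in the phase space of pairs of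
bounded real sequences. -/
structure IsTodaSolution (a b : ℤ → ℝ → ℝ) : Prop where
  pos : ∀ n t, 0 < a n t
  deriv_b : ∀ n t, HasDerivAt (b n) (2 * (a n t ^ 2 - a (n - 1) t ^ 2)) t
  deriv_a : ∀ n t, HasDerivAt (a n) (a n t * (b (n + 1) t - b n t)) t
  bdd : ∀ τ : ℝ, ∃ C : ℝ, ∀ n t, |t| ≤ τ → |a n t| ≤ C ∧ |b n t| ≤ C

/-- Convergence of a pair of sequences to the free background faster than every power:
`∑ |n|^l (|a(n) - 1/2| + |b(n)|) < ∞` for every `l`. -/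
def HasDecay (a b : ℤ → ℝ) : Prop :=
  ∀ l : ℕ, Summable fun n : ℤ => |(n : ℝ)| ^ l * (|a n - 1 / 2| + |b n|)

/-- The Jacobi difference expression
`(H u)(n) = a(n) u(n+1) + a(n-1) u(n-1) + b(n) u(n)`. -/
def jacobi (a b : ℤ → ℝ) (u : ℤ → ℂ) (n : ℤ) : ℂ :=
  a n * u (n + 1) + a (n - 1) * u (n - 1) + b n * u n

/-- `H u = (z + z⁻¹)/2 · u` as an equation between sequences. -/
def SolvesAt (a b : ℤ → ℝ) (z : ℂ) (u : ℤ → ℂ) : Prop :=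
  ∀ n, jacobi a b u n = (z + z⁻¹) / 2 * u n

open Classical in
/-- The right Jost function `ψ₊(z, ·)`, for `0 < |z| ≤ 1`: the solution of
`H ψ = (z + z⁻¹)/2 ψ` with `z ^ (-n) ψ(n) → 1` as `n → +∞` (such a solution is unique). -/
def jostPlus (a b : ℤ → ℝ) (z : ℂ) : ℤ → ℂ :=
  if h : ∃ u : ℤ → ℂ, SolvesAt a b z u ∧ Tendsto (fun n : ℤ => z ^ (-n) * u n) atTop (𝓝 1)
  then h.choose else 0

open Classical in
/-- The left Jost function `ψ₋(z, ·)`, for `0 < |z| ≤ 1`: the solution of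
`H ψ = (z + z⁻¹)/2 ψ` with `z ^ n ψ(n) → 1` as `n → -∞` (such a solution is unique). -/
def jostMinus (a b : ℤ → ℝ) (z : ℂ) : ℤ → ℂ :=
  if h : ∃ u : ℤ → ℂ, SolvesAt a b z u ∧ Tendsto (fun n : ℤ => z ^ n * u n) atBot (𝓝 1)
  then h.choose else 0

/-- The Wronskian `W(z) = a(n) (ψ₊(n) ψ₋(n+1) - ψ₊(n+1) ψ₋(n))` of the Jost functions. It does not
depend on `n` and is evaluated at `n = 0`. -/
def wronskian (a b : ℤ → ℝ) (z : ℂ) : ℂ :=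
  a 0 * (jostPlus a b z 0 * jostMinus a b z 1 - jostPlus a b z 1 * jostMinus a b z 0)

/-- The transmission coefficient `T(z) = (z⁻¹ - z) / (2 W(z))`. On the unit circle it is the
coefficient in the scattering relation `T ψ₋ = conj ψ₊ + R₊ ψ₊` (take Wronskians with `ψ₊`), and
inside the circle it is the meromorphic extension of that coefficient. -/
def transmission (a b : ℤ → ℝ) (z : ℂ) : ℂ :=
  (z⁻¹ - z) / (2 * wronskian a b z)

open Classical in
/-- The right reflection coefficient at a point `z ≠ ±1` of the unit circle: the number `r` of the
scattering relation `T(z) ψ₋(z, n) = conj (ψ₊(z, n)) + r ψ₊(z, n)` for all `n`. -/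
def reflectionAux (a b : ℤ → ℝ) (z : ℂ) : ℂ :=
  if h : ∃ r : ℂ, ∀ n, transmission a b z * jostMinus a b z n =
      conj (jostPlus a b z n) + r * jostPlus a b z n
  then h.choose else 0

/-- The right reflection coefficient `R = R₊` on the whole unit circle, the values at the band
edges `±1` being those of the continuous extension. -/
def reflection (a b : ℤ → ℝ) : ℂ → ℂ :=
  extendFrom {z : ℂ | ‖z‖ = 1 ∧ z ≠ 1 ∧ z ≠ -1} (reflectionAux a b)

/-- `lam` is an eigenvalue of the Jacobi operator in `ℓ²(ℤ)`. -/
def IsEigenvalue (a b : ℤ → ℝ) (lam : ℝ) : Prop :=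
  ∃ u : ℤ → ℂ, u ≠ 0 ∧ Memℓp u 2 ∧ ∀ n, jacobi a b u n = lam * u n

/-- The points `ζ ∈ (-1,0) ∪ (0,1)` for which `(ζ + ζ⁻¹)/2` is an eigenvalue. -/
def eigenPoints (a b : ℤ → ℝ) : Set ℝ :=
  {ζ | ζ ≠ 0 ∧ |ζ| < 1 ∧ IsEigenvalue a b ((ζ + ζ⁻¹) / 2)}

/-- The right norming constant, `γ⁻¹ = ∑ |ψ₊(ζ, n)|²`. -/
def normingConst (a b : ℤ → ℝ) (ζ : ℝ) : ℝ :=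
  (∑' n : ℤ, ‖jostPlus a b (ζ : ℂ) n‖ ^ 2)⁻¹

/-- `exp (t Φ(z))` for the phase `Φ(z) = z - z⁻¹ + 2 (n/t) log z`. It is single valued, because
`exp (2 n log z) = z ^ (2 n)`, and it makes sense at `t = 0` too. -/
def expPhase (n : ℤ) (t : ℝ) (z : ℂ) : ℂ :=
  z ^ (2 * n) * Complex.exp (t * (z - z⁻¹))

/-- The jump matrix on the unit circle. -/
def jumpMatrix (R : ℂ → ℂ) (n : ℤ) (t : ℝ) (z : ℂ) : Matrix (Fin 2) (Fin 2) ℂ :=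
  !![1 - (‖R z‖ : ℂ) ^ 2, -(conj (R z)) * (expPhase n t z)⁻¹;
     R z * expPhase n t z, 1]

/-- The set of all `ζ` and `ζ⁻¹` with `ζ ∈ Z`. -/
def poleSet (Z : Set ℝ) : Set ℂ :=
  {z | ∃ ζ ∈ Z, z = (ζ : ℂ) ∨ z = (ζ : ℂ)⁻¹}

/-- The condition `res_p m = lim_{z → p} m(z) N` at a point `p` where `m` has at most a simple pole:
the limit on the right exists, and the residue `lim_{z → p} (z - p) m(z)` exists and equals it. -/
def PoleCondition (m : ℂ → Fin 2 → ℂ) (p : ℂ) (N : Matrix (Fin 2) (Fin 2) ℂ) : Prop :=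
  ∃ L : Fin 2 → ℂ, Tendsto (fun z => m z ᵥ* N) (𝓝[≠] p) (𝓝 L) ∧
    Tendsto (fun z => (z - p) • m z) (𝓝[≠] p) (𝓝 L)

/-- `m` (a row vector, whose values on the unit circle and at the points of `poleSet Z` do not
matter) solves the vector Riemann-Hilbert problem with data `R`, `Z`, `γ` at the parameters `n`,
`t`. -/
structure IsRHPSolution (R : ℂ → ℂ) (Z : Set ℝ) (γ : ℝ → ℝ) (n : ℤ) (t : ℝ)
    (m : ℂ → Fin 2 → ℂ) : Prop where
  /-- `m` is holomorphic off the unit circle and off the prescribed poles. -/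
  holomorphic : ∀ z, ‖z‖ ≠ 1 → z ∉ poleSet Z → DifferentiableAt ℂ m z
  /-- `m` extends continuously to the unit circle from the inside (`mp`) and from the outside
  (`mm`), and the two boundary values satisfy `mp = mm v`. -/
  jump : ∀ z, ‖z‖ = 1 → ∃ mp mm : Fin 2 → ℂ,
    Tendsto m (𝓝[{w | ‖w‖ < 1}] z) (𝓝 mp) ∧ Tendsto m (𝓝[{w | 1 < ‖w‖}] z) (𝓝 mm) ∧
      mp = mm ᵥ* jumpMatrix R n t z
  pole : ∀ ζ ∈ Z, PoleCondition m ζ !![0, 0; -ζ * γ ζ * expPhase n t ζ, 0]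
  pole_inv : ∀ ζ ∈ Z, PoleCondition m (ζ : ℂ)⁻¹ !![0, (ζ : ℂ)⁻¹ * γ ζ * expPhase n t ζ; 0, 0]
  symmetric : ∀ z, z ≠ 0 → ‖z‖ ≠ 1 → z ∉ poleSet Z → m z⁻¹ = m z ᵥ* !![0, 1; 1, 0]
  normalized : m 0 0 * m 0 1 = 1 ∧ ∃ A : ℝ, 0 < A ∧ m 0 0 = A

/-- The defining formula of `m`, in terms of the Jost functions and the transmission coefficient,
for `z ≠ 0` off the unit circle. -/
def mFormula (a b : ℤ → ℝ) (n : ℤ) (z : ℂ) : Fin 2 → ℂ :=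
  if ‖z‖ < 1 then
    ![transmission a b z * jostMinus a b z n * z ^ n, jostPlus a b z n * z ^ (-n)]
  else
    ![jostPlus a b z⁻¹ n * z ^ n, transmission a b z⁻¹ * jostMinus a b z⁻¹ n * z ^ (-n)]

/-- The function `m(z, n)` of a Jacobi operator; its value at the removable singularity `z = 0` is
the limit there. -/
def mJost (a b : ℤ → ℝ) (n : ℤ) : ℂ → Fin 2 → ℂ :=
  Function.update (mFormula a b n) 0 (limUnder (𝓝[≠] 0) (mFormula a b n))

end TodaRHP

end

/-!
The proof has four ingredients.

*Direct scattering.* Up to an explicit amplitude, the right Jost solution is `z ^ n g₊(z, n)`,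
where `g₊` is the limit of polynomials in `z` obtained by cutting off the perturbation (`JostRec`,
`jostPolyAux`, `jostG`). A stability estimate for the recursion that is uniform in the closed disc
(`jostRec_stability`) makes the limit holomorphic inside and, by Parseval's identity for the
coefficients, differentiable up to the circle. The left Jost solution comes from reflection of the
lattice. Normalizing the Wronskian of the two to be `1` at the origin gives the function `jostW`.
Its zeros in the disc are real and correspond to the eigenvalues (`mem_eigenPoints_iff`), they are
simple, and the derivative there is given by the norming constant (`hasDerivAt_jostW`). On the
circle `jostW` can vanish only at `±1`, to first order at most, so that `(1 - z ^ 2) / jostW` has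
boundary values everywhere (`exists_tendsto_one_sub_sq_div_jostW`); hence there are finitely many
eigenvalues.

*Time evolution.* Decay propagates along the Toda flow (`IsTodaSolution.exists_rapidDecay`), and
both Jost solutions satisfy the equation of the Lax pair up to a scalar (`laxEvolves_psiPlus`,
`laxEvolves_psiMinus`). Wronskians of such solutions are exponentials in time (`wr_eq_exp_mul`),
which gives the evolution of the reflection coefficient and of the proportionality factor between
the Jost solutions at an eigenvalue.

*Existence.* Inside the disc the vector `m` equals `innerM`, outside it is the exchange of
components of `innerM` at `z⁻¹`. The jump condition is the scattering relation at `z` and at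
`z⁻¹`; it holds off `±1` and passes to `±1` by continuity along the circle. The residue conditions
follow from the derivative of the Wronskian.

*Uniqueness.* A suitable combination `h` of two solutions solves the homogeneous problem with
`h₁(0) = 0`. The function `h₁(z) conj (h₂(conj z)) + h₂(z) conj (h₁(conj z))` vanishes at the
origin, has real part `(1 - |R|²) |k₁|² + |k₂|²` on the circle, `k` being the outer boundary value
of `h`, and its residue at a pole `ζ` is a nonpositive multiple of `ζ`. Removing the poles by
multiples of `z / (z - ζ)`, which have positive real part on the circle, leaves a holomorphic
function whose real part must vanish by the maximum principle; therefore `h` has neither boundary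
values nor poles and is zero (`IsHomogeneousSolution.eq_zero`). The normalization at the origin
then identifies the two solutions.
-/

noncomputable section

namespace TodaRHP

open Polynomial

/-! ### Polynomials on the closed unit disc -/

theorem norm_pow_sub_pow_le {z w : ℂ} (hz : ‖z‖ ≤ 1) (hw : ‖w‖ ≤ 1) (i : ℕ) :
    ‖z ^ i - w ^ i‖ ≤ i * ‖z - w‖ := by
  induction i with
  | zero => simp
  | succ k ih =>
    have h : z ^ (k + 1) - w ^ (k + 1) = z ^ k * (z - w) + (z ^ k - w ^ k) * w := by ring
    rw [h]
    refine (norm_add_le _ _).trans ?_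
    rw [norm_mul, norm_mul, norm_pow]
    have h1 : ‖z‖ ^ k ≤ 1 := pow_le_one₀ (norm_nonneg _) hz
    have h2 := norm_nonneg (z - w)
    have h3 := norm_nonneg (z ^ k - w ^ k)
    push_cast
    nlinarith [norm_nonneg w]

/-- Parseval's identity bounds every coefficient by the supremum on the unit circle. -/
theorem norm_coeff_le_of_circle {p : ℂ[X]} {B : ℝ} (hB : ∀ z : ℂ, ‖z‖ = 1 → ‖p.eval z‖ ≤ B)
    (i : ℕ) : ‖p.coeff i‖ ≤ B := by
  have hB0 : 0 ≤ B := (norm_nonneg _).trans (hB 1 (by simp))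
  by_cases hi : i ∈ p.support
  · have h1 : ‖p.coeff i‖ ^ 2 ≤ B ^ 2 := by
      calc ‖p.coeff i‖ ^ 2 ≤ ∑ i ∈ p.support, ‖p.coeff i‖ ^ 2 :=
            Finset.single_le_sum (f := fun i => ‖p.coeff i‖ ^ 2) (fun _ _ => by positivity) hi
        _ = Real.circleAverage (fun θ ↦ ‖p.eval θ‖ ^ 2) 0 1 :=
            Polynomial.sum_sq_norm_coeff_eq_circleAverage p
        _ ≤ B ^ 2 := by
            apply Real.circleAverage_mono_on_of_le_circle
            · apply ContinuousOn.circleIntegrable zero_le_one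
              fun_prop
            · intro x hx
              have hx1 : ‖x‖ = 1 := by simpa using hx
              have := hB x hx1
              gcongr
    exact (sq_le_sq₀ (norm_nonneg _) hB0).mp h1
  · rw [Polynomial.notMem_support_iff.mp hi]; simpa using hB0

theorem norm_eval_sub_le_of_natDegree {p : ℂ[X]} {B : ℝ} {D : ℕ} (hD : p.natDegree ≤ D)
    (hB : ∀ z : ℂ, ‖z‖ = 1 → ‖p.eval z‖ ≤ B) {z w : ℂ} (hz : ‖z‖ ≤ 1) (hw : ‖w‖ ≤ 1) :
    ‖p.eval z - p.eval w‖ ≤ (D + 1) ^ 2 * B * ‖z - w‖ := by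
  have hB0 : 0 ≤ B := (norm_nonneg _).trans (hB 1 (by simp))
  rw [Polynomial.eval_eq_sum_range' (Nat.lt_succ_of_le hD),
    Polynomial.eval_eq_sum_range' (Nat.lt_succ_of_le hD), ← Finset.sum_sub_distrib]
  calc ‖∑ i ∈ Finset.range (D + 1), (p.coeff i * z ^ i - p.coeff i * w ^ i)‖
      ≤ ∑ i ∈ Finset.range (D + 1), (D + 1) * B * ‖z - w‖ := by
        refine norm_sum_le_of_le _ fun i hi => ?_
        rw [← mul_sub, norm_mul]
        have h1 := norm_coeff_le_of_circle hB i
        have h2 := norm_pow_sub_pow_le hz hw i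
        have h3 : (i : ℝ) ≤ D + 1 := by exact_mod_cast (Finset.mem_range.mp hi).le
        calc ‖p.coeff i‖ * ‖z ^ i - w ^ i‖ ≤ B * ((D + 1) * ‖z - w‖) := by
              gcongr
              exact h2.trans (by gcongr)
          _ = _ := by ring
    _ = _ := by simp; ring

/-- A series of polynomials whose suprema on the circle decay fast relative to the squared degrees
is differentiable on the closed disc, boundary points included. -/
theorem exists_hasDerivWithinAt_tsum_eval {p : ℕ → ℂ[X]} {B : ℕ → ℝ} {D : ℕ → ℕ}
    (hD : ∀ k, (p k).natDegree ≤ D k) (hB : ∀ k (z : ℂ), ‖z‖ ≤ 1 → ‖(p k).eval z‖ ≤ B k)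
    (hsum : Summable fun k => ((D k : ℝ) + 1) ^ 2 * B k) {w : ℂ} (hw : ‖w‖ ≤ 1) :
    ∃ d, HasDerivWithinAt (fun z => ∑' k, (p k).eval z) d (Metric.closedBall 0 1) w := by
  have hB0 : ∀ k, 0 ≤ B k := fun k => (norm_nonneg _).trans (hB k 1 (by simp))
  have hBs : Summable B := by
    refine Summable.of_nonneg_of_le hB0 (fun k => ?_) hsum
    have : (1 : ℝ) ≤ ((D k : ℝ) + 1) ^ 2 := by
      have : (0 : ℝ) ≤ D k := by positivity
      nlinarith
    nlinarith [hB0 k]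
  refine ⟨∑' k, (derivative (p k)).eval w, ?_⟩
  rw [hasDerivWithinAt_iff_tendsto_slope]
  have hmem : ∀ᶠ z in 𝓝[Metric.closedBall (0 : ℂ) 1 \ {w}] w, ‖z‖ ≤ 1 ∧ z ≠ w := by
    filter_upwards [self_mem_nhdsWithin] with z hz
    exact ⟨by simpa using hz.1, hz.2⟩
  have key : Tendsto (fun z => ∑' k, slope (fun z => (p k).eval z) w z)
      (𝓝[Metric.closedBall (0 : ℂ) 1 \ {w}] w) (𝓝 (∑' k, (derivative (p k)).eval w)) := by
    apply tendsto_tsum_of_dominated_convergence hsum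
    · intro k
      have := (p k).hasDerivAt w
      exact (hasDerivAt_iff_tendsto_slope.mp this).mono_left
        (nhdsWithin_mono _ (fun x hx => hx.2))
    · filter_upwards [hmem] with z hz k
      rw [slope_def_field, norm_div]
      have h0 : 0 < ‖z - w‖ := norm_pos_iff.mpr (sub_ne_zero.mpr hz.2)
      rw [div_le_iff₀ h0]
      exact norm_eval_sub_le_of_natDegree (hD k) (fun z h => hB k z h.le) hz.1 hw
  refine key.congr' ?_
  filter_upwards [hmem] with z hz
  rw [slope_def_field]
  simp_rw [slope_def_field]
  rw [tsum_div_const, Summable.tsum_sub]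
  · exact Summable.of_norm_bounded hBs fun k => hB k z hz.1
  · exact Summable.of_norm_bounded hBs fun k => hB k w hw

/-! ### Stability of the Jost recursion -/

/-- Quantitative decay of a Jacobi coefficient pair to the free background, in the form in which the
perturbation enters the recursion for the Jost solutions. The exponent `6` suffices for the
convergence of all the weighted sums below; the decay of the actual solution is faster. -/
structure RapidDecay (M : ℝ) (a b : ℤ → ℝ) : Prop where
  pos : ∀ n, 0 < a n
  bound : ∀ n : ℤ, |4 * a n ^ 2 - 1| + |2 * b n| ≤ M / (1 + |(n : ℝ)|) ^ 6

/-- `x` satisfies at the site `n` the recursion obtained from `H ψ = (z + z⁻¹)/2 ψ` by the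
substitution `ψ(n) = z ^ n (∏_{j ≥ n} 1 / (2 a(j))) x(n)`. -/
def JostRec (a b : ℤ → ℝ) (z : ℂ) (x : ℤ → ℂ) (n : ℤ) : Prop :=
  x (n - 1) = (1 + z ^ 2 - 2 * b n * z) * x n - 4 * a n ^ 2 * z ^ 2 * x (n + 1)

theorem RapidDecay.nonneg {M : ℝ} {a b : ℤ → ℝ} (h : RapidDecay M a b) : 0 ≤ M := by
  have := h.bound 0
  simp only [Int.cast_zero, abs_zero, add_zero, one_pow, div_one] at this
  exact (by positivity : (0:ℝ) ≤ _).trans this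

theorem summable_int_one_add_abs_pow {p : ℕ} (hp : 1 < p) :
    Summable fun j : ℤ => 1 / (1 + |(j : ℝ)|) ^ p := by
  have h : Summable fun k : ℕ => 1 / (1 + (k : ℝ)) ^ p := by
    have := (summable_nat_add_iff 1).mpr (Real.summable_one_div_nat_pow.mpr hp)
    refine this.congr fun k => ?_
    push_cast; rw [add_comm]
  apply Summable.of_nat_of_neg <;> simpa using h

/-- The sum `∑ (1 + |j|)⁻⁵` over the integers. -/
def weightSum : ℝ := ∑' j : ℤ, 1 / (1 + |(j : ℝ)|) ^ 5

/-- The stability constant of the Jost recursion between `+∞` and the site `m`. It stays bounded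
as `m → +∞`. -/
def stabConst (M : ℝ) (m : ℤ) : ℝ := Real.exp ((1 + |min (m : ℝ) 0|) * M * weightSum)

theorem one_le_stabConst {M : ℝ} (hM : 0 ≤ M) (m : ℤ) : 1 ≤ stabConst M m := by
  apply Real.one_le_exp
  have : 0 ≤ weightSum := tsum_nonneg fun j => by positivity
  positivity

/-- One step of the recursion to the left. -/
theorem jostRec_step {M : ℝ} {a b : ℤ → ℝ} (h : RapidDecay M a b) {z : ℂ} (hz : ‖z‖ ≤ 1)
    {x : ℤ → ℂ} {m n : ℤ} (hmn : m < n) (hx : JostRec a b z x n) :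
    max ‖x (n - 1)‖ ‖x n‖ + ((n - 1 : ℤ) - m : ℝ) * ‖x (n - 1) - x n‖ ≤
      (1 + (1 + |min (m : ℝ) 0|) * M * (1 / (1 + |(n : ℝ)|) ^ 5)) *
        (max ‖x n‖ ‖x (n + 1)‖ + ((n : ℝ) - m) * ‖x n - x (n + 1)‖) := by
  set c := |4 * a n ^ 2 - 1| + |2 * b n| with hc
  set X := max ‖x n‖ ‖x (n + 1)‖ with hX
  set d := ‖x n - x (n + 1)‖ with hd
  have hX0 : 0 ≤ X := (norm_nonneg _).trans (le_max_left _ _)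
  have hd0 : 0 ≤ d := norm_nonneg _
  have hc0 : 0 ≤ c := by positivity
  have e1 : x (n - 1) - x n = z ^ 2 * (x n - x (n + 1)) - ((2 * b n : ℝ) : ℂ) * z * x n
      - ((4 * a n ^ 2 - 1 : ℝ) : ℂ) * z ^ 2 * x (n + 1) := by
    rw [hx]; push_cast; ring
  have hz2 : ‖z‖ ^ 2 ≤ 1 := pow_le_one₀ (norm_nonneg _) hz
  have e2 : ‖x (n - 1) - x n‖ ≤ d + c * X := by
    rw [e1]
    refine (norm_sub_le _ _).trans ?_
    have t1 : ‖z ^ 2 * (x n - x (n + 1)) - ((2 * b n : ℝ) : ℂ) * z * x n‖ ≤ d + |2 * b n| * X := by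
      refine (norm_sub_le _ _).trans ?_
      apply add_le_add
      · rw [norm_mul, norm_pow]
        exact mul_le_of_le_one_left hd0 hz2
      · rw [norm_mul, norm_mul, Complex.norm_real, Real.norm_eq_abs]
        calc |2 * b n| * ‖z‖ * ‖x n‖ ≤ |2 * b n| * 1 * X := by
              gcongr; exact le_max_left _ _
          _ = _ := by ring
    have t2 : ‖((4 * a n ^ 2 - 1 : ℝ) : ℂ) * z ^ 2 * x (n + 1)‖ ≤ |4 * a n ^ 2 - 1| * X := by
      rw [norm_mul, norm_mul, norm_pow, Complex.norm_real, Real.norm_eq_abs]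
      calc |4 * a n ^ 2 - 1| * ‖z‖ ^ 2 * ‖x (n + 1)‖ ≤ |4 * a n ^ 2 - 1| * 1 * X := by
              gcongr; exact le_max_right _ _
        _ = _ := by ring
    rw [hc]; linarith
  have e3 : max ‖x (n - 1)‖ ‖x n‖ ≤ X + (d + c * X) := by
    apply max_le
    · have : x (n - 1) = x n + (x (n - 1) - x n) := by ring
      rw [this]
      exact (norm_add_le _ _).trans (add_le_add (le_max_left _ _) e2)
    · have : 0 ≤ d + c * X := by positivity
      exact (le_max_left _ _).trans (by linarith)
  have hnm : (1 : ℝ) ≤ (n : ℝ) - m := by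
    have : (1 : ℤ) ≤ n - m := by omega
    exact_mod_cast this
  have hw : ((n : ℝ) - m) * c ≤ (1 + |min (m : ℝ) 0|) * M * (1 / (1 + |(n : ℝ)|) ^ 5) := by
    have h1 : (n : ℝ) - m ≤ (1 + |min (m : ℝ) 0|) * (1 + |(n : ℝ)|) := by
      have h2 : (n : ℝ) - m ≤ |(n : ℝ)| + |min (m : ℝ) 0| := by
        have := le_abs_self (n : ℝ)
        have := neg_abs_le (min (m : ℝ) 0)
        have := min_le_left (m : ℝ) 0
        linarith
      nlinarith [abs_nonneg (n : ℝ), abs_nonneg (min (m : ℝ) 0)]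
    calc ((n : ℝ) - m) * c
        ≤ ((1 + |min (m : ℝ) 0|) * (1 + |(n : ℝ)|)) * (M / (1 + |(n : ℝ)|) ^ 6) := by
          gcongr
          exact h.bound n
      _ = _ := by
          have : (1 + |(n : ℝ)|) ≠ 0 := by positivity
          field_simp
  have hnm' : ((n - 1 : ℤ) - m : ℝ) = (n : ℝ) - m - 1 := by push_cast; ring
  rw [hnm']
  have hY : 0 ≤ X + ((n : ℝ) - m) * d := by nlinarith
  calc max ‖x (n - 1)‖ ‖x n‖ + ((n : ℝ) - m - 1) * ‖x (n - 1) - x n‖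
      ≤ X + (d + c * X) + ((n : ℝ) - m - 1) * (d + c * X) := by
        gcongr
    _ = X + ((n : ℝ) - m) * d + (((n : ℝ) - m) * c) * X := by ring
    _ ≤ X + ((n : ℝ) - m) * d + (((n : ℝ) - m) * c) * (X + ((n : ℝ) - m) * d) := by
        gcongr
        nlinarith
    _ = (1 + ((n : ℝ) - m) * c) * (X + ((n : ℝ) - m) * d) := by ring
    _ ≤ _ := by gcongr

/-- Stability: a solution of the recursion on `(m, N]` is controlled at `m` by its data at `N`, with
only linear growth in the number of steps. -/
theorem jostRec_stability {M : ℝ} {a b : ℤ → ℝ} (h : RapidDecay M a b) {z : ℂ} (hz : ‖z‖ ≤ 1)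
    {x : ℤ → ℂ} {m N : ℤ} (hmN : m ≤ N) (hx : ∀ n, m < n → n ≤ N → JostRec a b z x n) {δ : ℝ}
    (h0 : ‖x N‖ ≤ δ) (h1 : ‖x (N + 1)‖ ≤ δ) :
    ‖x m‖ ≤ stabConst M m * (1 + 2 * ((N : ℝ) - m)) * δ := by
  have hM := h.nonneg
  -- the size of the solution plus its increment, the latter weighted by the number of steps left
  set Y : ℤ → ℝ := fun n => max ‖x n‖ ‖x (n + 1)‖ + ((n : ℝ) - m) * ‖x n - x (n + 1)‖ with hY
  set w : ℤ → ℝ := fun n => (1 + |min (m : ℝ) 0|) * M * (1 / (1 + |(n : ℝ)|) ^ 5) with hw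
  have hw0 : ∀ n, 0 ≤ w n := fun n => by positivity
  have hws : Summable w := (summable_int_one_add_abs_pow (by norm_num)).mul_left _
  have hδ : 0 ≤ δ := (norm_nonneg _).trans h0
  have hY0 : 0 ≤ Y N := by
    have : (m : ℝ) ≤ N := by exact_mod_cast hmN
    have : 0 ≤ (N : ℝ) - m := by linarith
    have : 0 ≤ max ‖x N‖ ‖x (N + 1)‖ := (norm_nonneg _).trans (le_max_left _ _)
    positivity
  have ind : ∀ k : ℕ, (m : ℤ) ≤ N - k →
      Y (N - k) ≤ Real.exp (∑ i ∈ Finset.range k, w (N - i)) * Y N := by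
    intro k
    induction k with
    | zero => intro _; simp
    | succ k ih =>
      intro hk
      have hlt : m < N - k := by push_cast at hk; omega
      have hs := jostRec_step h hz hlt (hx _ hlt (by omega))
      have e : N - ((k + 1 : ℕ) : ℤ) = N - k - 1 := by push_cast; ring
      have e' : N - k - 1 + 1 = N - (k : ℤ) := by ring
      have hs' : Y (N - k - 1) ≤ (1 + w (N - k)) * Y (N - k) := by
        simp only [hY, hw, e']
        exact hs
      rw [e, Finset.sum_range_succ, Real.exp_add]
      calc Y (N - k - 1) ≤ (1 + w (N - k)) * Y (N - k) := hs'
        _ ≤ (1 + w (N - k)) * (Real.exp (∑ i ∈ Finset.range k, w (N - i)) * Y N) := by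
            have := hw0 (N - k)
            gcongr
            exact ih hlt.le
        _ ≤ Real.exp (w (N - k)) * (Real.exp (∑ i ∈ Finset.range k, w (N - i)) * Y N) := by
            gcongr
            linarith [Real.add_one_le_exp (w (N - k))]
        _ = _ := by ring
  have hk := ind (N - m).toNat (by omega)
  have e : N - ((N - m).toNat : ℤ) = m := by omega
  rw [e] at hk
  have hsum : ∑ i ∈ Finset.range (N - m).toNat, w (N - i) ≤
      (1 + |min (m : ℝ) 0|) * M * weightSum := by
    have hinj : Function.Injective fun i : ℕ => N - (i : ℤ) := fun i j hij => by
      simp only at hij; omega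
    have e1 : ∑ i ∈ Finset.range (N - m).toNat, w (N - i) =
        ∑ j ∈ (Finset.range (N - m).toNat).map ⟨_, hinj⟩, w j := by
      rw [Finset.sum_map]; rfl
    rw [e1, weightSum, ← tsum_mul_left]
    exact hws.sum_le_tsum _ fun j _ => hw0 j
  have hYN : Y N ≤ (1 + 2 * ((N : ℝ) - m)) * δ := by
    have hm : (m : ℝ) ≤ N := by exact_mod_cast hmN
    have hd : ‖x N - x (N + 1)‖ ≤ 2 * δ := (norm_sub_le _ _).trans (by linarith)
    have hmx : max ‖x N‖ ‖x (N + 1)‖ ≤ δ := max_le h0 h1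
    simp only [hY]
    nlinarith
  calc ‖x m‖ ≤ Y m := by simp [hY]
    _ ≤ Real.exp (∑ i ∈ Finset.range (N - m).toNat, w (N - i)) * Y N := hk
    _ ≤ stabConst M m * ((1 + 2 * ((N : ℝ) - m)) * δ) := by
        unfold stabConst
        gcongr
    _ = _ := by ring

/-! ### Construction of the Jost solutions -/

/-- The solution of the Jost recursion with the constant data `1` at the sites `N + 1` and `N`, as a
polynomial in `z`; the second argument counts the steps to the left from `N + 1`. -/
def jostPolyAux (a b : ℤ → ℝ) (N : ℤ) : ℕ → ℝ[X]
  | 0 => 1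
  | 1 => 1
  | k + 2 => (1 + X ^ 2 - C (2 * b (N - k)) * X) * jostPolyAux a b N (k + 1) -
      C (4 * a (N - k) ^ 2) * X ^ 2 * jostPolyAux a b N k

/-- The value at `n` of the solution of the Jost recursion that equals `1` from the site `N` on,
that is, of the Jost solution of the background cut off beyond `N`. -/
def jostApprox (a b : ℤ → ℝ) (N : ℤ) (z : ℂ) (n : ℤ) : ℂ :=
  aeval z (jostPolyAux a b N (N + 1 - n).toNat)

theorem jostApprox_of_le (a b : ℤ → ℝ) {N n : ℤ} (h : N ≤ n) (z : ℂ) :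
    jostApprox a b N z n = 1 := by
  unfold jostApprox
  have : (N + 1 - n).toNat = 0 ∨ (N + 1 - n).toNat = 1 := by omega
  rcases this with h | h <;> rw [h] <;> simp [jostPolyAux]

theorem jostRec_jostApprox (a b : ℤ → ℝ) {N n : ℤ} (h : n ≤ N) (z : ℂ) :
    JostRec a b z (jostApprox a b N z) n := by
  obtain ⟨k, rfl⟩ : ∃ k : ℕ, n = N - k := ⟨(N - n).toNat, by omega⟩
  have e1 : (N + 1 - (N - k - 1 : ℤ)).toNat = k + 2 := by omega
  have e2 : (N + 1 - (N - k : ℤ)).toNat = k + 1 := by omega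
  have e3 : (N + 1 - (N - k + 1 : ℤ)).toNat = k := by omega
  unfold JostRec jostApprox
  rw [e1, e2, e3, jostPolyAux]
  simp

theorem natDegree_jostPolyAux_le (a b : ℤ → ℝ) (N : ℤ) (k : ℕ) :
    (jostPolyAux a b N k).natDegree ≤ 2 * k := by
  induction k using Nat.strong_induction_on with
  | _ k ih =>
    match k, ih with
    | 0, _ => simp [jostPolyAux]
    | 1, _ => simp [jostPolyAux]
    | k + 2, ih =>
      have h1 := ih (k + 1) (by omega)
      have h0 := ih k (by omega)
      rw [jostPolyAux]
      have hq : (1 + X ^ 2 - C (2 * b (N - k)) * X : ℝ[X]).natDegree ≤ 2 := by compute_degree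
      have hr : (C (4 * a (N - k) ^ 2) * X ^ 2 : ℝ[X]).natDegree ≤ 2 := by compute_degree
      refine (natDegree_sub_le _ _).trans (max_le ?_ ?_)
      · exact natDegree_mul_le.trans (by omega)
      · exact natDegree_mul_le.trans (by omega)

theorem jostApprox_conj (a b : ℤ → ℝ) (N : ℤ) (z : ℂ) (n : ℤ) :
    jostApprox a b N (conj z) n = conj (jostApprox a b N z n) :=
  Polynomial.aeval_conj _ _

theorem jostApprox_zero (a b : ℤ → ℝ) (N n : ℤ) : jostApprox a b N 0 n = 1 := by
  have key : ∀ k : ℕ, aeval (0 : ℂ) (jostPolyAux a b N k) = 1 := by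
    intro k
    induction k using Nat.strong_induction_on with
    | _ k ih =>
      match k, ih with
      | 0, _ => simp [jostPolyAux]
      | 1, _ => simp [jostPolyAux]
      | k + 2, ih => simp [jostPolyAux, ih (k + 1) (by omega)]
  exact key _

/-- Moving the cut-off by one site changes the data by a term of the size of the perturbation. -/
theorem norm_jostApprox_succ_sub_le {M : ℝ} {a b : ℤ → ℝ} (h : RapidDecay M a b) {z : ℂ}
    (hz : ‖z‖ ≤ 1) {m N : ℤ} (hmN : m ≤ N) :
    ‖jostApprox a b (N + 1) z m - jostApprox a b N z m‖ ≤
      stabConst M m * (1 + 2 * ((N : ℝ) - m)) * (M / (1 + |((N + 1 : ℤ) : ℝ)|) ^ 6) := by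
  have hM := h.nonneg
  refine jostRec_stability h hz (x := fun n => jostApprox a b (N + 1) z n - jostApprox a b N z n)
    hmN (fun n _ hn => ?_) ?_ ?_
  · have h1 := jostRec_jostApprox a b (show n ≤ N + 1 by omega) z
    have h2 := jostRec_jostApprox a b hn z
    unfold JostRec at *
    simp only [h1, h2]; ring
  · have h1 := jostRec_jostApprox a b (le_refl (N + 1)) z
    unfold JostRec at h1
    rw [jostApprox_of_le a b (le_refl (N + 1)), jostApprox_of_le a b (by omega : N + 1 ≤ N + 1 + 1),
      add_sub_cancel_right] at h1
    rw [h1, jostApprox_of_le a b le_rfl]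
    have e : (1 + z ^ 2 - 2 * b (N + 1) * z) * 1 - 4 * a (N + 1) ^ 2 * z ^ 2 * 1 - 1 =
        -(((4 * a (N + 1) ^ 2 - 1 : ℝ) : ℂ) * z ^ 2) - ((2 * b (N + 1) : ℝ) : ℂ) * z := by
      push_cast; ring
    rw [e]
    refine (norm_sub_le _ _).trans (le_trans ?_ (h.bound (N + 1)))
    rw [norm_neg, norm_mul, norm_mul, Complex.norm_real, Complex.norm_real, norm_pow]
    apply add_le_add
    · exact mul_le_of_le_one_right (norm_nonneg _) (pow_le_one₀ (norm_nonneg _) hz)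
    · exact mul_le_of_le_one_right (norm_nonneg _) hz
  · rw [jostApprox_of_le a b le_rfl, jostApprox_of_le a b (by omega : N ≤ N + 1)]
    simp only [sub_self, norm_zero]
    positivity

/-- Bound for the change at `m` when the cut-off moves from `m + k` to `m + k + 1`. It depends on
the coefficients through `M` only. -/
def jostBound (M : ℝ) (m : ℤ) (k : ℕ) : ℝ :=
  stabConst M m * (1 + 2 * k) * (M / (1 + |((m + k + 1 : ℤ) : ℝ)|) ^ 6)

theorem jostBound_nonneg {M : ℝ} (hM : 0 ≤ M) (m : ℤ) (k : ℕ) : 0 ≤ jostBound M m k := by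
  unfold jostBound stabConst; positivity

theorem one_add_le_mul_one_add_abs (m : ℤ) (k : ℕ) :
    1 + (k : ℝ) ≤ (1 + |(m : ℝ)|) * (1 + |((m + k + 1 : ℤ) : ℝ)|) := by
  have h1 := le_abs_self ((m + k + 1 : ℤ) : ℝ)
  have h2 := neg_abs_le (m : ℝ)
  have h2' := le_abs_self (m : ℝ)
  have h3 := abs_nonneg ((m + k + 1 : ℤ) : ℝ)
  push_cast at *
  nlinarith [abs_nonneg (m : ℝ)]

theorem summable_shift (m : ℤ) {p : ℕ} (hp : 1 < p) :
    Summable fun k : ℕ => 1 / (1 + |((m + k + 1 : ℤ) : ℝ)|) ^ p :=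
  (summable_int_one_add_abs_pow hp).comp_injective (i := fun k : ℕ => m + k + 1)
    (fun i j hij => by simp only at hij; omega)

theorem summable_degree_mul_jostBound {M : ℝ} (hM : 0 ≤ M) (m : ℤ) :
    Summable fun k : ℕ => (((2 * (k + 2) : ℕ) : ℝ) + 1) ^ 2 * jostBound M m k := by
  refine Summable.of_nonneg_of_le (fun k => ?_) (fun k => ?_)
    ((summable_shift m (p := 3) (by norm_num)).mul_left
      (stabConst M m * 50 * M * (1 + |(m : ℝ)|) ^ 3))
  · have := jostBound_nonneg hM m k
    positivity
  · have hk := one_add_le_mul_one_add_abs m k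
    set q := 1 + |((m + k + 1 : ℤ) : ℝ)| with hq
    have hq0 : 0 < q := by positivity
    have hS := one_le_stabConst hM m
    have hk0 : (0 : ℝ) ≤ k := by positivity
    have h3 : (((2 * (k + 2) : ℕ) : ℝ) + 1) ^ 2 * (1 + 2 * k) ≤ 50 * ((1 + |(m : ℝ)|) * q) ^ 3 := by
      calc (((2 * (k + 2) : ℕ) : ℝ) + 1) ^ 2 * (1 + 2 * k) ≤ (5 * (1 + k)) ^ 2 * (2 * (1 + k)) := by
            gcongr
            · push_cast; linarith
            · linarith
        _ = 50 * (1 + k : ℝ) ^ 3 := by ring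
        _ ≤ _ := by gcongr
    unfold jostBound
    rw [← hq]
    calc (((2 * (k + 2) : ℕ) : ℝ) + 1) ^ 2 * (stabConst M m * (1 + 2 * k) * (M / q ^ 6))
        = stabConst M m * (M / q ^ 6) * ((((2 * (k + 2) : ℕ) : ℝ) + 1) ^ 2 * (1 + 2 * k)) := by ring
      _ ≤ stabConst M m * (M / q ^ 6) * (50 * ((1 + |(m : ℝ)|) * q) ^ 3) := by gcongr
      _ = _ := by field_simp

theorem summable_jostBound {M : ℝ} (hM : 0 ≤ M) (m : ℤ) : Summable (jostBound M m) := by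
  refine Summable.of_nonneg_of_le (jostBound_nonneg hM m) (fun k => ?_)
    (summable_degree_mul_jostBound hM m)
  have h0 := jostBound_nonneg hM m k
  have : (1 : ℝ) ≤ (((2 * (k + 2) : ℕ) : ℝ) + 1) ^ 2 := by
    have : (0 : ℝ) ≤ ((2 * (k + 2) : ℕ) : ℝ) := by positivity
    nlinarith
  nlinarith

/-- The normalized right Jost solution `g₊(z, n) = z ^ (-n) (∏_{j ≥ n} 2 a(j)) ψ₊(z, n)`, as the
limit of `jostApprox` when the cut-off tends to `+∞`. -/
def jostG (a b : ℤ → ℝ) (n : ℤ) (z : ℂ) : ℂ :=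
  1 + ∑' k : ℕ, (jostApprox a b (n + k + 1) z n - jostApprox a b (n + k) z n)

theorem norm_jostApprox_step_le {M : ℝ} {a b : ℤ → ℝ} (h : RapidDecay M a b) {z : ℂ}
    (hz : ‖z‖ ≤ 1) (n : ℤ) (k : ℕ) :
    ‖jostApprox a b (n + k + 1) z n - jostApprox a b (n + k) z n‖ ≤ jostBound M n k := by
  have := norm_jostApprox_succ_sub_le h hz (show n ≤ n + k by omega)
  unfold jostBound
  push_cast at this ⊢
  convert this using 3
  ring

theorem jostG_sub_jostApprox {M : ℝ} {a b : ℤ → ℝ} (h : RapidDecay M a b) {z : ℂ}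
    (hz : ‖z‖ ≤ 1) (n : ℤ) (K : ℕ) :
    ‖jostG a b n z - jostApprox a b (n + K) z n‖ ≤ ∑' k, jostBound M n (k + K) := by
  have hM := h.nonneg
  set D : ℕ → ℂ := fun k => jostApprox a b (n + k + 1) z n - jostApprox a b (n + k) z n with hD
  have hDs : Summable D :=
    Summable.of_norm_bounded (summable_jostBound hM n) (norm_jostApprox_step_le h hz n)
  have tele : jostApprox a b (n + K) z n = 1 + ∑ k ∈ Finset.range K, D k := by
    induction K with
    | zero => simp [jostApprox_of_le]
    | succ K ih =>
      rw [Finset.sum_range_succ, ← add_assoc, ← ih]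
      simp only [hD]
      push_cast
      rw [add_assoc n]; ring
  have e : jostG a b n z - jostApprox a b (n + K) z n = ∑' k, D (k + K) := by
    rw [tele, jostG, ← hDs.sum_add_tsum_nat_add K]; ring
  rw [e]
  exact tsum_of_norm_bounded ((summable_nat_add_iff K).mpr (summable_jostBound hM n)).hasSum
    fun k => norm_jostApprox_step_le h hz n (k + K)

theorem tendsto_jostBound_tail (M : ℝ) (n : ℤ) :
    Tendsto (fun K => ∑' k, jostBound M n (k + K)) atTop (𝓝 0) :=
  tendsto_sum_nat_add _

theorem tendsto_jostApprox {M : ℝ} {a b : ℤ → ℝ} (h : RapidDecay M a b) {z : ℂ}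
    (hz : ‖z‖ ≤ 1) (n : ℤ) : Tendsto (fun N : ℕ => jostApprox a b N z n) atTop (𝓝 (jostG a b n z)) := by
  have h1 : Tendsto (fun K : ℕ => jostApprox a b (n + K) z n) atTop (𝓝 (jostG a b n z)) := by
    rw [tendsto_iff_norm_sub_tendsto_zero]
    refine squeeze_zero (fun _ => norm_nonneg _) (fun K => ?_) (tendsto_jostBound_tail M n)
    rw [norm_sub_rev]
    exact jostG_sub_jostApprox h hz n K
  have h2 : Tendsto (fun N : ℕ => (N - n).toNat) atTop atTop := by
    rw [tendsto_atTop]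
    intro c
    filter_upwards [eventually_ge_atTop (n.natAbs + c)] with N hN
    omega
  refine (h1.comp h2).congr' ?_
  filter_upwards [eventually_ge_atTop n.natAbs] with N hN
  have : n + ((N - n).toNat : ℤ) = N := by omega
  rw [Function.comp_apply, this]

theorem jostRec_jostG {M : ℝ} {a b : ℤ → ℝ} (h : RapidDecay M a b) {z : ℂ}
    (hz : ‖z‖ ≤ 1) (n : ℤ) : JostRec a b z (fun n => jostG a b n z) n := by
  have h1 := tendsto_jostApprox h hz (n - 1)
  have h2 := ((tendsto_jostApprox h hz n).const_mul (1 + z ^ 2 - 2 * b n * z)).sub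
    ((tendsto_jostApprox h hz (n + 1)).const_mul (4 * a n ^ 2 * z ^ 2))
  refine tendsto_nhds_unique h1 (h2.congr' ?_)
  filter_upwards [eventually_ge_atTop n.natAbs] with N hN
  exact (jostRec_jostApprox a b (show n ≤ N by omega) z).symm

theorem jostG_conj (a b : ℤ → ℝ) (n : ℤ) (z : ℂ) :
    jostG a b n (conj z) = conj (jostG a b n z) := by
  unfold jostG
  rw [map_add, map_one, Complex.conj_tsum]
  simp [jostApprox_conj]

theorem jostG_zero (a b : ℤ → ℝ) (n : ℤ) : jostG a b n 0 = 1 := by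
  simp [jostG, jostApprox_zero]

theorem jostG_eq_tsum_eval (a b : ℤ → ℝ) (n : ℤ) : jostG a b n = fun z => 1 + ∑' k : ℕ,
    ((jostPolyAux a b (n + k + 1) (k + 2) - jostPolyAux a b (n + k) (k + 1)).map
      (algebraMap ℝ ℂ)).eval z := by
  ext z
  unfold jostG jostApprox
  congr 2 with k
  have e1 : (n + k + 1 + 1 - n : ℤ).toNat = k + 2 := by omega
  have e2 : (n + k + 1 - n : ℤ).toNat = k + 1 := by omega
  rw [e1, e2, ← map_sub, eval_map_algebraMap]

/-- The Jost solutions are differentiable on the closed unit disc, one-sidedly on the circle. -/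
theorem exists_hasDerivWithinAt_jostG {M : ℝ} {a b : ℤ → ℝ} (h : RapidDecay M a b) {w : ℂ}
    (hw : ‖w‖ ≤ 1) (n : ℤ) :
    ∃ d, HasDerivWithinAt (jostG a b n) d (Metric.closedBall 0 1) w := by
  have hD : ∀ k : ℕ, ((jostPolyAux a b (n + k + 1) (k + 2) -
      jostPolyAux a b (n + k) (k + 1)).map (algebraMap ℝ ℂ)).natDegree ≤ 2 * (k + 2) := fun k =>
    natDegree_map_le.trans ((natDegree_sub_le _ _).trans (max_le
      (natDegree_jostPolyAux_le _ _ _ _)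
      ((natDegree_jostPolyAux_le _ _ _ _).trans (by omega))))
  have hB : ∀ (k : ℕ) (z : ℂ), ‖z‖ ≤ 1 → ‖((jostPolyAux a b (n + k + 1) (k + 2) -
      jostPolyAux a b (n + k) (k + 1)).map (algebraMap ℝ ℂ)).eval z‖ ≤ jostBound M n k := by
    intro k z hz
    have := norm_jostApprox_step_le h hz n k
    unfold jostApprox at this
    have e1 : (n + k + 1 + 1 - n : ℤ).toNat = k + 2 := by omega
    have e2 : (n + k + 1 - n : ℤ).toNat = k + 1 := by omega
    rwa [e1, e2, ← map_sub, ← eval_map_algebraMap] at this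
  obtain ⟨d, hd⟩ := exists_hasDerivWithinAt_tsum_eval hD hB
    (summable_degree_mul_jostBound h.nonneg n) hw
  rw [jostG_eq_tsum_eval]
  exact ⟨d, hd.const_add 1⟩

theorem continuousOn_jostG {M : ℝ} {a b : ℤ → ℝ} (h : RapidDecay M a b) (n : ℤ) :
    ContinuousOn (jostG a b n) (Metric.closedBall 0 1) := fun w hw => by
  obtain ⟨d, hd⟩ := exists_hasDerivWithinAt_jostG h (w := w) (by simpa using hw) n
  exact hd.continuousWithinAt

theorem differentiableAt_jostG {M : ℝ} {a b : ℤ → ℝ} (h : RapidDecay M a b) (n : ℤ) {z : ℂ}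
    (hz : ‖z‖ < 1) : DifferentiableAt ℂ (jostG a b n) z := by
  obtain ⟨d, hd⟩ := exists_hasDerivWithinAt_jostG h hz.le n
  exact (hd.hasDerivAt (Metric.closedBall_mem_nhds_of_mem (by simpa using hz))).differentiableAt

/-- Convergence of the Jost solutions at `+∞`, with a rate that depends on the coefficients through
`M` only. -/
theorem exists_norm_jostG_sub_one_le {M : ℝ} (hM : 0 ≤ M) :
    ∃ K, ∀ a b, RapidDecay M a b → ∀ (n : ℕ) (z : ℂ), ‖z‖ ≤ 1 →
      ‖jostG a b n z - 1‖ ≤ K / (1 + n) := by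
  have hsum : Summable fun k : ℕ => 1 / (1 + (k : ℝ)) ^ 2 := by
    have := (summable_nat_add_iff 1).mpr (Real.summable_one_div_nat_pow.mpr one_lt_two)
    refine this.congr fun k => ?_
    push_cast; rw [add_comm]
  refine ⟨2 * Real.exp (M * weightSum) * M * ∑' k : ℕ, 1 / (1 + (k : ℝ)) ^ 2, fun a b h n z hz => ?_⟩
  have h0 := jostG_sub_jostApprox h hz n 0
  simp only [Nat.cast_zero, add_zero, jostApprox_of_le a b le_rfl] at h0
  refine h0.trans ?_
  have hb : ∀ k, jostBound M n k ≤
      2 * Real.exp (M * weightSum) * M / (1 + n) * (1 / (1 + (k : ℝ)) ^ 2) := by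
    intro k
    unfold jostBound stabConst
    have e1 : min ((n : ℤ) : ℝ) 0 = 0 := min_eq_right (by positivity)
    have e2 : |(((n : ℤ) + k + 1 : ℤ) : ℝ)| = n + k + 1 := by
      push_cast; exact abs_of_nonneg (by positivity)
    rw [e1, e2, abs_zero, add_zero, one_mul]
    have hk : (0 : ℝ) ≤ k := by positivity
    have hn : (0 : ℝ) ≤ n := by positivity
    have h6 : (1 + (k : ℝ)) * ((1 + n) * (1 + k) ^ 2) ≤ (1 + (n + k + 1 : ℝ)) ^ 6 := by
      have hq : (1 : ℝ) ≤ 1 + (n + k + 1) := by linarith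
      calc (1 + (k : ℝ)) * ((1 + n) * (1 + k) ^ 2)
          ≤ (1 + (n + k + 1)) * ((1 + (n + k + 1)) * (1 + (n + k + 1)) ^ 2) := by
            gcongr <;> linarith
        _ = (1 + (n + k + 1 : ℝ)) ^ 4 := by ring
        _ ≤ _ := pow_le_pow_right₀ hq (by norm_num)
    calc Real.exp (M * weightSum) * (1 + 2 * k) * (M / (1 + (n + k + 1)) ^ 6)
        ≤ Real.exp (M * weightSum) * (2 * (1 + k)) *
            (M / ((1 + (k : ℝ)) * ((1 + n) * (1 + k) ^ 2))) := by
          gcongr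
          linarith
      _ = _ := by field_simp
  calc ∑' k, jostBound M n k
      ≤ ∑' k : ℕ, 2 * Real.exp (M * weightSum) * M / (1 + n) * (1 / (1 + (k : ℝ)) ^ 2) :=
        (summable_jostBound hM n).tsum_le_tsum hb (hsum.mul_left _)
    _ = _ := by rw [tsum_mul_left]; ring

theorem tendsto_jostG_atTop {M : ℝ} {a b : ℤ → ℝ} (h : RapidDecay M a b) {z : ℂ}
    (hz : ‖z‖ ≤ 1) : Tendsto (fun n : ℤ => jostG a b n z) atTop (𝓝 1) := by
  obtain ⟨K, hK⟩ := exists_norm_jostG_sub_one_le h.nonneg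
  rw [← Nat.map_cast_int_atTop, tendsto_map'_iff, tendsto_iff_norm_sub_tendsto_zero]
  refine squeeze_zero (fun _ => norm_nonneg _) (fun n => hK a b h n z hz) ?_
  exact tendsto_const_nhds.div_atTop
    (tendsto_atTop_add_const_left _ _ tendsto_natCast_atTop_atTop)

theorem exists_norm_jostG_le {M : ℝ} {a b : ℤ → ℝ} (h : RapidDecay M a b) :
    ∃ K, 0 ≤ K ∧ ∀ (n : ℤ) (z : ℂ), 0 ≤ n → ‖z‖ ≤ 1 → ‖jostG a b n z‖ ≤ K := by
  obtain ⟨K, hK⟩ := exists_norm_jostG_sub_one_le h.nonneg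
  refine ⟨|K| + 1, by positivity, fun n z hn hz => ?_⟩
  lift n to ℕ using hn
  have e : jostG a b n z = (jostG a b n z - 1) + 1 := by ring
  rw [e]
  refine (norm_add_le _ _).trans ?_
  rw [norm_one]
  gcongr
  refine (hK a b h n z hz).trans ((div_le_div_of_nonneg_right (le_abs_self K) (by positivity)).trans ?_)
  exact div_le_self (abs_nonneg _) (by linarith [show (0:ℝ) ≤ n by positivity])

/-! ### Solutions of the Jacobi difference equation and their Wronskians -/

/-- The Wronskian `a(n) (u(n) v(n+1) - u(n+1) v(n))` of two sequences. -/
def wr (a : ℤ → ℝ) (u v : ℤ → ℂ) (n : ℤ) : ℂ := a n * (u n * v (n + 1) - u (n + 1) * v n)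

/-- Green's formula for the Jacobi difference expression. -/
theorem wr_sub_wr (a b : ℤ → ℝ) (u v : ℤ → ℂ) (n : ℤ) :
    wr a u v n - wr a u v (n - 1) = u n * jacobi a b v n - jacobi a b u n * v n := by
  unfold wr jacobi
  rw [sub_add_cancel]
  ring

theorem wr_eq_of_solves {a b : ℤ → ℝ} {lam : ℂ} {u v : ℤ → ℂ}
    (hu : ∀ n, jacobi a b u n = lam * u n) (hv : ∀ n, jacobi a b v n = lam * v n) (n : ℤ) :
    wr a u v n = wr a u v 0 := by
  have h : ∀ n, wr a u v n = wr a u v (n - 1) := fun n => by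
    rw [← sub_eq_zero, wr_sub_wr a b, hu, hv]; ring
  induction n using Int.induction_on with
  | zero => rfl
  | succ i ih => rw [h, add_sub_cancel_right, ih]
  | pred i ih => rw [← h, ih]

theorem eq_zero_of_solves {a b : ℤ → ℝ} (ha : ∀ n, 0 < a n) {lam : ℂ} {u : ℤ → ℂ}
    (hu : ∀ n, jacobi a b u n = lam * u n) {m : ℤ} (h0 : u m = 0) (h1 : u (m + 1) = 0) :
    u = 0 := by
  have ha' : ∀ n, (a n : ℂ) ≠ 0 := fun n => by exact_mod_cast (ha n).ne'
  have key : ∀ i : ℤ, u (m + i) = 0 ∧ u (m + i + 1) = 0 := by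
    intro i
    induction i using Int.induction_on with
    | zero => simpa using ⟨h0, h1⟩
    | succ i ih =>
      refine ⟨by rw [← add_assoc]; exact ih.2, ?_⟩
      have := hu (m + i + 1)
      unfold jacobi at this
      rw [ih.2, add_sub_cancel_right, ih.1] at this
      simp only [mul_zero, add_zero, mul_eq_zero, ha', false_or] at this
      rw [← add_assoc]; exact this
    | pred i ih =>
      have e : m + (-(i : ℤ) - 1) + 1 = m + -i := by ring
      have e' : m + (-(i : ℤ) - 1) = m + -i - 1 := by ring
      refine ⟨?_, by rw [e]; exact ih.1⟩
      have := hu (m + -i)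
      unfold jacobi at this
      rw [ih.1, ih.2] at this
      simp only [mul_zero, zero_add, add_zero, mul_eq_zero, ha', false_or] at this
      rw [e']; exact this
  ext n
  simpa using (key (n - m)).1

theorem exists_eq_smul_of_wr_eq_zero {a b : ℤ → ℝ} (ha : ∀ n, 0 < a n) {lam : ℂ} {u v : ℤ → ℂ}
    (hu : ∀ n, jacobi a b u n = lam * u n) (hv : ∀ n, jacobi a b v n = lam * v n) (hv0 : v ≠ 0)
    (h : wr a u v 0 = 0) : ∃ c : ℂ, ∀ n, u n = c * v n := by
  have ha0 : (a 0 : ℂ) ≠ 0 := by exact_mod_cast (ha 0).ne'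
  have hw : u 0 * v (0 + 1) = u (0 + 1) * v 0 := by
    unfold wr at h
    rw [mul_eq_zero, or_iff_right ha0] at h
    exact sub_eq_zero.mp h
  have key : ∀ c : ℂ, u 0 = c * v 0 → u (0 + 1) = c * v (0 + 1) → ∀ n, u n = c * v n := by
    intro c h0 h1
    have hz : (fun n => u n - c * v n) = 0 := by
      refine eq_zero_of_solves (b := b) ha (lam := lam) (fun n => ?_) (m := 0)
        (sub_eq_zero.mpr h0) (sub_eq_zero.mpr h1)
      have := hu n
      have h2 := hv n
      unfold jacobi at *
      linear_combination this - c * h2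
    intro n
    exact sub_eq_zero.mp (congrFun hz n)
  by_cases h0 : v 0 = 0
  · have h1 : v (0 + 1) ≠ 0 := fun h1 => hv0 (eq_zero_of_solves ha hv h0 h1)
    refine ⟨u (0 + 1) / v (0 + 1), key _ ?_ (by field_simp)⟩
    rw [h0, mul_zero]
    rw [h0, mul_zero, mul_eq_zero, or_iff_left h1] at hw
    exact hw
  · refine ⟨u 0 / v 0, key _ (by field_simp) ?_⟩
    field_simp
    linear_combination -hw

/-! ### Background asymptotics of the coefficients -/

theorem RapidDecay.abs_two_mul_sub_one_le {M : ℝ} {a b : ℤ → ℝ} (h : RapidDecay M a b) (n : ℤ) :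
    |2 * a n - 1| ≤ M / (1 + |(n : ℝ)|) ^ 6 := by
  have h1 := h.bound n
  have h2 : |4 * a n ^ 2 - 1| = |2 * a n - 1| * (2 * a n + 1) := by
    have e : 4 * a n ^ 2 - 1 = (2 * a n - 1) * (2 * a n + 1) := by ring
    rw [e, abs_mul, abs_of_pos (by linarith [h.pos n] : 0 < 2 * a n + 1)]
  nlinarith [abs_nonneg (2 * b n), abs_nonneg (2 * a n - 1), h.pos n]

theorem RapidDecay.tendsto_atTop {M : ℝ} {a b : ℤ → ℝ} (h : RapidDecay M a b) :
    Tendsto a atTop (𝓝 (1 / 2)) := by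
  have hs := ((summable_int_one_add_abs_pow (p := 6) (by norm_num)).mul_left M)
  have h0 : Tendsto (fun n : ℤ => M * (1 / (1 + |(n : ℝ)|) ^ 6)) atTop (𝓝 0) :=
    hs.tendsto_cofinite_zero.mono_left atTop_le_cofinite
  have h1 : Tendsto (fun n => 2 * a n - 1) atTop (𝓝 0) := by
    refine squeeze_zero_norm (fun n => ?_) h0
    rw [mul_one_div]
    exact h.abs_two_mul_sub_one_le n
  have h2 := (h1.add_const 1).const_mul (1 / 2)
  simpa using h2

theorem RapidDecay.summable_log {M : ℝ} {a b : ℤ → ℝ} (h : RapidDecay M a b) (n : ℤ) :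
    Summable fun k : ℕ => Real.log (2 * a (n + k)) := by
  have hs : Summable fun j : ℤ => 2 * a j - 1 := by
    refine Summable.of_norm_bounded
      ((summable_int_one_add_abs_pow (p := 6) (by norm_num)).mul_left M) fun j => ?_
    rw [mul_one_div]
    exact h.abs_two_mul_sub_one_le j
  have hs' : Summable fun k : ℕ => 2 * a (n + k) - 1 :=
    hs.comp_injective (i := fun k : ℕ => n + (k : ℤ)) fun i j hij => by simp only at hij; omega
  simpa using Real.summable_log_one_add_of_summable hs'

/-- The amplitude `∏_{j ≥ n} 1 / (2 a(j))`. -/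
def jostAmp (a : ℤ → ℝ) (n : ℤ) : ℝ := Real.exp (-∑' k : ℕ, Real.log (2 * a (n + k)))

theorem jostAmp_pos (a : ℤ → ℝ) (n : ℤ) : 0 < jostAmp a n := Real.exp_pos _

theorem jostAmp_succ {M : ℝ} {a b : ℤ → ℝ} (h : RapidDecay M a b) (n : ℤ) :
    jostAmp a (n + 1) = 2 * a n * jostAmp a n := by
  unfold jostAmp
  rw [(h.summable_log n).tsum_eq_zero_add]
  have e : ∀ k : ℕ, n + ((k + 1 : ℕ) : ℤ) = n + 1 + k := fun k => by push_cast; ring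
  simp only [e, Nat.cast_zero, add_zero]
  rw [neg_add, Real.exp_add, Real.exp_neg (Real.log _), Real.exp_log (by linarith [h.pos n])]
  have := (h.pos n).ne'
  field_simp

theorem tendsto_jostAmp_atTop (a : ℤ → ℝ) :
    Tendsto (jostAmp a) atTop (𝓝 1) := by
  rw [← Nat.map_cast_int_atTop, tendsto_map'_iff]
  have h1 := tendsto_sum_nat_add fun k : ℕ => Real.log (2 * a k)
  have h2 := (Real.continuous_exp.tendsto _).comp h1.neg
  rw [neg_zero, Real.exp_zero] at h2
  refine h2.congr fun n => ?_
  simp only [Function.comp_apply, jostAmp]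
  congr 3 with k
  push_cast; rw [add_comm]

/-! ### The right Jost solution -/

/-- The right Jost solution, written with the normalized solution `jostG`. -/
def psiPlus (a b : ℤ → ℝ) (z : ℂ) (n : ℤ) : ℂ := jostAmp a n * z ^ n * jostG a b n z

theorem solvesAt_psiPlus {M : ℝ} {a b : ℤ → ℝ} (h : RapidDecay M a b) {z : ℂ} (hz0 : z ≠ 0)
    (hz : ‖z‖ ≤ 1) : SolvesAt a b z (psiPlus a b z) := by
  intro n
  have h1 := jostRec_jostG h hz n
  unfold JostRec at h1
  have h2 := jostAmp_succ h n
  have h3 := jostAmp_succ h (n - 1)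
  rw [sub_add_cancel] at h3
  simp only [jacobi, psiPlus, zpow_add₀ hz0, zpow_sub₀ hz0, zpow_one, h2, h3, h1]
  push_cast
  field_simp
  ring

theorem zpow_neg_mul_psiPlus (a b : ℤ → ℝ) {z : ℂ} (hz0 : z ≠ 0) (n : ℤ) :
    z ^ (-n) * psiPlus a b z n = jostAmp a n * jostG a b n z := by
  unfold psiPlus
  have := zpow_ne_zero n hz0
  rw [zpow_neg]; field_simp

theorem tendsto_psiPlus {M : ℝ} {a b : ℤ → ℝ} (h : RapidDecay M a b) {z : ℂ} (hz0 : z ≠ 0)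
    (hz : ‖z‖ ≤ 1) : Tendsto (fun n : ℤ => z ^ (-n) * psiPlus a b z n) atTop (𝓝 1) := by
  simp_rw [zpow_neg_mul_psiPlus a b hz0]
  have h1 : Tendsto (fun n => (jostAmp a n : ℂ)) atTop (𝓝 ((1 : ℝ) : ℂ)) :=
    (Complex.continuous_ofReal.tendsto _).comp (tendsto_jostAmp_atTop a)
  simpa using h1.mul (tendsto_jostG_atTop h hz)

theorem tendsto_wr {M : ℝ} {a b : ℤ → ℝ} (h : RapidDecay M a b) {z w p q : ℂ} (hz0 : z ≠ 0)
    (hw0 : w ≠ 0) {u v : ℤ → ℂ} (hu : Tendsto (fun n : ℤ => z ^ (-n) * u n) atTop (𝓝 p))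
    (hv : Tendsto (fun n : ℤ => w ^ (-n) * v n) atTop (𝓝 q)) :
    Tendsto (fun n : ℤ => (z * w) ^ (-n) * wr a u v n) atTop (𝓝 (1 / 2 * (p * q * (w - z)))) := by
  have hs : Tendsto (fun n : ℤ => n + 1) atTop atTop := tendsto_atTop_add_const_right _ _ tendsto_id
  have hu1 := hu.comp hs
  have hv1 := hv.comp hs
  have ha : Tendsto (fun n => (a n : ℂ)) atTop (𝓝 ((1 / 2 : ℝ) : ℂ)) :=
    (Complex.continuous_ofReal.tendsto _).comp h.tendsto_atTop
  have key := ha.mul (((hu.mul hv1).mul_const w).sub ((hu1.mul hv).mul_const z))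
  have e : ((1 / 2 : ℝ) : ℂ) * (p * q * w - p * q * z) = 1 / 2 * (p * q * (w - z)) := by
    push_cast; ring
  rw [e] at key
  refine key.congr fun n => ?_
  have hzn := zpow_ne_zero n hz0
  have hwn := zpow_ne_zero n hw0
  simp only [Function.comp_apply, wr, zpow_neg, mul_zpow, zpow_add₀ hz0, zpow_add₀ hw0, zpow_one]
  field_simp

/-- Uniqueness of the right Jost solution: the Wronskian with `psiPlus` is constant, and it is
`o(z ^ (2 n))`. -/
theorem eq_psiPlus {M : ℝ} {a b : ℤ → ℝ} (h : RapidDecay M a b) {z : ℂ} (hz0 : z ≠ 0)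
    (hz : ‖z‖ ≤ 1) {u : ℤ → ℂ} (hu : SolvesAt a b z u)
    (hlim : Tendsto (fun n : ℤ => z ^ (-n) * u n) atTop (𝓝 1)) : u = psiPlus a b z := by
  have hp := solvesAt_psiPlus h hz0 hz
  have hpl := tendsto_psiPlus h hz0 hz
  have hw := tendsto_wr h hz0 hz0 hlim hpl
  rw [sub_self, mul_zero, mul_zero] at hw
  have hW : wr a u (psiPlus a b z) 0 = 0 := by
    have h2 : Tendsto (fun _ : ℤ => wr a u (psiPlus a b z) 0) atTop (𝓝 0) := by
      have hw' := hw.norm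
      rw [norm_zero] at hw'
      refine squeeze_zero_norm' ?_ hw'
      filter_upwards [eventually_ge_atTop 0] with n hn
      rw [wr_eq_of_solves hu hp n, norm_mul, norm_zpow]
      refine le_mul_of_one_le_left (norm_nonneg _) ?_
      rw [zpow_neg, ← inv_zpow]
      lift n to ℕ using hn
      rw [zpow_natCast]
      refine one_le_pow₀ ((one_le_inv₀ ?_).mpr ?_)
      · simpa using hz0
      · rw [norm_mul]
        exact mul_le_one₀ hz (norm_nonneg _) hz
    exact tendsto_nhds_unique tendsto_const_nhds h2
  have hne : psiPlus a b z ≠ 0 := by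
    intro h0
    rw [h0] at hpl
    simp only [Pi.zero_apply, mul_zero] at hpl
    exact zero_ne_one (tendsto_nhds_unique tendsto_const_nhds hpl)
  obtain ⟨c, hc⟩ := exists_eq_smul_of_wr_eq_zero h.pos hu hp hne hW
  have h3 := hpl.const_mul c
  have h4 : c * 1 = 1 := by
    refine tendsto_nhds_unique h3 (hlim.congr fun n => ?_)
    rw [hc n]; ring
  ext n
  rw [hc n, show c = 1 by simpa using h4, one_mul]

theorem jostPlus_eq {M : ℝ} {a b : ℤ → ℝ} (h : RapidDecay M a b) {z : ℂ} (hz0 : z ≠ 0)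
    (hz : ‖z‖ ≤ 1) : jostPlus a b z = psiPlus a b z := by
  have hex : ∃ u : ℤ → ℂ, SolvesAt a b z u ∧
      Tendsto (fun n : ℤ => z ^ (-n) * u n) atTop (𝓝 1) :=
    ⟨_, solvesAt_psiPlus h hz0 hz, tendsto_psiPlus h hz0 hz⟩
  rw [jostPlus, dif_pos hex]
  exact eq_psiPlus h hz0 hz hex.choose_spec.1 hex.choose_spec.2

/-! ### Reflection and the left Jost solution -/

/-- The off-diagonal coefficients after the reflection `n ↦ -n` of the lattice. -/
def reflA (a : ℤ → ℝ) (n : ℤ) : ℝ := a (-n - 1)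

/-- The diagonal coefficients after the reflection `n ↦ -n` of the lattice. -/
def reflB (b : ℤ → ℝ) (n : ℤ) : ℝ := b (-n)

theorem RapidDecay.reflect {M : ℝ} {a b : ℤ → ℝ} (h : RapidDecay M a b) :
    RapidDecay (65 * M) (reflA a) (reflB b) := by
  have hM := h.nonneg
  refine ⟨fun n => h.pos _, fun n => ?_⟩
  have h1 := h.bound (-n - 1)
  have h2 := h.bound (-n)
  have e : |((-n : ℤ) : ℝ)| = |(n : ℝ)| := by push_cast; exact abs_neg _
  rw [e] at h2
  have h3 : M / (1 + |((-n - 1 : ℤ) : ℝ)|) ^ 6 ≤ 64 * M / (1 + |(n : ℝ)|) ^ 6 := by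
    have hq : 1 + |(n : ℝ)| ≤ 2 * (1 + |((-n - 1 : ℤ) : ℝ)|) := by
      have e2 : (n : ℝ) = -((-n - 1 : ℤ) : ℝ) + (-1) := by push_cast; ring
      have h4 : |(n : ℝ)| ≤ |((-n - 1 : ℤ) : ℝ)| + 1 := by
        conv_lhs => rw [e2]
        refine (abs_add_le _ _).trans ?_
        rw [abs_neg, abs_neg, abs_one]
      linarith [abs_nonneg ((-n - 1 : ℤ) : ℝ)]
    rw [div_le_div_iff₀ (by positivity) (by positivity)]
    calc M * (1 + |(n : ℝ)|) ^ 6 ≤ M * (2 * (1 + |((-n - 1 : ℤ) : ℝ)|)) ^ 6 := by gcongr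
      _ = _ := by ring
  have h5 : |4 * a (-n - 1) ^ 2 - 1| ≤ 64 * M / (1 + |(n : ℝ)|) ^ 6 := by
    linarith [abs_nonneg (2 * b (-n - 1))]
  have h6 : |2 * b (-n)| ≤ M / (1 + |(n : ℝ)|) ^ 6 := by
    linarith [abs_nonneg (4 * a (-n) ^ 2 - 1)]
  have e3 : 65 * M / (1 + |(n : ℝ)|) ^ 6 =
      64 * M / (1 + |(n : ℝ)|) ^ 6 + M / (1 + |(n : ℝ)|) ^ 6 := by ring
  rw [e3]
  exact add_le_add h5 h6

theorem jacobi_refl (a b : ℤ → ℝ) (u : ℤ → ℂ) (n : ℤ) :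
    jacobi (reflA a) (reflB b) (fun m => u (-m)) n = jacobi a b u (-n) := by
  unfold jacobi reflA reflB
  have e1 : -(n - 1) - 1 = -n := by ring
  have e2 : -(n + 1) = -n - 1 := by ring
  have e3 : -(n - 1) = -n + 1 := by ring
  rw [e1]
  simp only [e2, e3]; ring

/-- The left Jost solution is the right Jost solution of the reflected operator. -/
def psiMinus (a b : ℤ → ℝ) (z : ℂ) (n : ℤ) : ℂ := psiPlus (reflA a) (reflB b) z (-n)

theorem solvesAt_psiMinus {M : ℝ} {a b : ℤ → ℝ} (h : RapidDecay M a b) {z : ℂ} (hz0 : z ≠ 0)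
    (hz : ‖z‖ ≤ 1) : SolvesAt a b z (psiMinus a b z) := by
  intro n
  have h1 := solvesAt_psiPlus h.reflect hz0 hz (-n)
  have h2 := jacobi_refl a b (psiMinus a b z) (-n)
  simp only [psiMinus, neg_neg] at h2 ⊢
  rw [← h2]
  exact h1

theorem tendsto_psiMinus {M : ℝ} {a b : ℤ → ℝ} (h : RapidDecay M a b) {z : ℂ} (hz0 : z ≠ 0)
    (hz : ‖z‖ ≤ 1) : Tendsto (fun n : ℤ => z ^ n * psiMinus a b z n) atBot (𝓝 1) := by
  refine ((tendsto_psiPlus h.reflect hz0 hz).comp tendsto_neg_atBot_atTop).congr fun n => ?_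
  simp [psiMinus]

theorem jostMinus_eq {M : ℝ} {a b : ℤ → ℝ} (h : RapidDecay M a b) {z : ℂ} (hz0 : z ≠ 0)
    (hz : ‖z‖ ≤ 1) : jostMinus a b z = psiMinus a b z := by
  have hex : ∃ u : ℤ → ℂ, SolvesAt a b z u ∧
      Tendsto (fun n : ℤ => z ^ n * u n) atBot (𝓝 1) :=
    ⟨_, solvesAt_psiMinus h hz0 hz, tendsto_psiMinus h hz0 hz⟩
  rw [jostMinus, dif_pos hex]
  obtain ⟨h1, h2⟩ := hex.choose_spec
  set u := hex.choose
  have h3 : (fun m => u (-m)) = psiPlus (reflA a) (reflB b) z := by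
    refine eq_psiPlus h.reflect hz0 hz (fun n => ?_) ?_
    · rw [jacobi_refl]; exact h1 _
    · exact h2.comp tendsto_neg_atTop_atBot
  ext n
  have := congrFun h3 (-n)
  simpa [psiMinus] using this

/-- The normalized left Jost solution. -/
def jostGMinus (a b : ℤ → ℝ) (n : ℤ) (z : ℂ) : ℂ := jostG (reflA a) (reflB b) (-n) z

/-- The amplitude `∏_{j < n} 1 / (2 a(j))` of the left Jost solution. -/
def jostAmpMinus (a : ℤ → ℝ) (n : ℤ) : ℝ := jostAmp (reflA a) (-n)

theorem psiMinus_eq (a b : ℤ → ℝ) (z : ℂ) (n : ℤ) :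
    psiMinus a b z n = jostAmpMinus a n * z ^ (-n) * jostGMinus a b n z := rfl

theorem jostAmpMinus_pos (a : ℤ → ℝ) (n : ℤ) : 0 < jostAmpMinus a n := jostAmp_pos _ _

theorem jostAmpMinus_succ {M : ℝ} {a b : ℤ → ℝ} (h : RapidDecay M a b) (n : ℤ) :
    jostAmpMinus a n = 2 * a n * jostAmpMinus a (n + 1) := by
  have := jostAmp_succ h.reflect (-(n + 1))
  have e : -(n + 1) + 1 = -n := by ring
  have e2 : reflA a (-(n + 1)) = a n := by unfold reflA; congr 1; ring
  rw [e, e2] at this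
  exact this

/-- The product `∏_j 1 / (2 a(j))` over the whole lattice. -/
def totalAmp (a : ℤ → ℝ) : ℝ := jostAmp a 0 * jostAmpMinus a 0

theorem totalAmp_pos (a : ℤ → ℝ) : 0 < totalAmp a := mul_pos (jostAmp_pos _ _) (jostAmpMinus_pos _ _)

theorem jostAmp_mul_jostAmpMinus {M : ℝ} {a b : ℤ → ℝ} (h : RapidDecay M a b) (n : ℤ) :
    jostAmp a n * jostAmpMinus a n = totalAmp a := by
  have hs : ∀ n, jostAmp a (n + 1) * jostAmpMinus a (n + 1) = jostAmp a n * jostAmpMinus a n := by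
    intro n
    rw [jostAmp_succ h, jostAmpMinus_succ h n]; ring
  induction n using Int.induction_on with
  | zero => rfl
  | succ i ih => rw [hs, ih]
  | pred i ih => rw [← hs, sub_add_cancel, ih]

/-! ### The Wronskian of the Jost solutions -/

/-- The Wronskian of the Jost solutions, freed of its pole at `z = 0`. -/
def jostW (a b : ℤ → ℝ) (z : ℂ) : ℂ :=
  jostG a b 0 z * jostGMinus a b 1 z - 4 * a 0 ^ 2 * z ^ 2 * jostG a b 1 z * jostGMinus a b 0 z

theorem wr_psi_eq {M : ℝ} {a b : ℤ → ℝ} (h : RapidDecay M a b) {z : ℂ} (hz0 : z ≠ 0) :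
    wr a (psiPlus a b z) (psiMinus a b z) 0 = totalAmp a / (2 * z) * jostW a b z := by
  have h1 := jostAmp_succ h 0
  have h2 := jostAmpMinus_succ h 0
  simp only [wr, psiMinus_eq, psiPlus, jostW, totalAmp]
  rw [h2, h1, zero_add]
  simp only [zpow_zero, neg_zero, zpow_neg, zpow_one]
  push_cast
  field_simp
  ring

theorem wronskian_eq {M : ℝ} {a b : ℤ → ℝ} (h : RapidDecay M a b) {z : ℂ} (hz0 : z ≠ 0)
    (hz : ‖z‖ ≤ 1) : wronskian a b z = totalAmp a / (2 * z) * jostW a b z := by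
  rw [← wr_psi_eq h hz0, wronskian, jostPlus_eq h hz0 hz, jostMinus_eq h hz0 hz]
  rfl

theorem transmission_eq {M : ℝ} {a b : ℤ → ℝ} (h : RapidDecay M a b) {z : ℂ} (hz0 : z ≠ 0)
    (hz : ‖z‖ ≤ 1) : transmission a b z = (1 - z ^ 2) / (totalAmp a * jostW a b z) := by
  have hA : (totalAmp a : ℂ) ≠ 0 := by exact_mod_cast (totalAmp_pos a).ne'
  rw [transmission, wronskian_eq h hz0 hz]
  by_cases hW : jostW a b z = 0
  · simp [hW]
  · field_simp

theorem jostW_zero (a b : ℤ → ℝ) : jostW a b 0 = 1 := by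
  simp [jostW, jostGMinus, jostG_zero]

theorem exists_hasDerivWithinAt_jostGMinus {M : ℝ} {a b : ℤ → ℝ} (h : RapidDecay M a b) {w : ℂ}
    (hw : ‖w‖ ≤ 1) (n : ℤ) :
    ∃ d, HasDerivWithinAt (jostGMinus a b n) d (Metric.closedBall 0 1) w :=
  exists_hasDerivWithinAt_jostG h.reflect hw (-n)

theorem exists_hasDerivWithinAt_jostW {M : ℝ} {a b : ℤ → ℝ} (h : RapidDecay M a b) {w : ℂ}
    (hw : ‖w‖ ≤ 1) : ∃ d, HasDerivWithinAt (jostW a b) d (Metric.closedBall 0 1) w := by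
  obtain ⟨d1, h1⟩ := exists_hasDerivWithinAt_jostG h hw 0
  obtain ⟨d2, h2⟩ := exists_hasDerivWithinAt_jostG h hw 1
  obtain ⟨d3, h3⟩ := exists_hasDerivWithinAt_jostGMinus h hw 0
  obtain ⟨d4, h4⟩ := exists_hasDerivWithinAt_jostGMinus h hw 1
  exact ⟨_, (h1.mul h4).sub (((((hasDerivWithinAt_id w _).pow 2).const_mul _).mul h2).mul h3)⟩

theorem continuousOn_jostW {M : ℝ} {a b : ℤ → ℝ} (h : RapidDecay M a b) :
    ContinuousOn (jostW a b) (Metric.closedBall 0 1) := fun w hw => by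
  obtain ⟨d, hd⟩ := exists_hasDerivWithinAt_jostW h (w := w) (by simpa using hw)
  exact hd.continuousWithinAt

theorem differentiableAt_jostW {M : ℝ} {a b : ℤ → ℝ} (h : RapidDecay M a b) {z : ℂ}
    (hz : ‖z‖ < 1) : DifferentiableAt ℂ (jostW a b) z := by
  obtain ⟨d, hd⟩ := exists_hasDerivWithinAt_jostW h hz.le
  exact (hd.hasDerivAt (Metric.closedBall_mem_nhds_of_mem (by simpa using hz))).differentiableAt

/-! ### Propagation of the decay along the Toda flow -/

/-- Pointwise decay of order `6` of a coefficient pair to the free background. -/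
def PointDecay (M : ℝ) (a b : ℤ → ℝ) : Prop :=
  ∀ n : ℤ, |a n - 1 / 2| ≤ M / (1 + |(n : ℝ)|) ^ 6 ∧ |b n| ≤ M / (1 + |(n : ℝ)|) ^ 6

theorem HasDecay.exists_pointDecay {a b : ℤ → ℝ} (h : HasDecay a b) : ∃ M, PointDecay M a b := by
  set y : ℤ → ℝ := fun n => |a n - 1 / 2| + |b n| with hy
  have hy0 : ∀ n, 0 ≤ y n := fun n => by positivity
  have hl : ∀ l : ℕ, ∀ n : ℤ, |(n : ℝ)| ^ l * y n ≤ ∑' n : ℤ, |(n : ℝ)| ^ l * y n := fun l n =>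
    (h l).le_tsum n fun j _ => mul_nonneg (by positivity) (hy0 j)
  refine ⟨64 * ((∑' n : ℤ, |(n : ℝ)| ^ 0 * y n) + ∑' n : ℤ, |(n : ℝ)| ^ 6 * y n), fun n => ?_⟩
  have key : y n ≤ 64 * ((∑' n : ℤ, |(n : ℝ)| ^ 0 * y n) + ∑' n : ℤ, |(n : ℝ)| ^ 6 * y n) /
      (1 + |(n : ℝ)|) ^ 6 := by
    rw [le_div_iff₀ (by positivity)]
    have h0 := hl 0 n
    have h6 := hl 6 n
    have hp : (1 + |(n : ℝ)|) ^ 6 ≤ 64 * (1 + |(n : ℝ)| ^ 6) := by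
      rcases le_total |(n : ℝ)| 1 with hn | hn
      · calc (1 + |(n : ℝ)|) ^ 6 ≤ (1 + 1) ^ 6 := by gcongr
          _ ≤ _ := by
            linarith [pow_nonneg (abs_nonneg (n : ℝ)) 6]
      · calc (1 + |(n : ℝ)|) ^ 6 ≤ (|(n : ℝ)| + |(n : ℝ)|) ^ 6 := by gcongr
          _ = 64 * |(n : ℝ)| ^ 6 := by ring
          _ ≤ _ := by linarith
    calc y n * (1 + |(n : ℝ)|) ^ 6 ≤ y n * (64 * (1 + |(n : ℝ)| ^ 6)) := by
          have := hy0 n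
          gcongr
      _ = 64 * (|(n : ℝ)| ^ 0 * y n + |(n : ℝ)| ^ 6 * y n) := by ring
      _ ≤ _ := by linarith
  simp only [hy] at key
  exact ⟨by linarith [abs_nonneg (b n)], by linarith [abs_nonneg (a n - 1 / 2)]⟩

theorem one_div_pow_six_le_of_abs_sub {m n : ℤ} (h : |(n : ℝ) - m| ≤ 1) :
    1 / (1 + |(m : ℝ)|) ^ 6 ≤ 64 * (1 / (1 + |(n : ℝ)|) ^ 6) := by
  rw [mul_one_div, div_le_div_iff₀ (by positivity) (by positivity)]
  have h1 : |(n : ℝ)| ≤ |(m : ℝ)| + 1 := by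
    have e : (n : ℝ) = m + (n - m) := by ring
    conv_lhs => rw [e]
    exact (abs_add_le _ _).trans (by linarith)
  calc 1 * (1 + |(n : ℝ)|) ^ 6 ≤ 1 * (2 * (1 + |(m : ℝ)|)) ^ 6 := by
        gcongr
        linarith [abs_nonneg (m : ℝ)]
    _ = _ := by ring

/-- Over a short time the Toda flow at most doubles the weighted size of the perturbation. The
weight is regularized by `ε`, so that boundedness of the coefficients starts an iteration that
halves the excess in every round; then `ε → 0`. -/
theorem IsTodaSolution.pointDecay_step {a b : ℤ → ℝ → ℝ} (hab : IsTodaSolution a b) {τ C : ℝ}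
    (hC0 : 0 < C) (hC : ∀ n t, |t| ≤ τ → |a n t| ≤ C ∧ |b n t| ≤ C) {s t : ℝ} (hs : |s| ≤ τ)
    (ht : |t| ≤ τ) (hst : |t - s| ≤ 1 / (520 * C)) {M : ℝ} (hM : 0 ≤ M)
    (h : PointDecay M (fun n => a n s) (fun n => b n s)) :
    PointDecay (2 * M) (fun n => a n t) (fun n => b n t) := by
  have hI : ∀ r ∈ Set.uIcc s t, |r| ≤ τ := by
    intro r hr
    rw [abs_le] at *
    rcases Set.mem_uIcc.mp hr with h | h <;> constructor <;> linarith [h.1, h.2, hs.1, hs.2, ht.1, ht.2]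
  have hIs : ∀ r ∈ Set.uIcc s t, |r - s| ≤ 1 / (520 * C) := fun r hr =>
    (Set.abs_sub_left_of_mem_uIcc hr).trans hst
  have main : ∀ ε : ℝ, 0 < ε → ∀ n : ℤ,
      |a n t - 1 / 2| ≤ 2 * M * (1 / (1 + |(n : ℝ)|) ^ 6 + ε) ∧
        |b n t| ≤ 2 * M * (1 / (1 + |(n : ℝ)|) ^ 6 + ε) := by
    intro ε hε
    set ρ : ℤ → ℝ := fun n => 1 / (1 + |(n : ℝ)|) ^ 6 + ε with hρ
    have hρ0 : ∀ n, 0 < ρ n := fun n => by positivity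
    have hρ1 : ∀ m n : ℤ, |(n : ℝ) - m| ≤ 1 → ρ m ≤ 64 * ρ n := fun m n hmn => by
      have := one_div_pow_six_le_of_abs_sub hmn
      simp only [hρ]
      linarith
    -- one round: the derivatives are at most `260 C X ρ`, and the time interval has length at most
    -- `1 / (520 C)`
    have round : ∀ X : ℝ, 0 ≤ X →
        (∀ r ∈ Set.uIcc s t, ∀ n, |a n r - 1 / 2| ≤ X * ρ n ∧ |b n r| ≤ X * ρ n) →
        ∀ r ∈ Set.uIcc s t, ∀ n, |a n r - 1 / 2| ≤ (M + X / 2) * ρ n ∧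
          |b n r| ≤ (M + X / 2) * ρ n := by
      intro X hX hXb r hr n
      have hsr : Set.uIcc s r ⊆ Set.uIcc s t := Set.uIcc_subset_uIcc_left hr
      have da : ∀ r' ∈ Set.uIcc s r, ‖a n r' * (b (n + 1) r' - b n r')‖ ≤ 260 * C * X * ρ n := by
        intro r' hr'
        have h1 := (hXb r' (hsr hr') (n + 1)).2
        have h2 := (hXb r' (hsr hr') n).2
        have h3 := (hC n r' (hI r' (hsr hr'))).1
        have h4 := hρ1 (n + 1) n (by push_cast; norm_num)
        rw [Real.norm_eq_abs, abs_mul]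
        have h5 : |b (n + 1) r' - b n r'| ≤ 65 * (X * ρ n) := by
          refine (abs_sub _ _).trans ?_
          nlinarith
        calc |a n r'| * |b (n + 1) r' - b n r'| ≤ C * (65 * (X * ρ n)) := by gcongr
          _ ≤ _ := by
            have : 0 ≤ C * X * ρ n := by have := (hρ0 n).le; positivity
            nlinarith
      have db : ∀ r' ∈ Set.uIcc s r, ‖2 * (a n r' ^ 2 - a (n - 1) r' ^ 2)‖ ≤ 260 * C * X * ρ n := by
        intro r' hr'
        have h1 := (hXb r' (hsr hr') (n - 1)).1
        have h2 := (hXb r' (hsr hr') n).1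
        have h3 := (hC n r' (hI r' (hsr hr'))).1
        have h3' := (hC (n - 1) r' (hI r' (hsr hr'))).1
        have h4 := hρ1 (n - 1) n (by push_cast; norm_num)
        have e : 2 * (a n r' ^ 2 - a (n - 1) r' ^ 2) =
            2 * (a n r' + a (n - 1) r') * ((a n r' - 1 / 2) - (a (n - 1) r' - 1 / 2)) := by ring
        rw [Real.norm_eq_abs, e, abs_mul, abs_mul, abs_two]
        have h5 : |(a n r' - 1 / 2) - (a (n - 1) r' - 1 / 2)| ≤ 65 * (X * ρ n) := by
          refine (abs_sub _ _).trans ?_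
          nlinarith
        have h6 : |a n r' + a (n - 1) r'| ≤ 2 * C := (abs_add_le _ _).trans (by linarith)
        calc 2 * |a n r' + a (n - 1) r'| * |(a n r' - 1 / 2) - (a (n - 1) r' - 1 / 2)|
            ≤ 2 * (2 * C) * (65 * (X * ρ n)) := by gcongr
          _ = _ := by ring
      have hr1 : |r - s| ≤ 1 / (520 * C) := hIs r hr
      have fin : 260 * C * X * ρ n * ‖r - s‖ ≤ X / 2 * ρ n := by
        have := (hρ0 n).le
        calc 260 * C * X * ρ n * ‖r - s‖ ≤ 260 * C * X * ρ n * (1 / (520 * C)) := by gcongr; exact hr1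
          _ = _ := by field_simp; ring
      have hρM : M / (1 + |(n : ℝ)|) ^ 6 ≤ M * ρ n := by
        rw [← mul_one_div]
        gcongr
        simp only [hρ]; linarith
      constructor
      · have h1 := (convex_uIcc s r).norm_image_sub_le_of_norm_hasDerivWithin_le
          (fun r' _ => (hab.deriv_a n r').hasDerivWithinAt) da Set.left_mem_uIcc Set.right_mem_uIcc
        have h2 := (h n).1
        have e : a n r - 1 / 2 = (a n s - 1 / 2) + (a n r - a n s) := by ring
        rw [e]
        refine (abs_add_le _ _).trans ?_
        rw [Real.norm_eq_abs] at h1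
        linarith
      · have h1 := (convex_uIcc s r).norm_image_sub_le_of_norm_hasDerivWithin_le
          (fun r' _ => (hab.deriv_b n r').hasDerivWithinAt) db Set.left_mem_uIcc Set.right_mem_uIcc
        have h2 := (h n).2
        have e : b n r = b n s + (b n r - b n s) := by ring
        rw [e]
        refine (abs_add_le _ _).trans ?_
        rw [Real.norm_eq_abs] at h1
        linarith
    -- the start of the iteration is boundedness of the coefficients, as `ε ≤ ρ`
    have iter : ∀ k : ℕ, ∀ r ∈ Set.uIcc s t, ∀ n,
        |a n r - 1 / 2| ≤ (2 * M + (C + 1) / ε * (1 / 2) ^ k) * ρ n ∧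
          |b n r| ≤ (2 * M + (C + 1) / ε * (1 / 2) ^ k) * ρ n := by
      intro k
      induction k with
      | zero =>
        intro r hr n
        have h1 := hC n r (hI r hr)
        have h2 : C + 1 ≤ (2 * M + (C + 1) / ε * (1 / 2) ^ 0) * ρ n := by
          have hε' : ε ≤ ρ n := by
            have : 0 ≤ 1 / (1 + |(n : ℝ)|) ^ 6 := by positivity
            simp only [hρ]; linarith
          calc C + 1 = (C + 1) / ε * ε := by field_simp
            _ ≤ (2 * M + (C + 1) / ε * (1 / 2) ^ 0) * ε := by
              gcongr
              rw [pow_zero, mul_one]; linarith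
            _ ≤ _ := by gcongr
        refine ⟨?_, by linarith [h1.2]⟩
        refine (abs_sub _ _).trans ?_
        have : |(1 / 2 : ℝ)| = 1 / 2 := abs_of_pos (by norm_num)
        linarith [h1.1]
      | succ k ih =>
        intro r hr n
        have := round _ (by positivity) ih r hr n
        have e : M + (2 * M + (C + 1) / ε * (1 / 2) ^ k) / 2 =
            2 * M + (C + 1) / ε * (1 / 2) ^ (k + 1) := by ring
        rwa [e] at this
    intro n
    have hlim : Tendsto (fun k : ℕ => (2 * M + (C + 1) / ε * (1 / 2) ^ k) * ρ n) atTop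
        (𝓝 ((2 * M + (C + 1) / ε * 0) * ρ n)) :=
      (((tendsto_pow_atTop_nhds_zero_of_lt_one (by norm_num) (by norm_num)).const_mul _).const_add
        _).mul_const _
    rw [mul_zero, add_zero] at hlim
    exact ⟨ge_of_tendsto' hlim fun k => (iter k t Set.right_mem_uIcc n).1,
      ge_of_tendsto' hlim fun k => (iter k t Set.right_mem_uIcc n).2⟩
  intro n
  have hlim : Tendsto (fun ε : ℝ => 2 * M * (1 / (1 + |(n : ℝ)|) ^ 6 + ε)) (𝓝[>] 0)
      (𝓝 (2 * M * (1 / (1 + |(n : ℝ)|) ^ 6 + 0))) :=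
    ((tendsto_id.mono_left nhdsWithin_le_nhds).const_add _).const_mul _
  rw [add_zero, mul_one_div] at hlim
  exact ⟨ge_of_tendsto hlim (eventually_mem_of_tendsto_nhdsWithin tendsto_id |>.mono
      fun ε hε => (main ε hε n).1),
    ge_of_tendsto hlim (eventually_mem_of_tendsto_nhdsWithin tendsto_id |>.mono
      fun ε hε => (main ε hε n).2)⟩

theorem PointDecay.nonneg {M : ℝ} {a b : ℤ → ℝ} (h : PointDecay M a b) : 0 ≤ M := by
  have := (h 0).2
  simp only [Int.cast_zero, abs_zero, add_zero, one_pow, div_one] at this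
  exact (abs_nonneg _).trans this

/-- The decay at one time persists for all times, uniformly on bounded time intervals. -/
theorem IsTodaSolution.exists_rapidDecay {a b : ℤ → ℝ → ℝ} (hab : IsTodaSolution a b) {t₀ : ℝ}
    (hdecay : HasDecay (fun k => a k t₀) (fun k => b k t₀)) (τ : ℝ) :
    ∃ M, ∀ t, |t| ≤ τ → RapidDecay M (fun k => a k t) (fun k => b k t) := by
  obtain ⟨C', hC'⟩ := hab.bdd (max τ |t₀|)
  set C := max C' 1 with hCdef
  set σ := max τ |t₀| with hσ
  have hC0 : 0 < C := lt_of_lt_of_le one_pos (le_max_right _ _)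
  have hC : ∀ n t, |t| ≤ σ → |a n t| ≤ C ∧ |b n t| ≤ C := fun n t ht =>
    ⟨(hC' n t ht).1.trans (le_max_left _ _), (hC' n t ht).2.trans (le_max_left _ _)⟩
  obtain ⟨M, hM⟩ := hdecay.exists_pointDecay
  have hM0 := hM.nonneg
  have hσ0 : 0 ≤ σ := (abs_nonneg _).trans (le_max_right _ _)
  -- the number of short steps from `t₀` to any time in `[-σ, σ]`
  obtain ⟨k, hk⟩ := exists_nat_gt (2 * σ * (520 * C))
  have hk0 : (0 : ℝ) < k := lt_of_le_of_lt (by positivity) hk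
  have chain : ∀ t, |t| ≤ σ → PointDecay (2 ^ k * M) (fun n => a n t) (fun n => b n t) := by
    intro t ht
    have ht0 : |t₀| ≤ σ := le_max_right _ _
    have hd : |t - t₀| ≤ 2 * σ := (abs_sub _ _).trans (by linarith)
    have hpt : ∀ i : ℕ, i ≤ k → |t₀ + i * ((t - t₀) / k)| ≤ σ := by
      intro i hi
      have hi' : (i : ℝ) / k ≤ 1 := (div_le_one hk0).mpr (by exact_mod_cast hi)
      have hi0 : (0 : ℝ) ≤ i / k := by positivity
      have e : t₀ + i * ((t - t₀) / k) = (1 - i / k) * t₀ + (i / k) * t := by field_simp; ring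
      rw [e]
      refine (abs_add_le _ _).trans ?_
      rw [abs_mul, abs_mul, abs_of_nonneg hi0, abs_of_nonneg (sub_nonneg.mpr hi')]
      nlinarith
    have ind : ∀ i : ℕ, i ≤ k → PointDecay (2 ^ i * M)
        (fun n => a n (t₀ + i * ((t - t₀) / k))) (fun n => b n (t₀ + i * ((t - t₀) / k))) := by
      intro i
      induction i with
      | zero => intro _; simpa using hM
      | succ i ih =>
        intro hi
        have := hab.pointDecay_step hC0 hC (hpt i (by omega)) (hpt (i + 1) hi) ?_
          (by positivity) (ih (by omega))
        · rw [pow_succ, mul_comm (2 ^ i) 2, mul_assoc]; exact this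
        · have e : t₀ + ((i + 1 : ℕ) : ℝ) * ((t - t₀) / k) - (t₀ + i * ((t - t₀) / k)) =
              (t - t₀) / k := by push_cast; ring
          rw [e, abs_div, abs_of_pos hk0, div_le_div_iff₀ hk0 (by positivity)]
          nlinarith
    have := ind k le_rfl
    have e : t₀ + (k : ℝ) * ((t - t₀) / k) = t := by field_simp; ring
    rwa [e] at this
  refine ⟨(2 * (2 * C + 1) + 2) * (2 ^ k * M), fun t ht => ⟨fun n => hab.pos n t, fun n => ?_⟩⟩
  have hts : |t| ≤ σ := ht.trans (le_max_left _ _)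
  obtain ⟨h1, h2⟩ := chain t hts n
  have h3 := (hC n t hts).1
  have e : 4 * a n t ^ 2 - 1 = 2 * (a n t - 1 / 2) * (2 * a n t + 1) := by ring
  simp only at h1 h2 ⊢
  rw [e, abs_mul, abs_mul, abs_mul, abs_two]
  have h4 : |2 * a n t + 1| ≤ 2 * C + 1 := by
    refine (abs_add_le _ _).trans ?_
    rw [abs_mul, abs_two, abs_one]; linarith
  calc 2 * |a n t - 1 / 2| * |2 * a n t + 1| + 2 * |b n t|
      ≤ 2 * (2 ^ k * M / (1 + |(n : ℝ)|) ^ 6) * (2 * C + 1) +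
          2 * (2 ^ k * M / (1 + |(n : ℝ)|) ^ 6) := by gcongr
    _ = _ := by ring

/-! ### Time evolution of the Jost solutions -/

/-- Rapid decay at all times, with bounds that are uniform on bounded time intervals. -/
def LocallyRapidDecay (a b : ℤ → ℝ → ℝ) : Prop :=
  ∀ τ : ℝ, ∃ M, ∀ t, |t| ≤ τ → RapidDecay M (fun k => a k t) (fun k => b k t)

theorem differentiable_jostPolyAux {a b : ℤ → ℝ → ℝ} (hab : IsTodaSolution a b) (N : ℤ) (z : ℂ)
    (k : ℕ) : Differentiable ℝ fun t => aeval z (jostPolyAux (fun j => a j t) (fun j => b j t) N k) := by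
  have ha : ∀ n, Differentiable ℝ fun t => (a n t : ℂ) := fun n t =>
    (hab.deriv_a n t).ofReal_comp.differentiableAt
  have hb : ∀ n, Differentiable ℝ fun t => (b n t : ℂ) := fun n t =>
    (hab.deriv_b n t).ofReal_comp.differentiableAt
  induction k using Nat.strong_induction_on with
  | _ k ih =>
    match k, ih with
    | 0, _ => simp [jostPolyAux]
    | 1, _ => simp [jostPolyAux]
    | k + 2, ih =>
      have h1 := ih (k + 1) (by omega)
      have h0 := ih k (by omega)
      have ha' := ha (N - k)
      have hb' := hb (N - k)
      simp only [jostPolyAux, map_sub, map_mul, map_add, map_one, map_pow, aeval_X, aeval_C,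
        Complex.coe_algebraMap]
      push_cast
      exact (((((hb'.const_mul _).mul_const _).const_sub _)).mul h1).sub
        ((((ha'.pow 2).const_mul _).mul_const _).mul h0)

/-- The time derivative of `jostApprox`. -/
def jostApproxDot (a b : ℤ → ℝ → ℝ) (N : ℤ) (z : ℂ) (t : ℝ) (n : ℤ) : ℂ :=
  deriv (fun t => jostApprox (fun j => a j t) (fun j => b j t) N z n) t

theorem hasDerivAt_jostApprox {a b : ℤ → ℝ → ℝ} (hab : IsTodaSolution a b) (N : ℤ) (z : ℂ)
    (t : ℝ) (n : ℤ) : HasDerivAt (fun t => jostApprox (fun j => a j t) (fun j => b j t) N z n)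
      (jostApproxDot a b N z t n) t :=
  (differentiable_jostPolyAux hab N z _ t).hasDerivAt

theorem jostApproxDot_of_le (a b : ℤ → ℝ → ℝ) {N n : ℤ} (h : N ≤ n) (z : ℂ) (t : ℝ) :
    jostApproxDot a b N z t n = 0 := by
  unfold jostApproxDot
  simp_rw [jostApprox_of_le _ _ h]
  simp

theorem jostApproxDot_rec {a b : ℤ → ℝ → ℝ} (hab : IsTodaSolution a b) {N n : ℤ} (h : n ≤ N)
    (z : ℂ) (t : ℝ) : jostApproxDot a b N z t (n - 1) =
      -(2 * (2 * (a n t ^ 2 - a (n - 1) t ^ 2)) * z) *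
          jostApprox (fun j => a j t) (fun j => b j t) N z n +
        (1 + z ^ 2 - 2 * b n t * z) * jostApproxDot a b N z t n -
        (4 * (2 * a n t * (a n t * (b (n + 1) t - b n t))) * z ^ 2 *
          jostApprox (fun j => a j t) (fun j => b j t) N z (n + 1) +
        4 * a n t ^ 2 * z ^ 2 * jostApproxDot a b N z t (n + 1)) := by
  have e : (fun t => jostApprox (fun j => a j t) (fun j => b j t) N z (n - 1)) = fun t =>
      (1 + z ^ 2 - 2 * (b n t : ℂ) * z) * jostApprox (fun j => a j t) (fun j => b j t) N z n -
      4 * (a n t : ℂ) ^ 2 * z ^ 2 * jostApprox (fun j => a j t) (fun j => b j t) N z (n + 1) := by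
    ext t
    exact jostRec_jostApprox _ _ h z
  have h1 := hasDerivAt_jostApprox hab N z t (n - 1)
  rw [e] at h1
  have ha := (hab.deriv_a n t).ofReal_comp
  have hb := (hab.deriv_b n t).ofReal_comp
  have h2 := ((((hb.const_mul 2).mul_const z).const_sub (1 + z ^ 2)).mul
    (hasDerivAt_jostApprox hab N z t n)).sub
    ((((ha.pow 2).const_mul 4).mul_const (z ^ 2)).mul (hasDerivAt_jostApprox hab N z t (n + 1)))
  rw [h1.unique h2]
  push_cast
  simp

/-- The defect of the cut-off Jost solution in the evolution equation `ġ(n) = z (4 a(n)² g(n+1) -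
g(n))`. By the Lax equation it solves the Jost recursion too, and its data at the cut-off are small. -/
def jostDefect (a b : ℤ → ℝ → ℝ) (N : ℤ) (z : ℂ) (t : ℝ) (n : ℤ) : ℂ :=
  jostApproxDot a b N z t n - z * (4 * a n t ^ 2 *
    jostApprox (fun j => a j t) (fun j => b j t) N z (n + 1) -
      jostApprox (fun j => a j t) (fun j => b j t) N z n)

theorem jostRec_jostDefect {a b : ℤ → ℝ → ℝ} (hab : IsTodaSolution a b) {N n : ℤ} (h : n ≤ N - 1)
    (z : ℂ) (t : ℝ) :
    JostRec (fun j => a j t) (fun j => b j t) z (jostDefect a b N z t) n := by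
  have hD := jostApproxDot_rec hab (show n ≤ N by omega) z t
  have h0 := jostRec_jostApprox (fun j => a j t) (fun j => b j t) (show n ≤ N by omega) z
  have h1 := jostRec_jostApprox (fun j => a j t) (fun j => b j t) (show n + 1 ≤ N by omega) z
  unfold JostRec jostDefect at *
  rw [add_sub_cancel_right] at h1
  rw [sub_add_cancel]
  simp only at h0 h1
  linear_combination hD + z * h0 - 4 * (a n t : ℂ) ^ 2 * z * h1

theorem norm_jostDefect_le {a b : ℤ → ℝ → ℝ} (hab : IsTodaSolution a b) {M t : ℝ}
    (h : RapidDecay M (fun j => a j t) (fun j => b j t)) {z : ℂ} (hz : ‖z‖ ≤ 1) {m : ℤ} {N : ℕ}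
    (hmN : m + 1 ≤ N) (hN : 1 ≤ N) : ‖jostDefect a b N z t m‖ ≤
      stabConst M m * (1 + 2 * ((N : ℝ) - 1 - m)) * ((7 + 2 * M) * (M / (N : ℝ) ^ 6)) := by
  have hM := h.nonneg
  set c := M / (N : ℝ) ^ 6 with hc
  have hN1 : (1 : ℝ) ≤ N := by exact_mod_cast hN
  have hc0 : 0 ≤ c := by positivity
  have hbd : ∀ j : ℤ, (N : ℤ) - 1 ≤ j → |4 * a j t ^ 2 - 1| ≤ c ∧ |2 * b j t| ≤ c := by
    intro j hj
    have h1 := h.bound j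
    have h2 : M / (1 + |(j : ℝ)|) ^ 6 ≤ c := by
      rw [hc]
      have : (N : ℝ) ≤ 1 + |(j : ℝ)| := by
        have h3 : ((N : ℤ) : ℝ) - 1 ≤ j := by exact_mod_cast hj
        have := le_abs_self (j : ℝ)
        push_cast at h3
        linarith
      gcongr
    constructor
    · linarith [abs_nonneg (2 * b j t)]
    · linarith [abs_nonneg (4 * a j t ^ 2 - 1)]
  have hz2 : ‖z ^ 2‖ ≤ 1 := by rw [norm_pow]; exact pow_le_one₀ (norm_nonneg _) hz
  have hsmul : ∀ {x y : ℂ} {r : ℝ}, ‖x‖ ≤ r → ‖y‖ ≤ 1 → ‖x * y‖ ≤ r := by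
    intro x y r hx hy
    rw [norm_mul]
    exact (mul_le_of_le_one_right (norm_nonneg _) hy).trans hx
  have hcM : c ≤ M := div_le_self hM (one_le_pow₀ hN1)
  set F := jostApprox (fun j => a j t) (fun j => b j t) N z with hF
  have hF0 : F N = 1 := jostApprox_of_le _ _ le_rfl z
  have hF1 : F (N + 1) = 1 := jostApprox_of_le _ _ (by omega) z
  have b0 := hbd N (by omega)
  have b1 := hbd (N + 1) (by omega)
  have bm := hbd (N - 1) le_rfl
  have hnr : ∀ r : ℝ, ‖(r : ℂ)‖ = |r| := fun r => by rw [Complex.norm_real, Real.norm_eq_abs]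
  have d0 : ‖jostDefect a b N z t N‖ ≤ c := by
    unfold jostDefect
    rw [jostApproxDot_of_le a b le_rfl, ← hF, hF0, hF1]
    have e : 0 - z * (4 * (a N t : ℂ) ^ 2 * 1 - 1) = ((-(4 * a N t ^ 2 - 1) : ℝ) : ℂ) * z := by
      push_cast; ring
    rw [e]
    exact hsmul (by rw [hnr, abs_neg]; exact b0.1) hz
  have d1 : ‖jostDefect a b N z t (N - 1)‖ ≤ (7 + 2 * M) * c := by
    have hFm : F (N - 1) = (1 + z ^ 2 - 2 * b N t * z) * F N - 4 * a N t ^ 2 * z ^ 2 * F (N + 1) :=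
      jostRec_jostApprox _ _ le_rfl z
    unfold jostDefect
    rw [jostApproxDot_rec hab le_rfl, jostApproxDot_of_le a b le_rfl,
      jostApproxDot_of_le a b (by omega : (N : ℤ) ≤ N + 1), sub_add_cancel, ← hF, hFm, hF0, hF1]
    set s1 : ℝ := (4 * a (N - 1) t ^ 2 - 1) - (4 * a N t ^ 2 - 1) with hs1
    set s2 : ℝ := 4 * a N t ^ 2 * (2 * b (N + 1) t - 2 * b N t) with hs2
    set s3 : ℝ := 4 * a (N - 1) t ^ 2 - 1 with hs3
    have e : -(2 * (2 * ((a N t : ℂ) ^ 2 - (a (N - 1) t : ℂ) ^ 2)) * z) * 1 +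
        (1 + z ^ 2 - 2 * (b N t : ℂ) * z) * 0 -
        (4 * (2 * (a N t : ℂ) * ((a N t : ℂ) * ((b (N + 1) t : ℂ) - (b N t : ℂ)))) * z ^ 2 * 1 +
        4 * (a N t : ℂ) ^ 2 * z ^ 2 * 0) - z * (4 * (a (N - 1) t : ℂ) ^ 2 * 1 -
        ((1 + z ^ 2 - 2 * (b N t : ℂ) * z) * 1 - 4 * (a N t : ℂ) ^ 2 * z ^ 2 * 1)) =
        (s1 : ℂ) * z - (s2 : ℂ) * z ^ 2 - ((s3 : ℂ) * z + (((4 * a N t ^ 2 - 1 : ℝ) : ℂ) * z ^ 2) * z +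
          (((2 * b N t : ℝ) : ℂ) * z) * z) := by
      simp only [hs1, hs2, hs3]
      push_cast; ring
    rw [e]
    have t1 : |s1| ≤ 2 * c := (abs_sub _ _).trans (by linarith [bm.1, b0.1])
    have t2 : |s2| ≤ (1 + M) * (2 * c) := by
      rw [hs2, abs_mul]
      have u1 : |4 * a N t ^ 2| ≤ 1 + M := by
        have : 4 * a N t ^ 2 = 1 + (4 * a N t ^ 2 - 1) := by ring
        rw [this]
        refine (abs_add_le _ _).trans ?_
        rw [abs_one]
        linarith [b0.1]
      have u2 : |2 * b (N + 1) t - 2 * b N t| ≤ 2 * c :=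
        (abs_sub _ _).trans (by linarith [b0.2, b1.2])
      gcongr
    have t3 : |s3| ≤ c := bm.1
    rw [← hnr] at t1 t2 t3
    have n1 := hsmul t1 hz
    have n2 := hsmul t2 hz2
    have n3 := hsmul t3 hz
    have n4 := hsmul (hsmul (hnr (4 * a N t ^ 2 - 1) ▸ b0.1) hz2) hz
    have n5 := hsmul (hsmul (hnr (2 * b N t) ▸ b0.2) hz) hz
    refine (norm_sub_le _ _).trans ?_
    have := norm_sub_le ((s1 : ℂ) * z) ((s2 : ℂ) * z ^ 2)
    have := norm_add₃_le (a := (s3 : ℂ) * z) (b := (((4 * a N t ^ 2 - 1 : ℝ) : ℂ) * z ^ 2) * z)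
      (c := (((2 * b N t : ℝ) : ℂ) * z) * z)
    nlinarith
  have h7 : c ≤ (7 + 2 * M) * c := by nlinarith
  have := jostRec_stability h hz (show m ≤ N - 1 by omega)
    (fun n _ hn => jostRec_jostDefect hab hn z t) d1 (by rw [sub_add_cancel]; exact d0.trans h7)
  push_cast at this
  exact this

theorem tendsto_defect_bound (M : ℝ) (m : ℤ) : Tendsto (fun N : ℕ =>
    stabConst M m * (1 + 2 * ((N : ℝ) - 1 - m)) * ((7 + 2 * M) * (M / (N : ℝ) ^ 6))) atTop (𝓝 0) := by
  have h5 : Tendsto (fun N : ℕ => ((N : ℝ))⁻¹ ^ 5) atTop (𝓝 0) := by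
    have := tendsto_inv_atTop_nhds_zero_nat (𝕜 := ℝ) |>.pow 5
    simpa using this
  have h6 : Tendsto (fun N : ℕ => ((N : ℝ))⁻¹ ^ 6) atTop (𝓝 0) := by
    have := tendsto_inv_atTop_nhds_zero_nat (𝕜 := ℝ) |>.pow 6
    simpa using this
  have h := (h5.const_mul (stabConst M m * 2 * ((7 + 2 * M) * M))).add
    (h6.const_mul (stabConst M m * (1 + 2 * (-1 - m)) * ((7 + 2 * M) * M)))
  rw [mul_zero, mul_zero, add_zero] at h
  refine h.congr' ?_
  filter_upwards [eventually_gt_atTop 0] with N hN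
  have : (N : ℝ) ≠ 0 := by exact_mod_cast hN.ne'
  field_simp
  ring

/-- The Toda evolution of the normalized right Jost solution. -/
theorem hasDerivAt_jostG {a b : ℤ → ℝ → ℝ} (hab : IsTodaSolution a b)
    (hd : LocallyRapidDecay a b) {z : ℂ} (hz : ‖z‖ ≤ 1) (n : ℤ)
    (t : ℝ) : HasDerivAt (fun t => jostG (fun k => a k t) (fun k => b k t) n z)
      (z * (4 * a n t ^ 2 * jostG (fun k => a k t) (fun k => b k t) (n + 1) z -
        jostG (fun k => a k t) (fun k => b k t) n z)) t := by
  obtain ⟨M, hM⟩ := hd (|t| + 1)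
  have hM0 : 0 ≤ M := (hM t (by linarith)).nonneg
  have hs : ∀ r ∈ Metric.ball t 1, RapidDecay M (fun k => a k r) (fun k => b k r) := by
    intro r hr
    apply hM
    rw [Metric.mem_ball, Real.dist_eq] at hr
    have : |r| ≤ |t| + |r - t| := by
      have e : r = t + (r - t) := by ring
      conv_lhs => rw [e]
      exact abs_add_le _ _
    linarith
  -- near `t` the cut-off solutions converge uniformly in time; their time derivatives differ from the
  -- asserted one by the defect and by these errors, all of which are uniformly small
  have tail : ∀ m : ℤ, ∃ u : ℕ → ℝ, Tendsto u atTop (𝓝 0) ∧ ∀ᶠ N : ℕ in atTop,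
      ∀ r ∈ Metric.ball t 1, ‖jostG (fun k => a k r) (fun k => b k r) m z -
        jostApprox (fun k => a k r) (fun k => b k r) N z m‖ ≤ u N := by
    intro m
    have h2 : Tendsto (fun N : ℕ => (N - m).toNat) atTop atTop := by
      rw [tendsto_atTop]
      intro c
      filter_upwards [eventually_ge_atTop (m.natAbs + c)] with N hN
      omega
    refine ⟨_, (tendsto_jostBound_tail M m).comp h2, ?_⟩
    filter_upwards [eventually_ge_atTop m.natAbs] with N hN r hr
    have := jostG_sub_jostApprox (hs r hr) hz m (N - m).toNat
    have e : m + ((N - m).toNat : ℤ) = N := by omega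
    rwa [e] at this
  refine hasDerivAt_of_tendstoUniformlyOn (l := atTop)
    (f := fun (N : ℕ) r => jostApprox (fun k => a k r) (fun k => b k r) N z n)
    (f' := fun (N : ℕ) r => jostApproxDot a b N z r n)
    (g' := fun r => z * (4 * a n r ^ 2 * jostG (fun k => a k r) (fun k => b k r) (n + 1) z -
        jostG (fun k => a k r) (fun k => b k r) n z)) Metric.isOpen_ball ?_
    (Eventually.of_forall fun N r _ => hasDerivAt_jostApprox hab N z r n)
    (fun r hr => tendsto_jostApprox (hs r hr) hz n) (Metric.mem_ball_self one_pos)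
  obtain ⟨u0, hu0, hu0'⟩ := tail n
  obtain ⟨u1, hu1, hu1'⟩ := tail (n + 1)
  have hlim := (tendsto_defect_bound M n).add ((hu1.const_mul (1 + M)).add hu0)
  rw [mul_zero, add_zero, add_zero] at hlim
  rw [Metric.tendstoUniformlyOn_iff]
  intro ε hε
  filter_upwards [hu0', hu1', hlim.eventually_lt_const hε, eventually_ge_atTop (n.natAbs + 1)]
    with N h0 h1 hlt hN r hr
  refine lt_of_le_of_lt ?_ hlt
  have hd := norm_jostDefect_le hab (hs r hr) hz (m := n) (N := N) (by omega) (by omega)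
  have g0 := h0 r hr
  have g1 := h1 r hr
  have hα : ‖(4 * (a n r : ℂ) ^ 2)‖ ≤ 1 + M := by
    have e : (4 * (a n r : ℂ) ^ 2) = ((1 + (4 * a n r ^ 2 - 1) : ℝ) : ℂ) := by push_cast; ring
    rw [e, Complex.norm_real, Real.norm_eq_abs]
    refine (abs_add_le _ _).trans ?_
    rw [abs_one]
    have h3 := (hs r hr).bound n
    have h4 : M / (1 + |(n : ℝ)|) ^ 6 ≤ M :=
      div_le_self hM0 (one_le_pow₀ (by linarith [abs_nonneg (n : ℝ)]))
    linarith [abs_nonneg (2 * b n r)]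
  rw [dist_eq_norm]
  set G0 := jostG (fun k => a k r) (fun k => b k r) n z
  set G1 := jostG (fun k => a k r) (fun k => b k r) (n + 1) z
  have e : z * (4 * (a n r : ℂ) ^ 2 * G1 - G0) - jostApproxDot a b N z r n =
      -(jostDefect a b N z r n) + z * (4 * (a n r : ℂ) ^ 2 *
        (G1 - jostApprox (fun k => a k r) (fun k => b k r) N z (n + 1)) -
        (G0 - jostApprox (fun k => a k r) (fun k => b k r) N z n)) := by
    unfold jostDefect; ring
  rw [e]
  refine (norm_add_le _ _).trans (add_le_add (by rw [norm_neg]; exact hd) ?_)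
  rw [norm_mul]
  refine (mul_le_of_le_one_left (norm_nonneg _) hz).trans ((norm_sub_le _ _).trans ?_)
  refine add_le_add ?_ g0
  rw [norm_mul]
  gcongr

/-- The Toda evolution of the amplitude: the logarithmic derivative is a telescoping sum. -/
theorem hasDerivAt_jostAmp {a b : ℤ → ℝ → ℝ} (hab : IsTodaSolution a b)
    (hd : LocallyRapidDecay a b) (n : ℤ) (t : ℝ) :
    HasDerivAt (fun t => jostAmp (fun k => a k t) n)
      (b n t * jostAmp (fun k => a k t) n) t := by
  obtain ⟨M, hM⟩ := hd (|t| + 1)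
  have hs : ∀ r ∈ Metric.ball t 1, RapidDecay M (fun k => a k r) (fun k => b k r) := by
    intro r hr
    apply hM
    rw [Metric.mem_ball, Real.dist_eq] at hr
    have : |r| ≤ |t| + |r - t| := by
      have e : r = t + (r - t) := by ring
      conv_lhs => rw [e]
      exact abs_add_le _ _
    linarith
  have ht := hs t (Metric.mem_ball_self one_pos)
  have hinj : ∀ m : ℤ, Function.Injective fun k : ℕ => m + (k : ℤ) :=
    fun m i j hij => by simp only at hij; omega
  have hsum := (summable_int_one_add_abs_pow (p := 6) (by norm_num)).mul_left M
  have hb : ∀ r ∈ Metric.ball t 1, ∀ j : ℤ, |b j r| ≤ M * (1 / (1 + |(j : ℝ)|) ^ 6) := by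
    intro r hr j
    have h1 := (hs r hr).bound j
    rw [mul_one_div]
    have h2 : |2 * b j r| = 2 * |b j r| := by rw [abs_mul, abs_two]
    linarith [abs_nonneg (4 * a j r ^ 2 - 1), abs_nonneg (b j r)]
  have hlog : HasDerivAt (fun r => ∑' k : ℕ, Real.log (2 * a (n + k) r))
      (∑' k : ℕ, (b (n + k + 1) t - b (n + k) t)) t := by
    refine hasDerivAt_tsum_of_isPreconnected (t := Metric.ball t 1)
      (g' := fun (k : ℕ) r => b (n + k + 1) r - b (n + k) r)
      ((hsum.comp_injective (hinj (n + 1))).add (hsum.comp_injective (hinj n)))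
      Metric.isOpen_ball (convex_ball t 1).isPreconnected (fun k r _ => ?_) (fun k r hr => ?_)
      (Metric.mem_ball_self one_pos) (ht.summable_log n) (Metric.mem_ball_self one_pos)
    · have hp := hab.pos (n + k) r
      have h1 := ((hab.deriv_a (n + k) r).const_mul 2).log (by positivity)
      refine h1.congr_deriv ?_
      field_simp
    · refine (norm_sub_le _ _).trans (add_le_add ?_ ?_)
      · have e : n + (k : ℤ) + 1 = n + 1 + k := by ring
        rw [e]; exact hb r hr _
      · exact hb r hr _
  have hbs : Summable fun k : ℕ => b (n + k) t :=
    Summable.of_norm_bounded (hsum.comp_injective (hinj n))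
      fun k => hb t (Metric.mem_ball_self one_pos) _
  have htele : ∑' k : ℕ, (b (n + k + 1) t - b (n + k) t) = -b n t := by
    have e : ∀ k : ℕ, b (n + k + 1) t = b (n + ((k + 1 : ℕ) : ℤ)) t := fun k => by
      push_cast; rw [add_assoc]
    simp_rw [e]
    rw [((summable_nat_add_iff 1).mpr hbs).tsum_sub hbs, hbs.tsum_eq_zero_add]
    simp
  rw [htele] at hlog
  have h := hlog.neg.exp
  refine h.congr_deriv ?_
  rw [neg_neg, mul_comm]
  rfl

/-- A sequence solves the Lax evolution with parameter `κ` when `u̇(n) = 2 a(n) u(n+1) + (b(n) - κ)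
u(n)`. On solutions of the Jacobi difference equation this is the flow of the second Lax operator up
to normalization. -/
def LaxEvolves (a b : ℤ → ℝ → ℝ) (κ : ℂ) (u : ℝ → ℤ → ℂ) : Prop :=
  ∀ n t, HasDerivAt (fun t => u t n) (2 * a n t * u t (n + 1) + (b n t - κ) * u t n) t

theorem laxEvolves_psiPlus {a b : ℤ → ℝ → ℝ} (hab : IsTodaSolution a b)
    (hd : LocallyRapidDecay a b) {z : ℂ} (hz0 : z ≠ 0) (hz : ‖z‖ ≤ 1) :
    LaxEvolves a b z fun t => psiPlus (fun k => a k t) (fun k => b k t) z := by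
  intro n t
  obtain ⟨M, hM⟩ := hd |t|
  have h1 := ((hasDerivAt_jostAmp hab hd n t).ofReal_comp.mul_const (z ^ n)).mul
    (hasDerivAt_jostG hab hd hz n t)
  refine h1.congr_deriv ?_
  simp only [psiPlus]
  rw [jostAmp_succ (hM t le_rfl), zpow_add_one₀ hz0]
  push_cast
  ring

/-- The reflected and time-reversed Toda solution. -/
theorem IsTodaSolution.reflect {a b : ℤ → ℝ → ℝ} (hab : IsTodaSolution a b) :
    IsTodaSolution (fun n t => a (-n - 1) (-t)) (fun n t => b (-n) (-t)) := by
  refine ⟨fun n t => hab.pos _ _, fun n t => ?_, fun n t => ?_, fun τ => ?_⟩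
  · have h := (hab.deriv_b (-n) (-t)).comp t (hasDerivAt_neg t)
    refine h.congr_deriv ?_
    have e : -(n - 1) - 1 = -n := by ring
    rw [e]; ring
  · have h := (hab.deriv_a (-n - 1) (-t)).comp t (hasDerivAt_neg t)
    refine h.congr_deriv ?_
    have e : -(n + 1) = -n - 1 := by ring
    rw [e, sub_add_cancel]; ring
  · obtain ⟨C, hC⟩ := hab.bdd τ
    refine ⟨C, fun n t ht => ?_⟩
    have ht' : |-t| ≤ τ := by rwa [abs_neg]
    exact ⟨(hC _ _ ht').1, (hC _ _ ht').2⟩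

theorem LocallyRapidDecay.reflect {a b : ℤ → ℝ → ℝ} (hd : LocallyRapidDecay a b) :
    LocallyRapidDecay (fun n t => a (-n - 1) (-t)) (fun n t => b (-n) (-t)) := fun τ => by
  obtain ⟨M, hM⟩ := hd τ
  exact ⟨65 * M, fun t ht => (hM (-t) (by rwa [abs_neg])).reflect⟩

theorem laxEvolves_psiMinus {a b : ℤ → ℝ → ℝ} (hab : IsTodaSolution a b)
    (hd : LocallyRapidDecay a b)
    {z : ℂ} (hz0 : z ≠ 0) (hz : ‖z‖ ≤ 1) :
    LaxEvolves a b z⁻¹ fun t => psiMinus (fun k => a k t) (fun k => b k t) z := by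
  intro n t
  obtain ⟨M, hM⟩ := hd |t|
  have h1 := (laxEvolves_psiPlus hab.reflect hd.reflect hz0 hz (-n) (-t)).scomp t
    (hasDerivAt_neg t)
  simp only [Function.comp_def, neg_neg] at h1
  have h2 : (fun t => psiPlus (fun k => a (-k - 1) t) (fun k => b (-k) t) z (-n)) =
      fun t => psiMinus (fun k => a k t) (fun k => b k t) z n := rfl
  rw [h2] at h1
  refine h1.congr_deriv ?_
  have hs := solvesAt_psiMinus (hM t le_rfl) hz0 hz n
  have e1 : psiPlus (fun k => a (-k - 1) t) (fun k => b (-k) t) z (-n) =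
      psiMinus (fun k => a k t) (fun k => b k t) z n := rfl
  have e2 : psiPlus (fun k => a (-k - 1) t) (fun k => b (-k) t) z (-n + 1) =
      psiMinus (fun k => a k t) (fun k => b k t) z (n - 1) := by
    unfold psiMinus
    rw [neg_sub, sub_eq_neg_add]; rfl
  rw [e1, e2]
  unfold jacobi at hs
  simp only [neg_smul, one_smul]
  linear_combination -2 * hs

theorem eq_exp_mul_of_hasDerivAt {y : ℝ → ℂ} {κ : ℂ} (h : ∀ t, HasDerivAt y (κ * y t) t) (t : ℝ) :
    y t = Complex.exp (t * κ) * y 0 := by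
  have h1 : ∀ t : ℝ, HasDerivAt (fun t : ℝ => Complex.exp (-((t : ℂ) * κ)) * y t) 0 t := by
    intro t
    have h2 : HasDerivAt (fun t : ℝ => -((t : ℂ) * κ)) (-(1 * κ)) t :=
      ((Complex.ofRealCLM.hasDerivAt (x := t)).mul_const κ).neg
    refine (h2.cexp.mul (h t)).congr_deriv ?_
    ring
  have h2 := is_const_of_deriv_eq_zero (fun t => (h1 t).differentiableAt) (fun t => (h1 t).deriv) t 0
  simp only [Complex.ofReal_zero, zero_mul, neg_zero, Complex.exp_zero, one_mul] at h2
  rw [← h2, ← mul_assoc, ← Complex.exp_add, add_neg_cancel, Complex.exp_zero, one_mul]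

/-- The Wronskian of two solutions that follow the Lax evolution is an exponential in time. -/
theorem wr_eq_exp_mul {a b : ℤ → ℝ → ℝ} (hab : IsTodaSolution a b) {lam κ κ' : ℂ}
    {u v : ℝ → ℤ → ℂ}
    (hu : ∀ t n, jacobi (fun k => a k t) (fun k => b k t) (u t) n = lam * u t n)
    (hv : ∀ t n, jacobi (fun k => a k t) (fun k => b k t) (v t) n = lam * v t n)
    (hu' : LaxEvolves a b κ u) (hv' : LaxEvolves a b κ' v) (t : ℝ) :
    wr (fun k => a k t) (u t) (v t) 0 =
      Complex.exp (t * (2 * lam - κ - κ')) * wr (fun k => a k 0) (u 0) (v 0) 0 := by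
  refine eq_exp_mul_of_hasDerivAt (y := fun t => wr (fun k => a k t) (u t) (v t) 0) (fun t => ?_) t
  have h := (hab.deriv_a 0 t).ofReal_comp.mul
    (((hu' 0 t).mul (hv' (0 + 1) t)).sub ((hu' (0 + 1) t).mul (hv' 0 t)))
  refine h.congr_deriv ?_
  unfold wr
  have e1 := hu t (0 + 1)
  have e2 := hv t (0 + 1)
  unfold jacobi at e1 e2
  rw [add_sub_cancel_right] at e1 e2
  push_cast
  simp only [Pi.sub_apply, Pi.mul_apply, zero_add, one_add_one_eq_two] at e1 e2 ⊢
  linear_combination 2 * (a 0 t : ℂ) * (u t 0 * e2 - v t 0 * e1)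

/-! ### Wronskians of Jost solutions on the unit circle -/

theorem wr_refl (a : ℤ → ℝ) (u v : ℤ → ℂ) (n : ℤ) :
    wr (reflA a) (fun m => u (-m)) (fun m => v (-m)) n = -wr a u v (-n - 1) := by
  unfold wr reflA
  have e : -(n + 1) = -n - 1 := by ring
  simp only [e, sub_add_cancel]
  ring

theorem psiPlus_conj (a b : ℤ → ℝ) (z : ℂ) (n : ℤ) :
    psiPlus a b (conj z) n = conj (psiPlus a b z n) := by
  simp [psiPlus, jostG_conj, map_zpow₀]

theorem psiMinus_conj (a b : ℤ → ℝ) (z : ℂ) (n : ℤ) :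
    psiMinus a b (conj z) n = conj (psiMinus a b z n) := psiPlus_conj _ _ _ _

theorem inv_eq_conj_of_norm {z : ℂ} (hz : ‖z‖ = 1) : z⁻¹ = conj z := Complex.inv_eq_conj hz

theorem ne_zero_of_norm_eq_one {z : ℂ} (hz : ‖z‖ = 1) : z ≠ 0 := by
  rintro rfl; simp at hz

theorem solvesAt_inv {a b : ℤ → ℝ} {z : ℂ} {u : ℤ → ℂ} (h : SolvesAt a b z⁻¹ u) :
    ∀ n, jacobi a b u n = (z + z⁻¹) / 2 * u n := fun n => by
  have := h n
  rwa [inv_inv, add_comm] at this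

theorem wr_psiPlus_psiPlus_inv {M : ℝ} {a b : ℤ → ℝ} (h : RapidDecay M a b) {z : ℂ}
    (hz : ‖z‖ = 1) (n : ℤ) : wr a (psiPlus a b z) (psiPlus a b z⁻¹) n = (z⁻¹ - z) / 2 := by
  have hz0 := ne_zero_of_norm_eq_one hz
  have hzi : ‖z⁻¹‖ = 1 := by rw [norm_inv, hz, inv_one]
  have h1 := tendsto_wr h hz0 (inv_ne_zero hz0) (tendsto_psiPlus h hz0 hz.le)
    (tendsto_psiPlus h (inv_ne_zero hz0) hzi.le)
  have hs := solvesAt_psiPlus h hz0 hz.le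
  have hs' := solvesAt_inv (solvesAt_psiPlus h (inv_ne_zero hz0) hzi.le)
  simp only [mul_inv_cancel₀ hz0, one_zpow, one_mul] at h1
  have h2 : Tendsto (fun _ : ℤ => wr a (psiPlus a b z) (psiPlus a b z⁻¹) 0) atTop
      (𝓝 (1 / 2 * (z⁻¹ - z))) := h1.congr fun n => wr_eq_of_solves hs hs' n
  rw [wr_eq_of_solves hs hs', tendsto_nhds_unique tendsto_const_nhds h2]
  ring

theorem wr_psiMinus_psiMinus_inv {M : ℝ} {a b : ℤ → ℝ} (h : RapidDecay M a b) {z : ℂ}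
    (hz : ‖z‖ = 1) (n : ℤ) : wr a (psiMinus a b z) (psiMinus a b z⁻¹) n = -((z⁻¹ - z) / 2) := by
  have h1 := wr_psiPlus_psiPlus_inv h.reflect hz (-n - 1)
  have h2 := wr_refl a (psiMinus a b z) (psiMinus a b z⁻¹) (-n - 1)
  simp only [psiMinus, neg_neg] at h2 ⊢
  rw [h1] at h2
  have e : -(-n - 1) - 1 = n := by ring
  rw [e] at h2
  rw [h2, neg_neg]

/-- The scattering identity `|W(ψ₊, ψ₋)|² = |W(ψ̄₊, ψ₋)|² + (Im z)²` on the unit circle; it is the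
Plücker relation for the four solutions `ψ₊, ψ̄₊, ψ₋, ψ̄₋`. -/
theorem normSq_wr_eq {M : ℝ} {a b : ℤ → ℝ} (h : RapidDecay M a b) {z : ℂ} (hz : ‖z‖ = 1) :
    ‖wr a (psiPlus a b z) (psiMinus a b z) 0‖ ^ 2 =
      ‖wr a (psiPlus a b z⁻¹) (psiMinus a b z) 0‖ ^ 2 + z.im ^ 2 := by
  have h1 := wr_psiPlus_psiPlus_inv h hz 0
  have h2 := wr_psiMinus_psiMinus_inv h hz 0
  have pl : wr a (psiPlus a b z) (psiPlus a b z⁻¹) 0 * wr a (psiMinus a b z) (psiMinus a b z⁻¹) 0 =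
      wr a (psiPlus a b z) (psiMinus a b z) 0 * wr a (psiPlus a b z⁻¹) (psiMinus a b z⁻¹) 0 -
      wr a (psiPlus a b z) (psiMinus a b z⁻¹) 0 * wr a (psiPlus a b z⁻¹) (psiMinus a b z) 0 := by
    unfold wr; ring
  have c1 : wr a (psiPlus a b z⁻¹) (psiMinus a b z⁻¹) 0 =
      conj (wr a (psiPlus a b z) (psiMinus a b z) 0) := by
    simp [wr, inv_eq_conj_of_norm hz, psiPlus_conj, psiMinus_conj]
  have c2 : wr a (psiPlus a b z) (psiMinus a b z⁻¹) 0 =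
      conj (wr a (psiPlus a b z⁻¹) (psiMinus a b z) 0) := by
    simp [wr, inv_eq_conj_of_norm hz, psiPlus_conj, psiMinus_conj]
  rw [h1, h2, c1, c2, Complex.mul_conj, mul_comm ((starRingEnd ℂ) _) (wr a (psiPlus a b z⁻¹) _ 0),
    Complex.mul_conj] at pl
  have e : z⁻¹ - z = ((-2 * z.im : ℝ) : ℂ) * Complex.I := by
    rw [inv_eq_conj_of_norm hz]
    apply Complex.ext <;> simp
    ring
  rw [e] at pl
  have pl' : ((z.im ^ 2 : ℝ) : ℂ) = ((Complex.normSq (wr a (psiPlus a b z) (psiMinus a b z) 0) -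
      Complex.normSq (wr a (psiPlus a b z⁻¹) (psiMinus a b z) 0) : ℝ) : ℂ) := by
    push_cast
    rw [← pl]
    push_cast
    linear_combination (z.im : ℂ) ^ 2 * Complex.I_sq
  have := Complex.ofReal_injective pl'
  rw [← Complex.normSq_eq_norm_sq, ← Complex.normSq_eq_norm_sq]
  linarith

/-- The unit circle without the band edges `±1`. -/
def openCircle : Set ℂ := {z : ℂ | ‖z‖ = 1 ∧ z ≠ 1 ∧ z ≠ -1}

theorem im_ne_zero_of_mem_openCircle {z : ℂ} (hz : z ∈ openCircle) : z.im ≠ 0 := by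
  obtain ⟨h1, h2, h3⟩ := hz
  intro him
  have hre : z = (z.re : ℂ) := Complex.ext (by simp) (by simp [him])
  rw [hre, Complex.norm_real, Real.norm_eq_abs, abs_eq zero_le_one] at h1
  rcases h1 with h | h <;> rw [h] at hre
  · exact h2 (by simpa using hre)
  · exact h3 (by simpa using hre)

theorem mem_closure_openCircle {z : ℂ} (hz : ‖z‖ = 1) : z ∈ closure openCircle := by
  by_cases hz' : z ∈ openCircle
  · exact subset_closure hz'
  have hz1 : z = 1 ∨ z = -1 := by
    unfold openCircle at hz'
    simp only [Set.mem_ofPred_eq, hz, true_and, not_and_or, not_not] at hz'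
    exact hz'
  have hzz : z.im = 0 ∧ z.re ≠ 0 := by rcases hz1 with rfl | rfl <;> simp
  have hc : Tendsto (fun θ : ℝ => z * Complex.exp (θ * Complex.I)) (𝓝[>] 0) (𝓝 z) := by
    have : Continuous fun θ : ℝ => z * Complex.exp (θ * Complex.I) := by fun_prop
    have h := this.tendsto 0
    simp only [Complex.ofReal_zero, zero_mul, Complex.exp_zero, mul_one] at h
    exact h.mono_left nhdsWithin_le_nhds
  refine mem_closure_of_tendsto hc ?_
  filter_upwards [Ioo_mem_nhdsGT (show (0 : ℝ) < 1 by norm_num)] with θ hθ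
  have him : (z * Complex.exp (θ * Complex.I)).im ≠ 0 := by
    rw [Complex.mul_im, hzz.1, zero_mul, add_zero, Complex.exp_ofReal_mul_I_im]
    refine mul_ne_zero hzz.2 (Real.sin_pos_of_pos_of_lt_pi hθ.1 ?_).ne'
    linarith [Real.pi_gt_three, hθ.2]
  refine ⟨?_, ?_, ?_⟩
  · rw [norm_mul, hz, Complex.norm_exp_ofReal_mul_I, mul_one]
  · intro h; rw [h] at him; simp at him
  · intro h; rw [h] at him; simp at him

theorem jostW_ne_zero_of_mem_openCircle {M : ℝ} {a b : ℤ → ℝ} (h : RapidDecay M a b) {z : ℂ}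
    (hz : z ∈ openCircle) : jostW a b z ≠ 0 := by
  intro h0
  have h1 := normSq_wr_eq h hz.1
  rw [wr_psi_eq h (ne_zero_of_norm_eq_one hz.1), h0, mul_zero, norm_zero] at h1
  have h2 : 0 < z.im ^ 2 := by
    have := im_ne_zero_of_mem_openCircle hz
    positivity
  have := sq_nonneg ‖wr a (psiPlus a b z⁻¹) (psiMinus a b z) 0‖
  norm_num at h1
  linarith

theorem norm_one_sub_sq_of_norm {z : ℂ} (hz : ‖z‖ = 1) : ‖1 - z ^ 2‖ = 2 * |z.im| := by
  have hz0 := ne_zero_of_norm_eq_one hz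
  have e : 1 - z ^ 2 = z * (z⁻¹ - z) := by field_simp
  have e2 : conj z - z = ((-2 * z.im : ℝ) : ℂ) * Complex.I := by
    apply Complex.ext <;> simp
    ring
  rw [e, norm_mul, hz, inv_eq_conj_of_norm hz, e2, norm_mul, Complex.norm_I, Complex.norm_real,
    Real.norm_eq_abs, abs_mul]
  norm_num

/-- On the unit circle the Wronskian vanishes at most to first order at the band edges. -/
theorem norm_jostW_ge {M : ℝ} {a b : ℤ → ℝ} (h : RapidDecay M a b) {z : ℂ} (hz : ‖z‖ = 1) :
    ‖1 - z ^ 2‖ / totalAmp a ≤ ‖jostW a b z‖ := by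
  have hA := totalAmp_pos a
  have h1 := normSq_wr_eq h hz
  rw [wr_psi_eq h (ne_zero_of_norm_eq_one hz)] at h1
  have h2 : |z.im| ≤ ‖(totalAmp a : ℂ) / (2 * z) * jostW a b z‖ := by
    rw [← Real.sqrt_sq_eq_abs, ← Real.sqrt_sq (norm_nonneg ((totalAmp a : ℂ) / (2 * z) * jostW a b z))]
    apply Real.sqrt_le_sqrt
    rw [h1]
    linarith [sq_nonneg ‖wr a (psiPlus a b z⁻¹) (psiMinus a b z) 0‖]
  rw [norm_mul, norm_div, norm_mul, hz, Complex.norm_real, Real.norm_eq_abs, abs_of_pos hA] at h2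
  norm_num at h2
  rw [norm_one_sub_sq_of_norm hz, div_le_iff₀ hA]
  nlinarith

/-- The transmission coefficient extends continuously to every boundary point of the disc. At a
band edge where the Wronskian vanishes its zero is simple by `norm_jostW_ge`. -/
theorem exists_tendsto_one_sub_sq_div_jostW {M : ℝ} {a b : ℤ → ℝ} (h : RapidDecay M a b) {w : ℂ}
    (hw : ‖w‖ = 1) : ∃ L, Tendsto (fun z => (1 - z ^ 2) / jostW a b z)
      (𝓝[Metric.closedBall 0 1 \ {w}] w) (𝓝 L) ∧
      ∀ᶠ z in 𝓝[Metric.closedBall 0 1 \ {w}] w, jostW a b z ≠ 0 := by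
  have hwm : w ∈ Metric.closedBall (0 : ℂ) 1 := by simp [hw]
  by_cases h0 : jostW a b w = 0
  · have hw1 : w ^ 2 = 1 := by
      have : w ∉ openCircle := fun hc => jostW_ne_zero_of_mem_openCircle h hc h0
      unfold openCircle at this
      simp only [Set.mem_ofPred_eq, hw, true_and, not_and_or, not_not] at this
      rcases this with rfl | rfl <;> norm_num
    obtain ⟨d, hd⟩ := exists_hasDerivWithinAt_jostW h hw.le
    have hsl := hasDerivWithinAt_iff_tendsto_slope.mp hd
    have hA := totalAmp_pos a
    -- the derivative can be computed along the circle, where the lower bound is available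
    have hd0 : 2 / totalAmp a ≤ ‖d‖ := by
      have hne : (𝓝[openCircle \ {w}] w).NeBot := by
        rw [← mem_closure_iff_nhdsWithin_neBot]
        have : w ∉ openCircle := fun hc => jostW_ne_zero_of_mem_openCircle h hc h0
        rw [Set.sdiff_singleton_eq_self this]
        exact mem_closure_openCircle hw
      have hsub : openCircle \ {w} ⊆ Metric.closedBall (0 : ℂ) 1 \ {w} :=
        Set.sdiff_subset_sdiff_left fun z hz => by simp [hz.1]
      have l1 := (hsl.mono_left (nhdsWithin_mono w hsub)).norm
      have l2 : Tendsto (fun z : ℂ => ‖w + z‖ / totalAmp a) (𝓝[openCircle \ {w}] w)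
          (𝓝 (‖w + w‖ / totalAmp a)) := by
        have : Continuous fun z : ℂ => ‖w + z‖ / totalAmp a := by fun_prop
        exact (this.tendsto w).mono_left nhdsWithin_le_nhds
      have e2 : ‖w + w‖ = 2 := by
        rw [← two_mul, norm_mul, hw]; norm_num
      rw [e2] at l2
      refine le_of_tendsto_of_tendsto l2 l1 ?_
      filter_upwards [self_mem_nhdsWithin] with z hz
      have hzw : z - w ≠ 0 := sub_ne_zero.mpr hz.2
      have h3 := norm_jostW_ge h hz.1.1
      rw [slope_def_field, h0, sub_zero, norm_div, le_div_iff₀ (norm_pos_iff.mpr hzw)]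
      have e3 : 1 - z ^ 2 = -((w + z) * (z - w)) := by rw [← hw1]; ring
      rw [e3, norm_neg, norm_mul] at h3
      calc ‖w + z‖ / totalAmp a * ‖z - w‖ = ‖w + z‖ * ‖z - w‖ / totalAmp a := by ring
        _ ≤ _ := h3
    have hd1 : d ≠ 0 := by
      rintro rfl
      rw [norm_zero] at hd0
      have : 0 < 2 / totalAmp a := by positivity
      linarith
    have hslne := hsl.eventually_ne hd1
    have eW : ∀ z ∈ Metric.closedBall (0 : ℂ) 1 \ {w},
        jostW a b z = slope (jostW a b) w z * (z - w) := by
      intro z hz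
      have hzw : z - w ≠ 0 := sub_ne_zero.mpr hz.2
      rw [slope_def_field, h0, sub_zero, div_mul_cancel₀ _ hzw]
    refine ⟨-(w + w) / d, ?_, ?_⟩
    · have l2 : Tendsto (fun z : ℂ => -(w + z)) (𝓝[Metric.closedBall 0 1 \ {w}] w)
          (𝓝 (-(w + w))) := by
        have : Continuous fun z : ℂ => -(w + z) := by fun_prop
        exact (this.tendsto w).mono_left nhdsWithin_le_nhds
      refine (l2.div hsl hd1).congr' ?_
      filter_upwards [self_mem_nhdsWithin, hslne] with z hz hs
      have hzw : z - w ≠ 0 := sub_ne_zero.mpr hz.2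
      rw [eW z hz, Pi.div_apply, div_eq_div_iff hs (mul_ne_zero hs hzw), ← hw1]
      ring
    · filter_upwards [self_mem_nhdsWithin, hslne] with z hz hs
      rw [eW z hz]
      exact mul_ne_zero hs (sub_ne_zero.mpr hz.2)
  · have hc : Tendsto (jostW a b) (𝓝[Metric.closedBall 0 1 \ {w}] w) (𝓝 (jostW a b w)) :=
      (continuousOn_jostW h w hwm).mono_left (nhdsWithin_mono _ Set.sdiff_subset)
    have l2 : Tendsto (fun z : ℂ => 1 - z ^ 2) (𝓝[Metric.closedBall 0 1 \ {w}] w)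
        (𝓝 (1 - w ^ 2)) := by
      have : Continuous fun z : ℂ => 1 - z ^ 2 := by fun_prop
      exact (this.tendsto w).mono_left nhdsWithin_le_nhds
    exact ⟨_, l2.div hc h0, hc.eventually_ne h0⟩

/-! ### Eigenvalues -/

theorem RapidDecay.abs_coeff_le {M : ℝ} {a b : ℤ → ℝ} (h : RapidDecay M a b) (n : ℤ) :
    |a n| ≤ 1 + M := by
  have h1 := h.abs_two_mul_sub_one_le n
  have h2 : M / (1 + |(n : ℝ)|) ^ 6 ≤ M :=
    div_le_self h.nonneg (one_le_pow₀ (by linarith [abs_nonneg (n : ℝ)]))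
  have h3 := h.nonneg
  rw [abs_le] at h1
  rw [abs_of_pos (h.pos n)]
  linarith [h1.2]

theorem tendsto_wr_atTop_zero {M : ℝ} {a b : ℤ → ℝ} (h : RapidDecay M a b) {u v : ℤ → ℂ} {K : ℝ}
    (hu : Tendsto u atTop (𝓝 0)) (hv : ∀ n, 0 ≤ n → ‖v n‖ ≤ K) :
    Tendsto (wr a u v) atTop (𝓝 0) := by
  have hM := h.nonneg
  have hs : Tendsto (fun n : ℤ => n + 1) atTop atTop := tendsto_atTop_add_const_right _ _ tendsto_id
  have h1 := (hu.norm.add (hu.comp hs).norm).const_mul ((1 + M) * K)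
  rw [norm_zero, add_zero, mul_zero] at h1
  refine squeeze_zero_norm' ?_ h1
  filter_upwards [eventually_ge_atTop 0] with n hn
  unfold wr
  rw [norm_mul, Complex.norm_real, Real.norm_eq_abs, mul_assoc]
  have h2 := hv n hn
  have h3 := hv (n + 1) (by omega)
  refine mul_le_mul (h.abs_coeff_le n) ?_ (norm_nonneg _) (by linarith)
  refine (norm_sub_le _ _).trans ?_
  rw [norm_mul, norm_mul, Function.comp_apply]
  nlinarith [norm_nonneg (u n), norm_nonneg (u (n + 1))]

theorem tendsto_wr_atBot_zero {M : ℝ} {a b : ℤ → ℝ} (h : RapidDecay M a b) {u v : ℤ → ℂ} {K : ℝ}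
    (hu : Tendsto u atBot (𝓝 0)) (hv : ∀ n, n ≤ 0 → ‖v n‖ ≤ K) :
    Tendsto (wr a u v) atBot (𝓝 0) := by
  have h1 := tendsto_wr_atTop_zero h.reflect (u := fun m => u (-m)) (v := fun m => v (-m)) (K := K)
    (hu.comp tendsto_neg_atTop_atBot) fun n hn => hv (-n) (by omega)
  have hs : Tendsto (fun n : ℤ => -n - 1) atBot atTop := by
    simp_rw [sub_eq_add_neg]
    exact tendsto_atTop_add_const_right _ _ tendsto_neg_atBot_atTop
  have h2 := (h1.comp hs).neg
  rw [neg_zero] at h2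
  refine h2.congr fun n => ?_
  rw [Function.comp_apply, wr_refl, neg_neg]
  congr 1; ring

theorem exists_norm_psiPlus_le {M : ℝ} {a b : ℤ → ℝ} (h : RapidDecay M a b) :
    ∃ K, 0 ≤ K ∧ ∀ (n : ℤ) (z : ℂ), 0 ≤ n → ‖z‖ ≤ 1 → ‖psiPlus a b z n‖ ≤ K * ‖z‖ ^ n := by
  obtain ⟨K, hK0, hK⟩ := exists_norm_jostG_le h
  have hb : ∃ C, ∀ n : ℕ, |jostAmp a n| ≤ C := by
    have h1 : Tendsto (fun n : ℕ => jostAmp a n) atTop (𝓝 1) := by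
      have := tendsto_jostAmp_atTop a
      rwa [← Nat.map_cast_int_atTop, tendsto_map'_iff] at this
    obtain ⟨C, hC⟩ := h1.norm.bddAbove_range
    exact ⟨C, fun n => hC ⟨n, rfl⟩⟩
  obtain ⟨C, hC⟩ := hb
  have hC0 : 0 ≤ C := (abs_nonneg _).trans (hC 0)
  refine ⟨C * K, by positivity, fun n z hn hz => ?_⟩
  have hg := hK n z hn hz
  lift n to ℕ using hn
  unfold psiPlus
  rw [norm_mul, norm_mul, Complex.norm_real, Real.norm_eq_abs, norm_zpow]
  have h1 := hC n
  calc |jostAmp a n| * ‖z‖ ^ (n : ℤ) * ‖jostG a b n z‖ ≤ C * ‖z‖ ^ (n : ℤ) * K := by gcongr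
    _ = _ := by ring

theorem exists_norm_psiMinus_le {M : ℝ} {a b : ℤ → ℝ} (h : RapidDecay M a b) :
    ∃ K, 0 ≤ K ∧ ∀ (n : ℤ) (z : ℂ), n ≤ 0 → ‖z‖ ≤ 1 → ‖psiMinus a b z n‖ ≤ K * ‖z‖ ^ (-n) := by
  obtain ⟨K, hK0, hK⟩ := exists_norm_psiPlus_le h.reflect
  exact ⟨K, hK0, fun n z hn hz => hK (-n) z (by omega) hz⟩

theorem tendsto_zpow_atTop_zero {r : ℝ} (h0 : 0 ≤ r) (h1 : r < 1) :
    Tendsto (fun n : ℤ => r ^ n) atTop (𝓝 0) := by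
  rw [← Nat.map_cast_int_atTop, tendsto_map'_iff]
  exact (tendsto_pow_atTop_nhds_zero_of_lt_one h0 h1).congr fun n => by simp

theorem psiPlus_ne_zero {M : ℝ} {a b : ℤ → ℝ} (h : RapidDecay M a b) {z : ℂ} (hz0 : z ≠ 0)
    (hz : ‖z‖ ≤ 1) : psiPlus a b z ≠ 0 := by
  intro h0
  have hpl := tendsto_psiPlus h hz0 hz
  rw [h0] at hpl
  simp only [Pi.zero_apply, mul_zero] at hpl
  exact zero_ne_one (tendsto_nhds_unique tendsto_const_nhds hpl)

theorem psiMinus_ne_zero {M : ℝ} {a b : ℤ → ℝ} (h : RapidDecay M a b) {z : ℂ} (hz0 : z ≠ 0)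
    (hz : ‖z‖ ≤ 1) : psiMinus a b z ≠ 0 := by
  intro h0
  refine psiPlus_ne_zero h.reflect hz0 hz ?_
  ext n
  have := congrFun h0 (-n)
  simpa [psiMinus] using this

theorem exists_psiMinus_eq_smul {M : ℝ} {a b : ℤ → ℝ} (h : RapidDecay M a b) {z : ℂ} (hz0 : z ≠ 0)
    (hz : ‖z‖ ≤ 1) (hW : jostW a b z = 0) :
    ∃ c : ℂ, c ≠ 0 ∧ ∀ n, psiMinus a b z n = c * psiPlus a b z n := by
  have h1 : wr a (psiMinus a b z) (psiPlus a b z) 0 = 0 := by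
    have e : wr a (psiMinus a b z) (psiPlus a b z) 0 = -wr a (psiPlus a b z) (psiMinus a b z) 0 := by
      unfold wr; ring
    rw [e, wr_psi_eq h hz0, hW, mul_zero, neg_zero]
  obtain ⟨c, hc⟩ := exists_eq_smul_of_wr_eq_zero h.pos (solvesAt_psiMinus h hz0 hz)
    (solvesAt_psiPlus h hz0 hz) (psiPlus_ne_zero h hz0 hz) h1
  refine ⟨c, ?_, hc⟩
  rintro rfl
  refine psiMinus_ne_zero h hz0 hz ?_
  ext n
  rw [hc n, zero_mul]; rfl

/-- At a zero of the Wronskian the Jost solutions decay exponentially in both directions. -/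
theorem exists_norm_psiPlus_le_of_jostW_eq_zero {M : ℝ} {a b : ℤ → ℝ} (h : RapidDecay M a b)
    {z : ℂ} (hz0 : z ≠ 0) (hz : ‖z‖ ≤ 1) (hW : jostW a b z = 0) :
    ∃ K, 0 ≤ K ∧ ∀ n : ℤ, ‖psiPlus a b z n‖ ≤ K * ‖z‖ ^ |n| := by
  obtain ⟨c, hc0, hc⟩ := exists_psiMinus_eq_smul h hz0 hz hW
  obtain ⟨K, hK0, hK⟩ := exists_norm_psiPlus_le h
  obtain ⟨K', hK0', hK'⟩ := exists_norm_psiMinus_le h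
  refine ⟨K + K' / ‖c‖, by positivity, fun n => ?_⟩
  have hp : 0 ≤ ‖z‖ ^ |n| := by positivity
  rcases le_total 0 n with hn | hn
  · rw [abs_of_nonneg hn] at hp ⊢
    refine (hK n z hn hz).trans ?_
    have : 0 ≤ K' / ‖c‖ := by positivity
    nlinarith
  · rw [abs_of_nonpos hn] at hp ⊢
    have h1 := hK' n z hn hz
    rw [hc, norm_mul] at h1
    have hc' : 0 < ‖c‖ := norm_pos_iff.mpr hc0
    have h2 : ‖psiPlus a b z n‖ ≤ K' / ‖c‖ * ‖z‖ ^ (-n) := by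
      rw [div_mul_eq_mul_div, le_div_iff₀ hc']
      linarith
    nlinarith

theorem summable_zpow_abs {r : ℝ} (h0 : 0 ≤ r) (h1 : r < 1) : Summable fun n : ℤ => r ^ |n| := by
  have h := summable_geometric_of_lt_one h0 h1
  apply Summable.of_nat_of_neg <;> simpa using h

theorem tendsto_zpow_abs_zero {r : ℝ} (h0 : 0 ≤ r) (h1 : r < 1) :
    Tendsto (fun n : ℤ => r ^ |n|) atBot (𝓝 0) ∧ Tendsto (fun n : ℤ => r ^ |n|) atTop (𝓝 0) := by
  have h := (summable_zpow_abs h0 h1).tendsto_cofinite_zero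
  exact ⟨h.mono_left atBot_le_cofinite, h.mono_left atTop_le_cofinite⟩

/-- Self-adjointness: the Wronskian has no nonreal zeros in the disc, since `W(u, ū)` would be
monotone in `n` up to a constant factor and vanish at both ends. -/
theorem jostW_ne_zero_of_im_ne_zero {M : ℝ} {a b : ℤ → ℝ} (h : RapidDecay M a b) {z : ℂ}
    (hz : ‖z‖ < 1) (him : z.im ≠ 0) : jostW a b z ≠ 0 := by
  intro hW
  have hz0 : z ≠ 0 := by rintro rfl; simp at him
  obtain ⟨K, hK0, hK⟩ := exists_norm_psiPlus_le_of_jostW_eq_zero h hz0 hz.le hW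
  set u := psiPlus a b z with hu
  set lam : ℂ := (z + z⁻¹) / 2 with hlam
  have hs : ∀ n, jacobi a b u n = lam * u n := solvesAt_psiPlus h hz0 hz.le
  have hsc : ∀ n, jacobi a b (fun n => conj (u n)) n = conj lam * conj (u n) := fun n => by
    rw [← map_mul, ← hs n]; simp [jacobi]
  have hlam0 : conj lam - lam ≠ 0 := by
    have e : conj lam - lam = ((-2 * lam.im : ℝ) : ℂ) * Complex.I := by
      apply Complex.ext <;> simp
      ring
    have e2 : lam.im = z.im * (1 - (Complex.normSq z)⁻¹) / 2 := by
      simp only [hlam, Complex.div_ofNat_im, Complex.add_im, Complex.inv_im]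
      ring
    have h1 : Complex.normSq z < 1 := by
      rw [Complex.normSq_eq_norm_sq]
      nlinarith [norm_nonneg z]
    have h2 : 0 < Complex.normSq z := Complex.normSq_pos.mpr hz0
    have h3 : 1 < (Complex.normSq z)⁻¹ := (one_lt_inv₀ h2).mpr h1
    rw [e]
    refine mul_ne_zero ?_ Complex.I_ne_zero
    rw [Complex.ofReal_ne_zero, e2]
    have : 1 - (Complex.normSq z)⁻¹ ≠ 0 := by linarith
    positivity
  set V : ℤ → ℝ := fun n => (wr a u (fun n => conj (u n)) n / (conj lam - lam)).re with hV
  have hVs : ∀ n, V n - V (n - 1) = ‖u n‖ ^ 2 := by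
    intro n
    simp only [hV]
    rw [← Complex.sub_re, ← sub_div, wr_sub_wr a b, hs, hsc]
    have e : u n * (conj lam * conj (u n)) - lam * u n * conj (u n) =
        (conj lam - lam) * ((Complex.normSq (u n) : ℝ) : ℂ) := by
      rw [← Complex.mul_conj]; ring
    rw [e, mul_div_cancel_left₀ _ hlam0, Complex.ofReal_re, Complex.normSq_eq_norm_sq]
  have hmono : Monotone V := monotone_int_of_le_succ fun n => by
    have := hVs (n + 1)
    rw [add_sub_cancel_right] at this
    linarith [sq_nonneg ‖u (n + 1)‖]
  have hu0 : Tendsto u atBot (𝓝 0) ∧ Tendsto u atTop (𝓝 0) := by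
    have ht := tendsto_zpow_abs_zero (norm_nonneg z) hz
    have h1 := ht.1.const_mul K
    have h2 := ht.2.const_mul K
    rw [mul_zero] at h1 h2
    exact ⟨squeeze_zero_norm hK h1, squeeze_zero_norm hK h2⟩
  have hub : ∀ n, ‖conj (u n)‖ ≤ K := fun n => by
    rw [RCLike.norm_conj]
    refine (hK n).trans (mul_le_of_le_one_right hK0 ?_)
    obtain ⟨k, hk⟩ := Int.eq_ofNat_of_zero_le (abs_nonneg n)
    rw [hk, zpow_natCast]
    exact pow_le_one₀ (norm_nonneg z) hz.le
  have hVt : Tendsto V atTop (𝓝 0) := by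
    have h1 := (tendsto_wr_atTop_zero h hu0.2 fun n _ => hub n).div_const (conj lam - lam)
    rw [zero_div] at h1
    exact (Complex.continuous_re.tendsto _).comp h1
  have hVb : Tendsto V atBot (𝓝 0) := by
    have h1 := (tendsto_wr_atBot_zero h hu0.1 fun n _ => hub n).div_const (conj lam - lam)
    rw [zero_div] at h1
    exact (Complex.continuous_re.tendsto _).comp h1
  have hV0 : ∀ n, V n = 0 := fun n => le_antisymm (hmono.ge_of_tendsto hVt n) (hmono.le_of_tendsto hVb n)
  refine psiPlus_ne_zero h hz0 hz.le ?_
  ext n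
  have := hVs n
  rw [hV0, hV0, sub_zero] at this
  simpa using this.symm

theorem summable_norm_psiPlus_sq {M : ℝ} {a b : ℤ → ℝ} (h : RapidDecay M a b)
    {z : ℂ} (hz0 : z ≠ 0) (hz : ‖z‖ < 1) (hW : jostW a b z = 0) :
    Summable fun n : ℤ => ‖psiPlus a b z n‖ ^ 2 := by
  obtain ⟨K, hK0, hK⟩ := exists_norm_psiPlus_le_of_jostW_eq_zero h hz0 hz.le hW
  refine Summable.of_nonneg_of_le (fun n => by positivity) (fun n => ?_)
    ((summable_zpow_abs (norm_nonneg z) hz).mul_left (K ^ 2))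
  have h1 : ‖z‖ ^ |n| ≤ 1 := by
    obtain ⟨k, hk⟩ := Int.eq_ofNat_of_zero_le (abs_nonneg n)
    rw [hk, zpow_natCast]
    exact pow_le_one₀ (norm_nonneg z) hz.le
  have h2 : 0 ≤ ‖z‖ ^ |n| := by positivity
  calc ‖psiPlus a b z n‖ ^ 2 ≤ (K * ‖z‖ ^ |n|) ^ 2 := by
        gcongr
        exact hK n
    _ = K ^ 2 * (‖z‖ ^ |n| * ‖z‖ ^ |n|) := by ring
    _ ≤ K ^ 2 * (‖z‖ ^ |n| * 1) := by gcongr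
    _ = _ := by ring

/-- The eigenvalues of the Jacobi operator are the zeros of the Wronskian in the unit disc. -/
theorem mem_eigenPoints_iff {M : ℝ} {a b : ℤ → ℝ} (h : RapidDecay M a b) (ζ : ℝ) :
    ζ ∈ eigenPoints a b ↔ ζ ≠ 0 ∧ |ζ| < 1 ∧ jostW a b ζ = 0 := by
  unfold eigenPoints IsEigenvalue
  simp only [Set.mem_ofPred_eq]
  refine and_congr_right fun h0 => and_congr_right fun h1 => ?_
  have hz0 : (ζ : ℂ) ≠ 0 := by exact_mod_cast h0
  have hz : ‖(ζ : ℂ)‖ < 1 := by rwa [Complex.norm_real, Real.norm_eq_abs]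
  have elam : (((ζ + ζ⁻¹) / 2 : ℝ) : ℂ) = ((ζ : ℂ) + (ζ : ℂ)⁻¹) / 2 := by push_cast; rfl
  have hp := solvesAt_psiPlus h hz0 hz.le
  have hm := solvesAt_psiMinus h hz0 hz.le
  rw [elam]
  constructor
  · rintro ⟨u, hu0, hu2, hu⟩
    have hlim : Tendsto u cofinite (𝓝 0) := by
      have h2 : (0 : ℝ) < ENNReal.toReal 2 := by norm_num
      have h3 := ((memℓp_gen_iff h2).mp hu2).tendsto_cofinite_zero
      rw [tendsto_zero_iff_norm_tendsto_zero]
      have h4 := h3.sqrt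
      rw [Real.sqrt_zero] at h4
      refine h4.congr fun n => ?_
      simp [Real.sqrt_sq (norm_nonneg (u n))]
    obtain ⟨K, hK0, hK⟩ := exists_norm_psiPlus_le h
    obtain ⟨K', hK0', hK'⟩ := exists_norm_psiMinus_le h
    have hpow : ∀ n : ℤ, 0 ≤ n → ‖(ζ : ℂ)‖ ^ n ≤ 1 := fun n hn => by
      lift n to ℕ using hn
      rw [zpow_natCast]
      exact pow_le_one₀ (norm_nonneg _) hz.le
    -- an eigenfunction has vanishing Wronskian with each Jost solution, so it is a multiple of both
    have w1 : wr a u (psiPlus a b ζ) 0 = 0 := by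
      have := tendsto_wr_atTop_zero h (hlim.mono_left atTop_le_cofinite)
        fun n hn => (hK n ζ hn hz.le).trans (mul_le_of_le_one_right hK0 (hpow n hn))
      exact tendsto_nhds_unique (tendsto_const_nhds.congr fun n => (wr_eq_of_solves hu hp n).symm) this
    have w2 : wr a u (psiMinus a b ζ) 0 = 0 := by
      have := tendsto_wr_atBot_zero h (hlim.mono_left atBot_le_cofinite)
        fun n hn => (hK' n ζ hn hz.le).trans (mul_le_of_le_one_right hK0' (hpow (-n) (by omega)))
      exact tendsto_nhds_unique (tendsto_const_nhds.congr fun n => (wr_eq_of_solves hu hm n).symm) this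
    obtain ⟨c, hc⟩ := exists_eq_smul_of_wr_eq_zero h.pos hu hp (psiPlus_ne_zero h hz0 hz.le) w1
    obtain ⟨c', hc'⟩ := exists_eq_smul_of_wr_eq_zero h.pos hu hm (psiMinus_ne_zero h hz0 hz.le) w2
    have hc0 : c ≠ 0 := by
      rintro rfl
      exact hu0 (funext fun n => by rw [hc n, zero_mul]; rfl)
    have w3 : c * wr a (psiPlus a b ζ) (psiMinus a b ζ) 0 = wr a u (psiMinus a b ζ) 0 := by
      unfold wr
      rw [hc 0, hc (0 + 1)]; ring
    rw [w2, mul_eq_zero, or_iff_right hc0, wr_psi_eq h hz0, mul_eq_zero] at w3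
    refine w3.resolve_left (div_ne_zero ?_ (mul_ne_zero two_ne_zero hz0))
    exact_mod_cast (totalAmp_pos a).ne'
  · intro hW
    refine ⟨psiPlus a b ζ, psiPlus_ne_zero h hz0 hz.le, ?_, hp⟩
    have h2 : (0 : ℝ) < ENNReal.toReal 2 := by norm_num
    rw [memℓp_gen_iff h2]
    simpa using summable_norm_psiPlus_sq h hz0 hz hW

/-! ### The derivative of the Wronskian at an eigenvalue -/

theorem tsum_int_eq_sub_of_tendsto {f g : ℤ → ℂ} (hg : Summable g)
    (hfg : ∀ n, f n - f (n - 1) = g n) {A B : ℂ} (hA : Tendsto f atTop (𝓝 A))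
    (hB : Tendsto f atBot (𝓝 B)) : ∑' n, g n = A - B := by
  have h1 : Summable fun n : ℕ => g n := hg.comp_injective Nat.cast_injective
  have h2 : Summable fun n : ℕ => g (-(n + 1 : ℤ)) :=
    hg.comp_injective (i := fun n : ℕ => -((n : ℤ) + 1)) fun i j hij => by simp only at hij; omega
  rw [tsum_of_nat_of_neg_add_one h1 h2]
  have e1 : ∀ K : ℕ, ∑ k ∈ Finset.range K, g k = f (K - 1) - f (-1) := by
    intro K
    induction K with
    | zero => simp
    | succ K ih =>
      rw [Finset.sum_range_succ, ih, ← hfg]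
      push_cast
      rw [add_sub_cancel_right]; ring
  have e2 : ∀ K : ℕ, ∑ k ∈ Finset.range K, g (-(k + 1 : ℤ)) = f (-1) - f (-K - 1) := by
    intro K
    induction K with
    | zero => simp
    | succ K ih =>
      rw [Finset.sum_range_succ, ih, ← hfg]
      push_cast
      have e : -((K : ℤ) + 1) = -K - 1 := by ring
      rw [e]; ring
  have l1 : Tendsto (fun K : ℕ => f (K - 1) - f (-1)) atTop (𝓝 (A - f (-1))) := by
    refine (hA.comp ?_).sub_const _
    simp_rw [sub_eq_add_neg]
    exact tendsto_atTop_add_const_right _ _ tendsto_natCast_atTop_atTop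
  have l2 : Tendsto (fun K : ℕ => f (-1) - f (-K - 1)) atTop (𝓝 (f (-1) - B)) := by
    refine (hB.comp ?_).const_sub _
    simp_rw [sub_eq_add_neg]
    exact tendsto_atBot_add_const_right _ _
      (tendsto_neg_atTop_atBot.comp tendsto_natCast_atTop_atTop)
  have s1 := h1.hasSum.tendsto_sum_nat
  have s2 := h2.hasSum.tendsto_sum_nat
  simp_rw [e1] at s1
  simp_rw [e2] at s2
  rw [tendsto_nhds_unique s1 l1, tendsto_nhds_unique s2 l2]
  ring

theorem differentiableAt_psiPlus {M : ℝ} {a b : ℤ → ℝ} (h : RapidDecay M a b) {z : ℂ}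
    (hz0 : z ≠ 0) (hz : ‖z‖ < 1) (n : ℤ) : DifferentiableAt ℂ (fun z => psiPlus a b z n) z := by
  unfold psiPlus
  exact ((differentiableAt_zpow.mpr (Or.inl hz0)).const_mul _).mul (differentiableAt_jostG h n hz)

/-- The `z`-derivative of the right Jost solution. -/
def psiPlusDeriv (a b : ℤ → ℝ) (z : ℂ) (n : ℤ) : ℂ := deriv (fun z => psiPlus a b z n) z

/-- The `z`-derivative of the left Jost solution. -/
def psiMinusDeriv (a b : ℤ → ℝ) (z : ℂ) (n : ℤ) : ℂ := deriv (fun z => psiMinus a b z n) z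

theorem jacobi_deriv {a b : ℤ → ℝ} {u : ℂ → ℤ → ℂ} {z : ℂ} (hz0 : z ≠ 0)
    (hu : ∀ᶠ w in 𝓝 z, SolvesAt a b w (u w))
    (hd : ∀ n, DifferentiableAt ℂ (fun w => u w n) z) (n : ℤ) :
    jacobi a b (fun n => deriv (fun w => u w n) z) n =
      (z + z⁻¹) / 2 * deriv (fun w => u w n) z + (1 - (z ^ 2)⁻¹) / 2 * u z n := by
  have h1 := (((hd (n + 1)).hasDerivAt.const_mul (a n : ℂ)).add
    ((hd (n - 1)).hasDerivAt.const_mul (a (n - 1) : ℂ))).add ((hd n).hasDerivAt.const_mul (b n : ℂ))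
  have h2 := (((hasDerivAt_id z).add (hasDerivAt_inv hz0)).div_const 2).mul (hd n).hasDerivAt
  have h3 := h1.unique (h2.congr_of_eventuallyEq (hu.mono fun w hw => hw n))
  simp only [jacobi]
  rw [h3]
  simp only [Pi.add_apply, id]
  ring

/-- Cauchy's estimate, applied to the exponential bound of the Jost solutions on a small disc. -/
theorem exists_norm_psiPlusDeriv_le {M : ℝ} {a b : ℤ → ℝ} (h : RapidDecay M a b) {z : ℂ}
    (hz0 : z ≠ 0) (hz : ‖z‖ < 1) :
    ∃ K ρ : ℝ, 0 ≤ ρ ∧ ρ < 1 ∧ ∀ n : ℤ, 0 ≤ n → ‖psiPlusDeriv a b z n‖ ≤ K * ρ ^ n := by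
  obtain ⟨K, hK0, hK⟩ := exists_norm_psiPlus_le h
  have hzp : 0 < ‖z‖ := norm_pos_iff.mpr hz0
  set δ := min ‖z‖ (1 - ‖z‖) / 2 with hδ
  have hδ0 : 0 < δ := by
    have : 0 < min ‖z‖ (1 - ‖z‖) := lt_min hzp (by linarith)
    positivity
  have hδ1 : δ < ‖z‖ := by
    have := min_le_left ‖z‖ (1 - ‖z‖)
    rw [hδ]; linarith
  have hδ2 : ‖z‖ + δ < 1 := by
    have := min_le_right ‖z‖ (1 - ‖z‖)
    rw [hδ]; linarith
  refine ⟨K / δ, ‖z‖ + δ, by positivity, hδ2, fun n hn => ?_⟩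
  have hball : ∀ w ∈ Metric.closedBall z δ, w ≠ 0 ∧ ‖w‖ ≤ ‖z‖ + δ := by
    intro w hw
    rw [mem_closedBall_iff_norm] at hw
    constructor
    · rintro rfl
      rw [zero_sub, norm_neg] at hw
      linarith
    · have e : w = z + (w - z) := by ring
      rw [e]
      exact (norm_add_le _ _).trans (by linarith)
  have hd : DiffContOnCl ℂ (fun w => psiPlus a b w n) (Metric.ball z δ) := by
    apply DifferentiableOn.diffContOnCl
    intro w hw
    have := hball w (Metric.closure_ball_subset_closedBall hw)
    exact (differentiableAt_psiPlus h this.1 (by linarith) n).differentiableWithinAt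
  refine (Complex.norm_deriv_le_of_forall_mem_sphere_norm_le hδ0 hd fun w hw => ?_).trans
    (le_of_eq (div_mul_eq_mul_div K δ ((‖z‖ + δ) ^ n)).symm)
  have h1 := hball w (Metric.sphere_subset_closedBall hw)
  refine (hK n w hn (by linarith)).trans ?_
  lift n to ℕ using hn
  rw [zpow_natCast, zpow_natCast]
  gcongr
  exact h1.2

theorem tendsto_psiPlusDeriv_zero {M : ℝ} {a b : ℤ → ℝ} (h : RapidDecay M a b) {z : ℂ}
    (hz0 : z ≠ 0) (hz : ‖z‖ < 1) : Tendsto (psiPlusDeriv a b z) atTop (𝓝 0) := by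
  obtain ⟨K, ρ, hρ0, hρ1, hK⟩ := exists_norm_psiPlusDeriv_le h hz0 hz
  have h1 := (tendsto_zpow_atTop_zero hρ0 hρ1).const_mul K
  rw [mul_zero] at h1
  refine squeeze_zero_norm' ?_ h1
  filter_upwards [eventually_ge_atTop 0] with n hn
  exact hK n hn

theorem tendsto_psiMinusDeriv_zero {M : ℝ} {a b : ℤ → ℝ} (h : RapidDecay M a b) {z : ℂ}
    (hz0 : z ≠ 0) (hz : ‖z‖ < 1) : Tendsto (psiMinusDeriv a b z) atBot (𝓝 0) :=
  ((tendsto_psiPlusDeriv_zero h.reflect hz0 hz).comp tendsto_neg_atBot_atTop).congr fun _ => rfl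

theorem eventually_ne_zero_norm_lt {z : ℂ} (hz0 : z ≠ 0) (hz : ‖z‖ < 1) :
    ∀ᶠ w in 𝓝 z, w ≠ 0 ∧ ‖w‖ < 1 :=
  (eventually_ne_nhds hz0).and (continuous_norm.continuousAt.eventually_lt_const hz)

/-- The derivative of the Wronskian at one of its zeros is a multiple of `∑ ψ₊ ψ₋`. -/
theorem hasDerivAt_wr_psi {M : ℝ} {a b : ℤ → ℝ} (h : RapidDecay M a b) {z : ℂ}
    (hz0 : z ≠ 0) (hz : ‖z‖ < 1) (hW : jostW a b z = 0) :
    HasDerivAt (fun z => wr a (psiPlus a b z) (psiMinus a b z) 0)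
      ((1 - (z ^ 2)⁻¹) / 2 * ∑' n, psiPlus a b z n * psiMinus a b z n) z := by
  obtain ⟨c, hc0, hc⟩ := exists_psiMinus_eq_smul h hz0 hz.le hW
  obtain ⟨K, hK0, hK⟩ := exists_norm_psiPlus_le_of_jostW_eq_zero h hz0 hz.le hW
  have hKb : ∀ n, ‖psiPlus a b z n‖ ≤ K := fun n => by
    refine (hK n).trans (mul_le_of_le_one_right hK0 ?_)
    obtain ⟨k, hk⟩ := Int.eq_ofNat_of_zero_le (abs_nonneg n)
    rw [hk, zpow_natCast]
    exact pow_le_one₀ (norm_nonneg z) hz.le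
  set lam : ℂ := (z + z⁻¹) / 2 with hlam
  set lam' : ℂ := (1 - (z ^ 2)⁻¹) / 2 with hlam'
  have hev := eventually_ne_zero_norm_lt hz0 hz
  have du := fun n => differentiableAt_psiPlus h hz0 hz n
  have dv : ∀ n, DifferentiableAt ℂ (fun z => psiMinus a b z n) z :=
    fun n => differentiableAt_psiPlus h.reflect hz0 hz (-n)
  have su : ∀ n, jacobi a b (psiPlus a b z) n = lam * psiPlus a b z n := solvesAt_psiPlus h hz0 hz.le
  have sv : ∀ n, jacobi a b (psiMinus a b z) n = lam * psiMinus a b z n :=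
    solvesAt_psiMinus h hz0 hz.le
  have su' : ∀ n, jacobi a b (psiPlusDeriv a b z) n =
      lam * psiPlusDeriv a b z n + lam' * psiPlus a b z n :=
    jacobi_deriv (u := psiPlus a b) hz0 (hev.mono fun w hw => solvesAt_psiPlus h hw.1 hw.2.le) du
  have sv' : ∀ n, jacobi a b (psiMinusDeriv a b z) n =
      lam * psiMinusDeriv a b z n + lam' * psiMinus a b z n :=
    jacobi_deriv (u := psiMinus a b) hz0 (hev.mono fun w hw => solvesAt_psiMinus h hw.1 hw.2.le) dv
  -- the two halves of the derivative of the Wronskian: `X` vanishes at `-∞` and `Y` at `+∞`, while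
  -- `X + Y` is constant in `n`
  set X := wr a (psiPlus a b z) (psiMinusDeriv a b z) with hX
  set Y := wr a (psiPlusDeriv a b z) (psiMinus a b z) with hY
  have hXs : ∀ n, X n - X (n - 1) = lam' * (psiPlus a b z n * psiMinus a b z n) := fun n => by
    rw [hX, wr_sub_wr a b, su, sv']; ring
  have hYs : ∀ n, Y n - Y (n - 1) = -(lam' * (psiPlus a b z n * psiMinus a b z n)) := fun n => by
    rw [hY, wr_sub_wr a b, su', sv]; ring
  have hXY : ∀ n, X n + Y n = X 0 + Y 0 := by
    have hs : ∀ n, X n + Y n = X (n - 1) + Y (n - 1) := fun n => by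
      linear_combination hXs n + hYs n
    intro n
    induction n using Int.induction_on with
    | zero => rfl
    | succ i ih => rw [hs, add_sub_cancel_right, ih]
    | pred i ih => rw [← hs, ih]
  have hYt : Tendsto Y atTop (𝓝 0) := by
    refine tendsto_wr_atTop_zero h (tendsto_psiPlusDeriv_zero h hz0 hz) (K := ‖c‖ * K) fun n _ => ?_
    rw [hc, norm_mul]
    exact mul_le_mul_of_nonneg_left (hKb n) (norm_nonneg c)
  have hXt : Tendsto X atTop (𝓝 (X 0 + Y 0)) := by
    have := hYt.const_sub (X 0 + Y 0)
    rw [sub_zero] at this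
    exact this.congr fun n => by rw [← hXY n]; ring
  have hXb : Tendsto X atBot (𝓝 0) := by
    have h1 : Tendsto (wr a (psiMinusDeriv a b z) (psiPlus a b z)) atBot (𝓝 0) :=
      tendsto_wr_atBot_zero h (tendsto_psiMinusDeriv_zero h hz0 hz) fun n _ => hKb n
    have h2 := h1.neg
    rw [neg_zero] at h2
    refine h2.congr fun n => ?_
    rw [hX]; unfold wr; ring
  have hsum : Summable fun n => psiPlus a b z n * psiMinus a b z n := by
    refine Summable.of_norm ?_
    refine ((summable_norm_psiPlus_sq h hz0 hz hW).mul_left ‖c‖).congr fun n => ?_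
    rw [hc, norm_mul, norm_mul]; ring
  have htot := tsum_int_eq_sub_of_tendsto (hsum.mul_left lam') hXs hXt hXb
  rw [tsum_mul_left, sub_zero] at htot
  rw [htot]
  have h1 := (((du 0).hasDerivAt.mul (dv (0 + 1)).hasDerivAt).sub
    ((du (0 + 1)).hasDerivAt.mul (dv 0).hasDerivAt)).const_mul (a 0 : ℂ)
  refine h1.congr_deriv ?_
  simp only [hX, hY, wr, psiPlusDeriv, psiMinusDeriv]
  ring

theorem tsum_norm_psiPlus_sq_pos {M : ℝ} {a b : ℤ → ℝ} (h : RapidDecay M a b)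
    {z : ℂ} (hz0 : z ≠ 0) (hz : ‖z‖ < 1) (hW : jostW a b z = 0) :
    0 < ∑' n : ℤ, ‖psiPlus a b z n‖ ^ 2 := by
  obtain ⟨n, hn⟩ := Function.ne_iff.mp (psiPlus_ne_zero h hz0 hz.le)
  refine (summable_norm_psiPlus_sq h hz0 hz hW).tsum_pos (fun n => by positivity) n ?_
  have : 0 < ‖psiPlus a b z n‖ := norm_pos_iff.mpr hn
  positivity

/-- The zeros of the Wronskian at real points are simple, with derivative given by the norming
constant and the proportionality factor of the Jost solutions. -/
theorem hasDerivAt_jostW {M : ℝ} {a b : ℤ → ℝ} (h : RapidDecay M a b) {ζ : ℝ}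
    (hζ0 : ζ ≠ 0) (hζ : |ζ| < 1) (hW : jostW a b ζ = 0) {c : ℂ}
    (hc : ∀ n, psiMinus a b ζ n = c * psiPlus a b ζ n) :
    HasDerivAt (jostW a b) (-((1 - (ζ : ℂ) ^ 2) * c *
      ((∑' n : ℤ, ‖psiPlus a b ζ n‖ ^ 2 : ℝ) : ℂ) / (totalAmp a * ζ))) ζ := by
  have hz0 : (ζ : ℂ) ≠ 0 := by exact_mod_cast hζ0
  have hz : ‖(ζ : ℂ)‖ < 1 := by rwa [Complex.norm_real, Real.norm_eq_abs]
  have hA : (totalAmp a : ℂ) ≠ 0 := by exact_mod_cast (totalAmp_pos a).ne'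
  have h1 := hasDerivAt_wr_psi h hz0 hz hW
  have e1 : ∑' n, psiPlus a b ζ n * psiMinus a b ζ n =
      c * ((∑' n : ℤ, ‖psiPlus a b ζ n‖ ^ 2 : ℝ) : ℂ) := by
    rw [Complex.ofReal_tsum, ← tsum_mul_left]
    refine tsum_congr fun n => ?_
    have hr : conj (psiPlus a b ζ n) = psiPlus a b ζ n := by
      rw [← psiPlus_conj, Complex.conj_ofReal]
    have h2 : psiPlus a b ζ n * psiPlus a b ζ n = ((‖psiPlus a b ζ n‖ ^ 2 : ℝ) : ℂ) := by
      conv_lhs => rw [← hr]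
      rw [mul_comm, hr]
      nth_rw 2 [← hr]
      rw [Complex.mul_conj, Complex.normSq_eq_norm_sq]
    rw [hc, ← h2]; ring
  rw [e1] at h1
  have h2 := ((hasDerivAt_id (ζ : ℂ)).const_mul (2 / (totalAmp a : ℂ))).mul h1
  have h3 : jostW a b =ᶠ[𝓝 (ζ : ℂ)] fun z => 2 / (totalAmp a : ℂ) * z *
      wr a (psiPlus a b z) (psiMinus a b z) 0 := by
    filter_upwards [eventually_ne_nhds hz0] with z hz'
    rw [wr_psi_eq h hz']
    field_simp
  refine (h2.congr_of_eventuallyEq h3).congr_deriv ?_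
  rw [wr_psi_eq h hz0, hW, mul_zero, mul_zero, zero_add]
  simp only [id]
  field_simp
  ring

/-! ### The Riemann–Hilbert vector inside the unit disc -/

/-- The function `m(z, n)` inside the unit disc, freed of the powers of `z`. -/
def innerM (a b : ℤ → ℝ) (n : ℤ) (z : ℂ) : Fin 2 → ℂ :=
  ![(1 - z ^ 2) / jostW a b z * (jostGMinus a b n z / jostAmp a n), jostAmp a n * jostG a b n z]

/-- Exchange of the two components of a vector. -/
def swapVec (v : Fin 2 → ℂ) : Fin 2 → ℂ := ![v 1, v 0]

theorem continuous_swapVec : Continuous swapVec := by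
  unfold swapVec
  refine continuous_pi fun i => ?_
  fin_cases i <;> simp <;> fun_prop

theorem transmission_mul_psiMinus {M : ℝ} {a b : ℤ → ℝ} (h : RapidDecay M a b) {z : ℂ}
    (hz0 : z ≠ 0) (hz : ‖z‖ ≤ 1) (n : ℤ) :
    transmission a b z * psiMinus a b z n * z ^ n = innerM a b n z 0 := by
  have h1 := jostAmp_mul_jostAmpMinus h n
  have hA : (jostAmp a n : ℂ) ≠ 0 := by exact_mod_cast (jostAmp_pos a n).ne'
  have hA' : (jostAmpMinus a n : ℂ) ≠ 0 := by exact_mod_cast (jostAmpMinus_pos a n).ne'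
  have hzn := zpow_ne_zero n hz0
  rw [transmission_eq h hz0 hz, psiMinus_eq, ← h1]
  simp only [innerM, Matrix.cons_val_zero, zpow_neg]
  by_cases hW : jostW a b z = 0
  · simp [hW]
  · push_cast
    field_simp

theorem mFormula_of_norm_lt {M : ℝ} {a b : ℤ → ℝ} (h : RapidDecay M a b) {z : ℂ}
    (hz0 : z ≠ 0) (hz : ‖z‖ < 1) (n : ℤ) : mFormula a b n z = innerM a b n z := by
  rw [mFormula, if_pos hz, jostPlus_eq h hz0 hz.le, jostMinus_eq h hz0 hz.le,
    transmission_mul_psiMinus h hz0 hz.le, mul_comm (psiPlus a b z n), zpow_neg_mul_psiPlus a b hz0]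
  ext i
  fin_cases i <;> simp [innerM]

theorem mFormula_of_one_lt {M : ℝ} {a b : ℤ → ℝ} (h : RapidDecay M a b) {z : ℂ}
    (hz : 1 < ‖z‖) (n : ℤ) : mFormula a b n z = swapVec (innerM a b n z⁻¹) := by
  have hz0 : z ≠ 0 := by rintro rfl; simp at hz; linarith
  have hi0 := inv_ne_zero hz0
  have hi : ‖z⁻¹‖ < 1 := by rw [norm_inv]; exact inv_lt_one_of_one_lt₀ hz
  have e1 : z ^ n = z⁻¹ ^ (-n) := by simp
  have e2 : z ^ (-n) = z⁻¹ ^ n := by simp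
  rw [mFormula, if_neg (by linarith), jostPlus_eq h hi0 hi.le, jostMinus_eq h hi0 hi.le, e1, e2,
    transmission_mul_psiMinus h hi0 hi.le, mul_comm (psiPlus a b z⁻¹ n),
    zpow_neg_mul_psiPlus a b hi0]
  ext i
  fin_cases i <;> simp [innerM, swapVec]

theorem differentiableAt_innerM {M : ℝ} {a b : ℤ → ℝ} (h : RapidDecay M a b) (n : ℤ) {z : ℂ}
    (hz : ‖z‖ < 1) (hW : jostW a b z ≠ 0) : DifferentiableAt ℂ (innerM a b n) z := by
  rw [differentiableAt_pi]
  have hg := differentiableAt_jostG h n hz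
  have hg' : DifferentiableAt ℂ (jostGMinus a b n) z := differentiableAt_jostG h.reflect (-n) hz
  have hw := differentiableAt_jostW h hz
  intro i
  fin_cases i
  · simp only [innerM]
    exact (((differentiableAt_id.pow 2).const_sub 1).div hw hW).mul (hg'.div_const _)
  · simp only [innerM]
    exact hg.const_mul _

theorem mJost_of_norm_lt {M : ℝ} {a b : ℤ → ℝ} (h : RapidDecay M a b) {z : ℂ}
    (hz : ‖z‖ < 1) (n : ℤ) : mJost a b n z = innerM a b n z := by
  unfold mJost
  by_cases hz0 : z = 0
  · subst hz0
    rw [Function.update_self]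
    apply Tendsto.limUnder_eq
    have h1 : Tendsto (innerM a b n) (𝓝[≠] 0) (𝓝 (innerM a b n 0)) :=
      (differentiableAt_innerM h n hz (by rw [jostW_zero]; exact one_ne_zero)).continuousAt.mono_left
        nhdsWithin_le_nhds
    refine h1.congr' ?_
    have h2 : ∀ᶠ z : ℂ in 𝓝[≠] 0, ‖z‖ < 1 :=
      (continuous_norm.continuousAt.eventually_lt_const hz).filter_mono nhdsWithin_le_nhds
    filter_upwards [h2, self_mem_nhdsWithin] with z hz hz0
    exact (mFormula_of_norm_lt h hz0 hz n).symm
  · rw [Function.update_of_ne hz0, mFormula_of_norm_lt h hz0 hz]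

theorem mJost_of_one_lt {M : ℝ} {a b : ℤ → ℝ} (h : RapidDecay M a b) {z : ℂ}
    (hz : 1 < ‖z‖) (n : ℤ) : mJost a b n z = swapVec (innerM a b n z⁻¹) := by
  have hz0 : z ≠ 0 := by rintro rfl; simp at hz; linarith
  unfold mJost
  rw [Function.update_of_ne hz0, mFormula_of_one_lt h hz]

/-! ### Boundary values and the scattering relation -/

theorem isOpen_norm_lt_one : IsOpen {w : ℂ | ‖w‖ < 1} := isOpen_lt continuous_norm continuous_const

theorem exists_tendsto_innerM {M : ℝ} {a b : ℤ → ℝ} (h : RapidDecay M a b) (n : ℤ) {w : ℂ}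
    (hw : ‖w‖ = 1) : ∃ L, Tendsto (innerM a b n) (𝓝[{z | ‖z‖ < 1}] w) (𝓝 L) ∧
      Tendsto (innerM a b n) (𝓝[openCircle] w) (𝓝 L) := by
  have hwm : w ∈ Metric.closedBall (0 : ℂ) 1 := by simp [hw]
  have hg := continuousOn_jostG h n w hwm
  have hg' : ContinuousWithinAt (jostGMinus a b n) (Metric.closedBall 0 1) w :=
    continuousOn_jostG h.reflect (-n) w hwm
  have key : ∀ {l : Filter ℂ} {L : ℂ}, l ≤ 𝓝[Metric.closedBall 0 1] w →
      Tendsto (fun z => (1 - z ^ 2) / jostW a b z) l (𝓝 L) →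
      Tendsto (innerM a b n) l (𝓝 ![L * (jostGMinus a b n w / jostAmp a n),
        jostAmp a n * jostG a b n w]) := by
    intro l L hl hL
    rw [tendsto_pi_nhds]
    intro i
    fin_cases i
    · exact hL.mul ((hg'.mono_left hl).div_const _)
    · exact (hg.mono_left hl).const_mul _
  have s1 : 𝓝[{z : ℂ | ‖z‖ < 1}] w ≤ 𝓝[Metric.closedBall 0 1] w :=
    nhdsWithin_mono w fun z hz => by simpa using (Set.mem_ofPred.mp hz).le
  have s2 : 𝓝[openCircle] w ≤ 𝓝[Metric.closedBall 0 1] w :=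
    nhdsWithin_mono w fun z hz => by simp [hz.1]
  by_cases hc : w ∈ openCircle
  · have hW := jostW_ne_zero_of_mem_openCircle h hc
    have hq : Tendsto (fun z => (1 - z ^ 2) / jostW a b z) (𝓝[Metric.closedBall 0 1] w)
        (𝓝 ((1 - w ^ 2) / jostW a b w)) := by
      have l2 : Continuous fun z : ℂ => 1 - z ^ 2 := by fun_prop
      exact ((l2.tendsto w).mono_left nhdsWithin_le_nhds).div (continuousOn_jostW h w hwm) hW
    exact ⟨_, key s1 (hq.mono_left s1), key s2 (hq.mono_left s2)⟩
  · obtain ⟨L, hL, -⟩ := exists_tendsto_one_sub_sq_div_jostW h hw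
    refine ⟨_, key s1 (hL.mono_left (nhdsWithin_mono w fun z hz => ⟨?_, ?_⟩)),
      key s2 (hL.mono_left (nhdsWithin_mono w fun z hz => ⟨?_, ?_⟩))⟩
    · simpa using (Set.mem_ofPred.mp hz).le
    · rintro rfl
      exact absurd (Set.mem_ofPred.mp hz) (by rw [hw]; exact lt_irrefl _)
    · simp [hz.1]
    · rintro rfl
      exact hc hz

/-- The right reflection coefficient as a quotient of Wronskians. -/
def jostR (a b : ℤ → ℝ) (z : ℂ) : ℂ :=
  -wr a (psiPlus a b z⁻¹) (psiMinus a b z) 0 / wr a (psiPlus a b z) (psiMinus a b z) 0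

theorem wr_psi_ne_zero {M : ℝ} {a b : ℤ → ℝ} (h : RapidDecay M a b) {z : ℂ}
    (hz : z ∈ openCircle) : wr a (psiPlus a b z) (psiMinus a b z) 0 ≠ 0 := by
  have hz0 := ne_zero_of_norm_eq_one hz.1
  rw [wr_psi_eq h hz0]
  refine mul_ne_zero (div_ne_zero ?_ (mul_ne_zero two_ne_zero hz0))
    (jostW_ne_zero_of_mem_openCircle h hz)
  exact_mod_cast (totalAmp_pos a).ne'

theorem norm_jostR_lt_one {M : ℝ} {a b : ℤ → ℝ} (h : RapidDecay M a b) {z : ℂ}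
    (hz : z ∈ openCircle) : ‖jostR a b z‖ < 1 := by
  have h1 := normSq_wr_eq h hz.1
  have h2 : 0 < z.im ^ 2 := by
    have := im_ne_zero_of_mem_openCircle hz
    positivity
  have h3 : 0 < ‖wr a (psiPlus a b z) (psiMinus a b z) 0‖ := norm_pos_iff.mpr (wr_psi_ne_zero h hz)
  rw [jostR, norm_div, norm_neg, div_lt_one h3]
  refine lt_of_pow_lt_pow_left₀ 2 h3.le ?_
  linarith

/-- The scattering relation; it is the linear dependence of three solutions in terms of their
Wronskians. -/
theorem scattering_psi {M : ℝ} {a b : ℤ → ℝ} (h : RapidDecay M a b) {z : ℂ}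
    (hz : z ∈ openCircle) (n : ℤ) : transmission a b z * psiMinus a b z n =
      psiPlus a b z⁻¹ n + jostR a b z * psiPlus a b z n := by
  have hz0 := ne_zero_of_norm_eq_one hz.1
  have hzi : ‖z⁻¹‖ = 1 := by rw [norm_inv, hz.1, inv_one]
  have hW := wr_psi_ne_zero h hz
  have s1 := solvesAt_psiPlus h hz0 hz.1.le
  have s2 := solvesAt_inv (solvesAt_psiPlus h (inv_ne_zero hz0) hzi.le)
  have s3 := solvesAt_psiMinus h hz0 hz.1.le
  have e1 := wr_psiPlus_psiPlus_inv h hz.1 n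
  have e2 := wr_eq_of_solves s2 s3 n
  have e3 := wr_eq_of_solves s1 s3 n
  have key : wr a (psiPlus a b z) (psiPlus a b z⁻¹) n * psiMinus a b z n +
      wr a (psiPlus a b z⁻¹) (psiMinus a b z) n * psiPlus a b z n -
      wr a (psiPlus a b z) (psiMinus a b z) n * psiPlus a b z⁻¹ n = 0 := by
    unfold wr; ring
  rw [e1, e2, e3] at key
  have eT : transmission a b z = (z⁻¹ - z) / (2 * wr a (psiPlus a b z) (psiMinus a b z) 0) := by
    rw [transmission, wronskian_eq h hz0 hz.1.le, wr_psi_eq h hz0]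
  rw [eT, jostR, div_mul_eq_mul_div, div_mul_eq_mul_div, add_div' _ _ _ hW,
    div_eq_div_iff (mul_ne_zero two_ne_zero hW) hW]
  linear_combination 2 * wr a (psiPlus a b z) (psiMinus a b z) 0 * key

theorem reflectionAux_eq {M : ℝ} {a b : ℤ → ℝ} (h : RapidDecay M a b) {z : ℂ}
    (hz : z ∈ openCircle) : reflectionAux a b z = jostR a b z := by
  have hz0 := ne_zero_of_norm_eq_one hz.1
  have hsc : ∀ n, transmission a b z * jostMinus a b z n =
      conj (jostPlus a b z n) + jostR a b z * jostPlus a b z n := fun n => by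
    rw [jostPlus_eq h hz0 hz.1.le, jostMinus_eq h hz0 hz.1.le, scattering_psi h hz,
      inv_eq_conj_of_norm hz.1, psiPlus_conj]
  have hex : ∃ r : ℂ, ∀ n, transmission a b z * jostMinus a b z n =
      conj (jostPlus a b z n) + r * jostPlus a b z n := ⟨_, hsc⟩
  rw [reflectionAux, dif_pos hex]
  have h1 := hex.choose_spec
  obtain ⟨n, hn⟩ := Function.ne_iff.mp (psiPlus_ne_zero h hz0 hz.1.le)
  have h2 := (h1 n).symm.trans (hsc n)
  have hn' : jostPlus a b z n ≠ 0 := by rw [jostPlus_eq h hz0 hz.1.le]; exact hn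
  exact mul_right_cancel₀ hn' (add_left_cancel h2)

/-- The scattering relation for the vector; `ψ₊(z⁻¹)` is the complex conjugate of `ψ₊(z)`. -/
theorem scattering_innerM {M : ℝ} {a b : ℤ → ℝ} (h : RapidDecay M a b) {z : ℂ}
    (hz : z ∈ openCircle) (n : ℤ) : innerM a b n z 0 =
      innerM a b n z⁻¹ 1 + jostR a b z * z ^ (2 * n) * innerM a b n z 1 := by
  have hz0 := ne_zero_of_norm_eq_one hz.1
  have hi0 := inv_ne_zero hz0
  have e1 : innerM a b n z 1 = z ^ (-n) * psiPlus a b z n := by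
    rw [zpow_neg_mul_psiPlus a b hz0]; simp [innerM]
  have e2 : innerM a b n z⁻¹ 1 = z ^ n * psiPlus a b z⁻¹ n := by
    have := zpow_neg_mul_psiPlus a b hi0 n
    rw [inv_zpow', neg_neg] at this
    rw [this]; simp [innerM]
  have e3 : z ^ (2 * n) * z ^ (-n) = z ^ n := by
    rw [← zpow_add₀ hz0]; congr 1; ring
  rw [← transmission_mul_psiMinus h hz0 hz.1.le, scattering_psi h hz, e1, e2]
  linear_combination (-(jostR a b z * psiPlus a b z n)) * e3

theorem inv_mem_openCircle {z : ℂ} (hz : z ∈ openCircle) : z⁻¹ ∈ openCircle := by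
  obtain ⟨h1, h2, h3⟩ := hz
  refine ⟨by rw [norm_inv, h1, inv_one], fun h => h2 ?_, fun h => h3 ?_⟩
  · rw [← inv_inv z, h, inv_one]
  · rw [← inv_inv z, h]; norm_num

theorem tendsto_inv_openCircle {w : ℂ} (hw : ‖w‖ = 1) :
    Tendsto (fun z : ℂ => z⁻¹) (𝓝[openCircle] w) (𝓝[openCircle] w⁻¹) :=
  tendsto_nhdsWithin_of_tendsto_nhds_of_eventually_within _
    ((continuousAt_inv₀ (ne_zero_of_norm_eq_one hw)).mono_left nhdsWithin_le_nhds)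
    (eventually_mem_nhdsWithin.mono fun _ hz => inv_mem_openCircle hz)

theorem tendsto_reflectionAux {M : ℝ} {a b : ℤ → ℝ} (h : RapidDecay M a b) {w : ℂ}
    (hw : ‖w‖ = 1) : Tendsto (reflectionAux a b) (𝓝[openCircle] w) (𝓝 (reflection a b w)) := by
  refine tendsto_extendFrom ?_
  obtain ⟨n, hn⟩ := ((tendsto_jostG_atTop h hw.le).eventually_ne one_ne_zero).exists
  obtain ⟨L, -, hL⟩ := exists_tendsto_innerM h n hw
  have hwi : ‖w⁻¹‖ = 1 := by rw [norm_inv, hw, inv_one]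
  obtain ⟨L', -, hL'⟩ := exists_tendsto_innerM h n hwi
  have t0 := tendsto_pi_nhds.mp hL 0
  have t1' := tendsto_pi_nhds.mp (hL'.comp (tendsto_inv_openCircle hw)) 1
  have hwm : w ∈ Metric.closedBall (0 : ℂ) 1 := by simp [hw]
  have t1 : Tendsto (fun z => innerM a b n z 1) (𝓝[openCircle] w) (𝓝 (innerM a b n w 1)) := by
    simp only [innerM, Matrix.cons_val_one, Matrix.cons_val_zero]
    exact ((continuousOn_jostG h n w hwm).mono_left
      (nhdsWithin_mono w fun z hz => by simp [hz.1])).const_mul _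
  have hne : innerM a b n w 1 ≠ 0 := by
    simp only [innerM, Matrix.cons_val_one, Matrix.cons_val_zero]
    refine mul_ne_zero ?_ hn
    exact_mod_cast (jostAmp_pos a n).ne'
  have hw0 := ne_zero_of_norm_eq_one hw
  have tz : Tendsto (fun z : ℂ => z ^ (2 * n)) (𝓝[openCircle] w) (𝓝 (w ^ (2 * n))) :=
    (continuousAt_zpow₀ w (2 * n) (Or.inl hw0)).mono_left nhdsWithin_le_nhds
  refine ⟨_, ((t0.sub t1').div (tz.mul t1) (mul_ne_zero (zpow_ne_zero _ hw0) hne)).congr' ?_⟩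
  filter_upwards [self_mem_nhdsWithin, t1.eventually_ne hne] with z hz hz1
  have hz0 := zpow_ne_zero (2 * n) (ne_zero_of_norm_eq_one hz.1)
  rw [Pi.div_apply, Function.comp_apply, scattering_innerM h hz, reflectionAux_eq h hz]
  field_simp
  ring

/-- Off the band edges `jostR` is continuous, so that the continuous extension does not change it. -/
theorem reflection_eq {M : ℝ} {a b : ℤ → ℝ} (h : RapidDecay M a b) {z : ℂ}
    (hz : z ∈ openCircle) : reflection a b z = jostR a b z := by
  have hne : (𝓝[openCircle] z).NeBot :=
    mem_closure_iff_nhdsWithin_neBot.mp (subset_closure hz)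
  have h1 := tendsto_reflectionAux h hz.1
  exact (tendsto_nhds_unique h1 (by
    have hz0 := ne_zero_of_norm_eq_one hz.1
    have hzi : ‖z⁻¹‖ = 1 := by rw [norm_inv, hz.1, inv_one]
    have hc : ContinuousWithinAt (jostR a b) openCircle z := by
      have hsub : openCircle ⊆ Metric.closedBall (0 : ℂ) 1 := fun w hw => by simp [hw.1]
      have hzm := hsub hz
      have hzp : ∀ k : ℤ, ContinuousWithinAt (fun w : ℂ => w ^ k) openCircle z := fun k =>
        (continuousAt_zpow₀ z k (Or.inl hz0)).continuousWithinAt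
      have hinv : Tendsto (fun z : ℂ => z⁻¹) (𝓝[openCircle] z) (𝓝[Metric.closedBall 0 1] z⁻¹) :=
        (tendsto_inv_openCircle hz.1).mono_right (nhdsWithin_mono _ hsub)
      have hp : ∀ k : ℤ, ContinuousWithinAt (fun w => psiPlus a b w k) openCircle z := fun k =>
        ((hzp k).const_mul _ |>.mul ((continuousOn_jostG h k z hzm).mono hsub))
      have hm : ∀ k : ℤ, ContinuousWithinAt (fun w => psiMinus a b w k) openCircle z := fun k =>
        ((hzp (-k)).const_mul _ |>.mul ((continuousOn_jostG h.reflect (-k) z hzm).mono hsub))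
      have hp' : ∀ k : ℤ, ContinuousWithinAt (fun w => psiPlus a b w⁻¹ k) openCircle z := fun k =>
        (((continuousAt_zpow₀ z⁻¹ k (Or.inl (inv_ne_zero hz0))).comp
          (continuousAt_inv₀ hz0)).continuousWithinAt.const_mul _).mul
          (ContinuousWithinAt.tendsto (continuousOn_jostG h k z⁻¹ (by simp [hzi])) |>.comp hinv)
      unfold jostR wr
      exact (((((hp' 0).mul (hm (0 + 1))).sub ((hp' (0 + 1)).mul (hm 0))).const_mul _).neg).div
        ((((hp 0).mul (hm (0 + 1))).sub ((hp (0 + 1)).mul (hm 0))).const_mul _)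
        (wr_psi_ne_zero h hz)
    exact hc.tendsto.congr' (eventually_mem_nhdsWithin.mono
      fun w hw => (reflectionAux_eq h hw).symm)))

/-! ### Time dependence of the scattering data -/

/-- Conservation of the Wronskian of the Jost solutions. -/
theorem jostW_time {a b : ℤ → ℝ → ℝ} (hab : IsTodaSolution a b) (hd : LocallyRapidDecay a b)
    {z : ℂ} (hz0 : z ≠ 0) (hz : ‖z‖ ≤ 1) (t : ℝ) :
    totalAmp (fun k => a k t) * jostW (fun k => a k t) (fun k => b k t) z =
      totalAmp (fun k => a k 0) * jostW (fun k => a k 0) (fun k => b k 0) z := by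
  have hR : ∀ r, ∃ M, RapidDecay M (fun k => a k r) (fun k => b k r) := fun r =>
    (hd |r|).imp fun M hM => hM r le_rfl
  have h1 := wr_eq_exp_mul hab (lam := (z + z⁻¹) / 2)
    (fun r => (solvesAt_psiPlus (hR r).choose_spec hz0 hz))
    (fun r => (solvesAt_psiMinus (hR r).choose_spec hz0 hz))
    (laxEvolves_psiPlus hab hd hz0 hz) (laxEvolves_psiMinus hab hd hz0 hz) t
  have e : (t : ℂ) * (2 * ((z + z⁻¹) / 2) - z - z⁻¹) = 0 := by ring
  rw [e, Complex.exp_zero, one_mul, wr_psi_eq (hR t).choose_spec hz0,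
    wr_psi_eq (hR 0).choose_spec hz0] at h1
  field_simp at h1
  exact h1

theorem jostW_time_eq_zero_iff {a b : ℤ → ℝ → ℝ} (hab : IsTodaSolution a b)
    (hd : LocallyRapidDecay a b) {z : ℂ} (hz0 : z ≠ 0) (hz : ‖z‖ ≤ 1) (t : ℝ) :
    jostW (fun k => a k t) (fun k => b k t) z = 0 ↔
      jostW (fun k => a k 0) (fun k => b k 0) z = 0 := by
  have h := jostW_time hab hd hz0 hz t
  have h1 : (totalAmp (fun k => a k t) : ℂ) ≠ 0 := by exact_mod_cast (totalAmp_pos _).ne'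
  have h2 : (totalAmp (fun k => a k 0) : ℂ) ≠ 0 := by exact_mod_cast (totalAmp_pos _).ne'
  constructor
  · intro h0
    rw [h0, mul_zero] at h
    exact (mul_eq_zero.mp h.symm).resolve_left h2
  · intro h0
    rw [h0, mul_zero] at h
    exact (mul_eq_zero.mp h).resolve_left h1

/-- The reflection coefficient evolves exponentially, since it is a quotient of two Wronskians of
which only the numerator depends on time. -/
theorem jostR_time {a b : ℤ → ℝ → ℝ} (hab : IsTodaSolution a b) (hd : LocallyRapidDecay a b)
    {z : ℂ} (hz : ‖z‖ = 1) (t : ℝ) :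
    jostR (fun k => a k t) (fun k => b k t) z =
      Complex.exp (t * (z - z⁻¹)) * jostR (fun k => a k 0) (fun k => b k 0) z := by
  have hz0 := ne_zero_of_norm_eq_one hz
  have hzi : ‖z⁻¹‖ ≤ 1 := by rw [norm_inv, hz, inv_one]
  have hR : ∀ r, ∃ M, RapidDecay M (fun k => a k r) (fun k => b k r) := fun r =>
    (hd |r|).imp fun M hM => hM r le_rfl
  have h1 := wr_eq_exp_mul hab (lam := (z + z⁻¹) / 2)
    (fun r => (solvesAt_psiPlus (hR r).choose_spec hz0 hz.le))
    (fun r => (solvesAt_psiMinus (hR r).choose_spec hz0 hz.le))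
    (laxEvolves_psiPlus hab hd hz0 hz.le) (laxEvolves_psiMinus hab hd hz0 hz.le) t
  have h2 := wr_eq_exp_mul hab (lam := (z + z⁻¹) / 2)
    (fun r => solvesAt_inv (solvesAt_psiPlus (hR r).choose_spec (inv_ne_zero hz0) hzi))
    (fun r => (solvesAt_psiMinus (hR r).choose_spec hz0 hz.le))
    (laxEvolves_psiPlus hab hd (inv_ne_zero hz0) hzi) (laxEvolves_psiMinus hab hd hz0 hz.le) t
  have e : (t : ℂ) * (2 * ((z + z⁻¹) / 2) - z - z⁻¹) = 0 := by ring
  have e' : (t : ℂ) * (2 * ((z + z⁻¹) / 2) - z⁻¹ - z⁻¹) = t * (z - z⁻¹) := by ring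
  rw [e, Complex.exp_zero, one_mul] at h1
  rw [e'] at h2
  unfold jostR
  rw [h1, h2]
  ring

/-- At an eigenvalue, the factor relating the two Jost solutions evolves exponentially. -/
theorem psiMinus_time {a b : ℤ → ℝ → ℝ} (hab : IsTodaSolution a b) (hd : LocallyRapidDecay a b)
    {z : ℂ} (hz0 : z ≠ 0) (hz : ‖z‖ ≤ 1)
    (hW : jostW (fun k => a k 0) (fun k => b k 0) z = 0) {c : ℂ}
    (hc : ∀ n, psiMinus (fun k => a k 0) (fun k => b k 0) z n =
      c * psiPlus (fun k => a k 0) (fun k => b k 0) z n) (t : ℝ) (n : ℤ) :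
    psiMinus (fun k => a k t) (fun k => b k t) z n =
      c * Complex.exp (t * (z - z⁻¹)) * psiPlus (fun k => a k t) (fun k => b k t) z n := by
  obtain ⟨M, hM⟩ := hd |t|
  have ht := hM t le_rfl
  obtain ⟨K, hK⟩ := exists_norm_jostG_sub_one_le ht.nonneg
  -- far to the right, `ψ₊` has no zeros up to time `t`
  obtain ⟨m, hm⟩ : ∃ m : ℕ, K / (1 + m) < 1 := by
    have h1 : Tendsto (fun m : ℕ => K / (1 + (m : ℝ))) atTop (𝓝 0) :=
      tendsto_const_nhds.div_atTop (tendsto_atTop_add_const_left _ _ tendsto_natCast_atTop_atTop)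
    exact (h1.eventually_lt_const one_pos).exists
  have hne : ∀ r, |r| ≤ |t| → psiPlus (fun k => a k r) (fun k => b k r) z m ≠ 0 := by
    intro r hr
    have h1 := (hK _ _ (hM r hr) m z hz).trans_lt hm
    unfold psiPlus
    refine mul_ne_zero (mul_ne_zero ?_ (zpow_ne_zero _ hz0)) fun h0 => ?_
    · exact_mod_cast (jostAmp_pos _ _).ne'
    · rw [h0] at h1; simp at h1
  have hwr : ∀ r, |r| ≤ |t| → wr (fun k => a k r) (psiPlus (fun k => a k r) (fun k => b k r) z)
      (psiMinus (fun k => a k r) (fun k => b k r) z) m = 0 := by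
    intro r hr
    rw [wr_eq_of_solves (solvesAt_psiPlus (hM r hr) hz0 hz)
      (solvesAt_psiMinus (hM r hr) hz0 hz) (m : ℤ), wr_psi_eq (hM r hr) hz0,
      (jostW_time_eq_zero_iff hab hd hz0 hz r).mpr hW, mul_zero]
  have hp := laxEvolves_psiPlus hab hd hz0 hz m
  have hq := laxEvolves_psiMinus hab hd hz0 hz m
  set p : ℝ → ℂ := fun r => psiPlus (fun k => a k r) (fun k => b k r) z m with hpdef
  set q : ℝ → ℂ := fun r => psiMinus (fun k => a k r) (fun k => b k r) z m with hqdef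
  have hder : ∀ r, |r| ≤ |t| → HasDerivAt (fun r : ℝ => Complex.exp (-(r * (z - z⁻¹))) *
      (q r / p r)) 0 r := by
    intro r hr
    have h2 : HasDerivAt (fun r : ℝ => -((r : ℂ) * (z - z⁻¹))) (-(1 * (z - z⁻¹))) r :=
      ((Complex.ofRealCLM.hasDerivAt (x := r)).mul_const _).neg
    refine (h2.cexp.mul ((hq r).div (hp r) (hne r hr))).congr_deriv ?_
    have hw := hwr r hr
    have hne' := hne r hr
    unfold wr at hw
    simp only [hpdef, hqdef, Pi.div_apply]
    generalize Complex.exp (-((r : ℂ) * (z - z⁻¹))) = E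
    generalize z⁻¹ = y
    field_simp
    linear_combination 2 * E * hw
  have hf := Convex.norm_image_sub_le_of_norm_hasDerivWithin_le (C := 0)
    (s := Set.Icc (-|t|) |t|) (x := 0) (y := t)
    (fun r hr => (hder r (abs_le.mpr hr)).hasDerivWithinAt) (fun r _ => by simp)
    (convex_Icc _ _) ⟨by simp, abs_nonneg t⟩ (abs_le.mp le_rfl)
  rw [zero_mul, norm_le_zero_iff, sub_eq_zero] at hf
  have hp0 := hne 0 (by simp)
  have hpt := hne t le_rfl
  have hqt : q t = c * Complex.exp (t * (z - z⁻¹)) * p t := by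
    have e0 : q 0 = c * p 0 := hc m
    rw [e0, mul_div_assoc, div_self hp0, Complex.exp_neg] at hf
    have he := Complex.exp_ne_zero ((t : ℂ) * (z - z⁻¹))
    simp only [Complex.ofReal_zero, zero_mul, neg_zero, Complex.exp_zero, one_mul] at hf
    rw [inv_mul_eq_div, div_div, div_eq_iff (mul_ne_zero hpt he)] at hf
    rw [hf]
    simp only [hpdef]
    ring
  obtain ⟨d, -, hd'⟩ := exists_psiMinus_eq_smul ht hz0 hz
    ((jostW_time_eq_zero_iff hab hd hz0 hz t).mpr hW)
  have : d = c * Complex.exp (t * (z - z⁻¹)) :=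
    mul_right_cancel₀ hpt ((hd' m).symm.trans hqt)
  rw [hd' n, this]

/-! ### The vector of Jost functions solves the Riemann–Hilbert problem -/

theorem vecMul_of_two (v : Fin 2 → ℂ) (p q r s : ℂ) :
    v ᵥ* !![p, q; r, s] = ![v 0 * p + v 1 * r, v 0 * q + v 1 * s] := by
  ext i
  fin_cases i <;> simp [Matrix.vecMul, dotProduct, Fin.sum_univ_two]

theorem vecMul_swap (v : Fin 2 → ℂ) : v ᵥ* !![0, 1; 1, 0] = swapVec v := by
  rw [vecMul_of_two]; simp [swapVec]

theorem expPhase_inv (n : ℤ) (t : ℝ) (z : ℂ) : expPhase n t z⁻¹ = (expPhase n t z)⁻¹ := by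
  unfold expPhase
  rw [mul_inv, inv_zpow, ← Complex.exp_neg, inv_inv]
  congr 2
  ring

theorem expPhase_ne_zero (n : ℤ) (t : ℝ) {z : ℂ} (hz : z ≠ 0) : expPhase n t z ≠ 0 :=
  mul_ne_zero (zpow_ne_zero _ hz) (Complex.exp_ne_zero _)

theorem continuousAt_expPhase (n : ℤ) (t : ℝ) {z : ℂ} (hz : z ≠ 0) :
    ContinuousAt (expPhase n t) z := by
  have h1 : ContinuousAt (fun z : ℂ => (t : ℂ) * (z - z⁻¹)) z :=
    (continuousAt_id.sub (continuousAt_inv₀ hz)).const_mul _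
  exact (continuousAt_zpow₀ z (2 * n) (Or.inl hz)).mul
    (Complex.continuous_exp.continuousAt.comp h1)

theorem jostR_conj (a b : ℤ → ℝ) (z : ℂ) : jostR a b (conj z) = conj (jostR a b z) := by
  simp only [jostR, wr, ← map_inv₀, psiPlus_conj, psiMinus_conj]
  simp

theorem tendsto_inv_of_norm_eq_one {w : ℂ} (hw : ‖w‖ = 1) :
    Tendsto (fun z : ℂ => z⁻¹) (𝓝[{z | 1 < ‖z‖}] w) (𝓝[{z | ‖z‖ < 1}] w⁻¹) :=
  tendsto_nhdsWithin_of_tendsto_nhds_of_eventually_within _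
    ((continuousAt_inv₀ (ne_zero_of_norm_eq_one hw)).mono_left nhdsWithin_le_nhds)
    (eventually_mem_nhdsWithin.mono fun z (hz : 1 < ‖z‖) => by
      change ‖z⁻¹‖ < 1
      rw [norm_inv]
      exact inv_lt_one_of_one_lt₀ hz)

theorem tendsto_reflection {M : ℝ} {a b : ℤ → ℝ} (h : RapidDecay M a b) {w : ℂ}
    (hw : ‖w‖ = 1) :
    Tendsto (reflection a b) (𝓝[openCircle] w) (𝓝 (reflection a b w)) :=
  (tendsto_reflectionAux h hw).congr' (eventually_mem_nhdsWithin.mono fun z hz => by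
    rw [reflection_eq h hz, reflectionAux_eq h hz])

theorem scattering_innerM_time {a b : ℤ → ℝ → ℝ} (hab : IsTodaSolution a b)
    (hd : LocallyRapidDecay a b) (n : ℤ) (t : ℝ) {z : ℂ} (hz : z ∈ openCircle) :
    innerM (fun k => a k t) (fun k => b k t) n z 0 =
      innerM (fun k => a k t) (fun k => b k t) n z⁻¹ 1 +
        reflection (fun k => a k 0) (fun k => b k 0) z * expPhase n t z *
          innerM (fun k => a k t) (fun k => b k t) n z 1 := by
  obtain ⟨M, hM⟩ := hd |t|
  rw [scattering_innerM (hM t le_rfl) hz, jostR_time hab hd hz.1, reflection_eq (hM 0 (by simp)) hz,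
    expPhase]
  ring

/-- The jump condition off the band edges: the scattering relations at `z` and at `z⁻¹`. -/
theorem innerM_eq_vecMul_jumpMatrix {a b : ℤ → ℝ → ℝ} (hab : IsTodaSolution a b)
    (hd : LocallyRapidDecay a b) (n : ℤ) (t : ℝ) {z : ℂ} (hz : z ∈ openCircle) :
    innerM (fun k => a k t) (fun k => b k t) n z =
      swapVec (innerM (fun k => a k t) (fun k => b k t) n z⁻¹) ᵥ*
        jumpMatrix (reflection (fun k => a k 0) (fun k => b k 0)) n t z := by
  obtain ⟨M, hM⟩ := hd |t|
  have h0 := hM 0 (by simp)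
  have h1 := scattering_innerM_time hab hd n t hz
  have h2 := scattering_innerM_time hab hd n t (inv_mem_openCircle hz)
  rw [inv_inv, expPhase_inv, reflection_eq h0 (inv_mem_openCircle hz),
    inv_eq_conj_of_norm hz.1, jostR_conj, ← reflection_eq h0 hz] at h2
  rw [inv_eq_conj_of_norm hz.1] at h1 ⊢
  have he := expPhase_ne_zero n t (ne_zero_of_norm_eq_one hz.1)
  have hR := Complex.mul_conj' (reflection (fun k => a k 0) (fun k => b k 0) z)
  rw [jumpMatrix, vecMul_of_two]
  ext i
  fin_cases i
  · simp only [swapVec, Fin.zero_eta, Fin.isValue, Matrix.cons_val_zero, Matrix.cons_val_one]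
    rw [h1, h2, ← hR]
    field_simp
    ring
  · simp only [swapVec, Fin.mk_one, Fin.isValue, Matrix.cons_val_zero, Matrix.cons_val_one]
    rw [h2]
    ring

/-- The jump condition on the whole circle. At the band edges it is the limit along the circle. -/
theorem exists_jump_mJost {a b : ℤ → ℝ → ℝ} (hab : IsTodaSolution a b)
    (hd : LocallyRapidDecay a b) (n : ℤ) (t : ℝ) {w : ℂ} (hw : ‖w‖ = 1) :
    ∃ mp mm : Fin 2 → ℂ,
      Tendsto (mJost (fun k => a k t) (fun k => b k t) n) (𝓝[{w | ‖w‖ < 1}] w) (𝓝 mp) ∧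
      Tendsto (mJost (fun k => a k t) (fun k => b k t) n) (𝓝[{w | 1 < ‖w‖}] w) (𝓝 mm) ∧
      mp = mm ᵥ* jumpMatrix (reflection (fun k => a k 0) (fun k => b k 0)) n t w := by
  obtain ⟨M, hM⟩ := hd |t|
  have ht := hM t le_rfl
  have h0 := hM 0 (by simp)
  have hwi : ‖w⁻¹‖ = 1 := by rw [norm_inv, hw, inv_one]
  have hw0 := ne_zero_of_norm_eq_one hw
  obtain ⟨L, hL, hL'⟩ := exists_tendsto_innerM ht n hw
  obtain ⟨K, hK, hK'⟩ := exists_tendsto_innerM ht n hwi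
  refine ⟨L, swapVec K, hL.congr' ?_, ?_, ?_⟩
  · filter_upwards [self_mem_nhdsWithin] with z hz
    exact (mJost_of_norm_lt ht hz n).symm
  · refine ((continuous_swapVec.tendsto K).comp (hK.comp (tendsto_inv_of_norm_eq_one hw))).congr' ?_
    filter_upwards [self_mem_nhdsWithin] with z hz
    exact (mJost_of_one_lt ht hz n).symm
  · have hne : (𝓝[openCircle] w).NeBot :=
      mem_closure_iff_nhdsWithin_neBot.mp (mem_closure_openCircle hw)
    have hR := tendsto_reflection h0 hw
    have he : Tendsto (expPhase n t) (𝓝[openCircle] w) (𝓝 (expPhase n t w)) :=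
      (continuousAt_expPhase n t hw0).mono_left nhdsWithin_le_nhds
    have he0 := expPhase_ne_zero n t hw0
    have hRn : Tendsto (fun z => 1 - (‖reflection (fun k => a k 0) (fun k => b k 0) z‖ : ℂ) ^ 2)
        (𝓝[openCircle] w) (𝓝 (1 - (‖reflection (fun k => a k 0) (fun k => b k 0) w‖ : ℂ) ^ 2)) :=
      (((Complex.continuous_ofReal.tendsto _).comp hR.norm).pow 2).const_sub 1
    have hRc := (Complex.continuous_conj.tendsto _).comp hR
    have hS := tendsto_pi_nhds.mp
      ((continuous_swapVec.tendsto K).comp (hK'.comp (tendsto_inv_openCircle hw)))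
    refine tendsto_nhds_unique_of_eventuallyEq hL' (f := innerM _ _ n) (g := fun z =>
      swapVec (innerM (fun k => a k t) (fun k => b k t) n z⁻¹) ᵥ*
        jumpMatrix (reflection (fun k => a k 0) (fun k => b k 0)) n t z) ?_
        (eventually_mem_nhdsWithin.mono fun z hz => innerM_eq_vecMul_jumpMatrix hab hd n t hz)
    simp only [jumpMatrix, vecMul_of_two]
    rw [tendsto_pi_nhds]
    intro i
    fin_cases i
    · exact ((hS 0).mul hRn).add ((hS 1).mul (hR.mul he))
    · exact ((hS 0).mul (hRc.neg.mul (he.inv₀ he0))).add ((hS 1).mul tendsto_const_nhds)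

theorem jostW_ne_zero_of_notMem_poleSet {a b : ℤ → ℝ → ℝ} (hab : IsTodaSolution a b)
    (hd : LocallyRapidDecay a b) (t : ℝ) {z : ℂ} (hz : ‖z‖ < 1)
    (hzp : z ∉ poleSet (eigenPoints (fun k => a k 0) (fun k => b k 0))) :
    jostW (fun k => a k t) (fun k => b k t) z ≠ 0 := by
  by_cases hz0 : z = 0
  · rw [hz0, jostW_zero]; exact one_ne_zero
  obtain ⟨M, hM⟩ := hd 0
  have h0 := hM 0 (by simp)
  rw [Ne, jostW_time_eq_zero_iff hab hd hz0 hz.le]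
  by_cases him : z.im = 0
  · have hre : (z.re : ℂ) = z := Complex.ext (by simp) (by simp [him])
    intro hW
    refine hzp ⟨z.re, (mem_eigenPoints_iff h0 _).mpr ⟨?_, ?_, ?_⟩, Or.inl hre.symm⟩
    · rintro h; rw [h] at hre; exact hz0 (by simpa using hre.symm)
    · rwa [← Real.norm_eq_abs, ← Complex.norm_real, hre]
    · rwa [hre]
  · exact jostW_ne_zero_of_im_ne_zero h0 hz him

theorem inv_mem_poleSet {Z : Set ℝ} {z : ℂ} (hz : z ∈ poleSet Z) : z⁻¹ ∈ poleSet Z := by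
  obtain ⟨ζ, hζ, h | h⟩ := hz
  · exact ⟨ζ, hζ, Or.inr (by rw [h])⟩
  · exact ⟨ζ, hζ, Or.inl (by rw [h, inv_inv])⟩

/-- The residue condition for the first component: the derivative of the Wronskian at an
eigenvalue is expressed by the norming constant, and the two Jost solutions are proportional. -/
theorem tendsto_sub_mul_innerM {a b : ℤ → ℝ → ℝ} (hab : IsTodaSolution a b)
    (hd : LocallyRapidDecay a b) (n : ℤ) (t : ℝ) {ζ : ℝ}
    (hζ : ζ ∈ eigenPoints (fun k => a k 0) (fun k => b k 0)) :
    Tendsto (fun z => (z - ζ) * innerM (fun k => a k t) (fun k => b k t) n z 0) (𝓝[≠] (ζ : ℂ))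
      (𝓝 (innerM (fun k => a k t) (fun k => b k t) n ζ 1 *
        (-ζ * normingConst (fun k => a k 0) (fun k => b k 0) ζ * expPhase n t ζ))) := by
  obtain ⟨M, hM⟩ := hd |t|
  have ht := hM t le_rfl
  have h0 := hM 0 (by simp)
  obtain ⟨hζ0, hζ1, hW⟩ := (mem_eigenPoints_iff h0 ζ).mp hζ
  have hz0 : (ζ : ℂ) ≠ 0 := by exact_mod_cast hζ0
  have hz1 : ‖(ζ : ℂ)‖ < 1 := by rwa [Complex.norm_real, Real.norm_eq_abs]
  obtain ⟨c, hc0, hc⟩ := exists_psiMinus_eq_smul h0 hz0 hz1.le hW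
  have hS := tsum_norm_psiPlus_sq_pos h0 hz0 hz1 hW
  have hd0 := hasDerivAt_jostW h0 hζ0 hζ1 hW hc
  have hγ : normingConst (fun k => a k 0) (fun k => b k 0) ζ =
      (∑' n : ℤ, ‖psiPlus (fun k => a k 0) (fun k => b k 0) ζ n‖ ^ 2)⁻¹ := by
    rw [normingConst, jostPlus_eq h0 hz0 hz1.le]
  set S := ∑' n : ℤ, ‖psiPlus (fun k => a k 0) (fun k => b k 0) ζ n‖ ^ 2 with hSdef
  have htot : (totalAmp (fun k => a k t) : ℂ) ≠ 0 := by exact_mod_cast (totalAmp_pos _).ne'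
  have htot0 : (totalAmp (fun k => a k 0) : ℂ) ≠ 0 := by exact_mod_cast (totalAmp_pos _).ne'
  have hS0 : (S : ℂ) ≠ 0 := by exact_mod_cast hS.ne'
  have h1ζ : (1 - (ζ : ℂ) ^ 2) ≠ 0 := by
    have : ζ ^ 2 < 1 := (sq_lt_one_iff_abs_lt_one ζ).mpr hζ1
    have h2 : (1 - ζ ^ 2 : ℝ) ≠ 0 := by linarith
    exact_mod_cast h2
  have hev : (jostW (fun k => a k t) (fun k => b k t)) =ᶠ[𝓝 (ζ : ℂ)]
      fun z => (totalAmp (fun k => a k 0) : ℂ) / totalAmp (fun k => a k t) *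
        jostW (fun k => a k 0) (fun k => b k 0) z := by
    filter_upwards [eventually_ne_zero_norm_lt hz0 hz1] with z hz
    have := jostW_time hab hd hz.1 hz.2.le t
    field_simp
    rw [mul_comm]
    exact this
  have hdt := (hd0.const_mul _).congr_of_eventuallyEq hev
  have hWt : jostW (fun k => a k t) (fun k => b k t) ζ = 0 :=
    (jostW_time_eq_zero_iff hab hd hz0 hz1.le t).mpr hW
  have hslope := hasDerivAt_iff_tendsto_slope.mp hdt
  have hq := hslope.inv₀ (by
    refine mul_ne_zero (div_ne_zero htot0 htot) (neg_ne_zero.mpr (div_ne_zero ?_ ?_))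
    · exact mul_ne_zero (mul_ne_zero h1ζ hc0) hS0
    · exact mul_ne_zero htot0 hz0)
  have hg : ContinuousAt (jostGMinus (fun k => a k t) (fun k => b k t) n) ζ :=
    (differentiableAt_jostG ht.reflect (-n) hz1).continuousAt
  have hsq : ContinuousAt (fun z : ℂ => 1 - z ^ 2) ζ := by fun_prop
  have hr := (hsq.mul (hg.div_const (jostAmp (fun k => a k t) n : ℂ))).tendsto.mono_left
    (nhdsWithin_le_nhds (s := {(ζ : ℂ)}ᶜ))
  have hfin := hq.mul hr
  have hval := psiMinus_time hab hd hz0 hz1.le hW hc t n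
  have hA := jostAmp_mul_jostAmpMinus ht n
  have hA1 : (jostAmp (fun k => a k t) n : ℂ) ≠ 0 := by exact_mod_cast (jostAmp_pos _ _).ne'
  have hA2 : (jostAmpMinus (fun k => a k t) n : ℂ) ≠ 0 := by
    exact_mod_cast (jostAmpMinus_pos _ _).ne'
  have hA' : (jostAmp (fun k => a k t) n : ℂ) * jostAmpMinus (fun k => a k t) n =
      totalAmp (fun k => a k t) := by exact_mod_cast hA
  have hgm : jostGMinus (fun k => a k t) (fun k => b k t) n ζ /
      jostAmp (fun k => a k t) n = c * expPhase n t ζ *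
        (jostAmp (fun k => a k t) n * jostG (fun k => a k t) (fun k => b k t) n ζ) /
          totalAmp (fun k => a k t) := by
    rw [psiMinus_eq, psiPlus] at hval
    have hzn := zpow_ne_zero n hz0
    have e2 : (ζ : ℂ) ^ (2 * n) = ζ ^ n * ζ ^ n := by rw [← zpow_add₀ hz0]; congr 1; ring
    rw [expPhase, e2, ← hA', div_eq_div_iff hA1 (mul_ne_zero hA1 hA2)]
    rw [zpow_neg] at hval
    generalize Complex.exp (t * ((ζ : ℂ) - (ζ : ℂ)⁻¹)) = E at *
    field_simp at hval
    linear_combination (jostAmp (fun k => a k t) n : ℂ) * hval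
  refine (hfin.congr' ?_).trans_eq ?_
  · filter_upwards with z
    simp only [slope, vsub_eq_sub, Pi.mul_apply, smul_eq_mul, hWt, sub_zero, innerM, Matrix.cons_val_zero,
      mul_inv, inv_inv]
    ring
  · simp only [Pi.mul_apply, hgm, hγ, innerM, Matrix.cons_val_one, Matrix.cons_val_zero]
    congr 1
    push_cast
    field_simp

theorem poleCondition_mJost {a b : ℤ → ℝ → ℝ} (hab : IsTodaSolution a b)
    (hd : LocallyRapidDecay a b) (n : ℤ) (t : ℝ) {ζ : ℝ}
    (hζ : ζ ∈ eigenPoints (fun k => a k 0) (fun k => b k 0)) :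
    PoleCondition (mJost (fun k => a k t) (fun k => b k t) n) ζ
      !![0, 0; -ζ * normingConst (fun k => a k 0) (fun k => b k 0) ζ * expPhase n t ζ, 0] := by
  obtain ⟨M, hM⟩ := hd |t|
  have ht := hM t le_rfl
  have hζ1 : |ζ| < 1 := hζ.2.1
  have hz1 : ‖(ζ : ℂ)‖ < 1 := by rwa [Complex.norm_real, Real.norm_eq_abs]
  set ν := -(ζ : ℂ) * normingConst (fun k => a k 0) (fun k => b k 0) ζ * expPhase n t ζ
  have hev : ∀ᶠ z : ℂ in 𝓝[≠] (ζ : ℂ), ‖z‖ < 1 :=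
    (continuous_norm.continuousAt.eventually_lt_const hz1).filter_mono nhdsWithin_le_nhds
  have h1 : Tendsto (fun z => innerM (fun k => a k t) (fun k => b k t) n z 1) (𝓝[≠] (ζ : ℂ))
      (𝓝 (innerM (fun k => a k t) (fun k => b k t) n ζ 1)) :=
    ((differentiableAt_jostG ht n hz1).continuousAt.tendsto.const_mul _).mono_left
      nhdsWithin_le_nhds
  refine ⟨![innerM (fun k => a k t) (fun k => b k t) n ζ 1 * ν, 0], ?_, ?_⟩
  · rw [tendsto_pi_nhds]
    intro i
    fin_cases i
    · refine (h1.mul_const ν).congr' ?_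
      filter_upwards [hev] with z hz
      rw [mJost_of_norm_lt ht hz, vecMul_of_two]
      simp
    · refine tendsto_const_nhds.congr fun z => ?_
      rw [vecMul_of_two]
      simp
  · rw [tendsto_pi_nhds]
    intro i
    fin_cases i
    · refine (tendsto_sub_mul_innerM hab hd n t hζ).congr' ?_
      filter_upwards [hev] with z hz
      rw [mJost_of_norm_lt ht hz]
      simp
    · have h2 : Tendsto (fun z : ℂ => z - ζ) (𝓝[≠] (ζ : ℂ)) (𝓝 ((ζ : ℂ) - ζ)) :=
        ((continuous_id.sub continuous_const).tendsto _).mono_left nhdsWithin_le_nhds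
      have h3 := h2.mul h1
      rw [sub_self, zero_mul] at h3
      refine h3.congr' ?_
      filter_upwards [hev] with z hz
      rw [mJost_of_norm_lt ht hz]
      simp

theorem tendsto_inv_punctured {p : ℂ} (hp : p ≠ 0) :
    Tendsto (fun z : ℂ => z⁻¹) (𝓝[≠] p⁻¹) (𝓝[≠] p) := by
  have h := continuousAt_inv₀ (inv_ne_zero hp)
  unfold ContinuousAt at h
  rw [inv_inv] at h
  refine tendsto_nhdsWithin_of_tendsto_nhds_of_eventually_within _
    (h.mono_left nhdsWithin_le_nhds) ?_
  filter_upwards [self_mem_nhdsWithin] with z hz hz'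
  rw [Set.mem_singleton_iff] at hz'
  exact hz (by rw [Set.mem_singleton_iff, ← hz', inv_inv])

theorem poleCondition_inv_mJost {a b : ℤ → ℝ → ℝ} (hab : IsTodaSolution a b)
    (hd : LocallyRapidDecay a b) (n : ℤ) (t : ℝ) {ζ : ℝ}
    (hζ : ζ ∈ eigenPoints (fun k => a k 0) (fun k => b k 0)) :
    PoleCondition (mJost (fun k => a k t) (fun k => b k t) n) (ζ : ℂ)⁻¹
      !![0, (ζ : ℂ)⁻¹ * normingConst (fun k => a k 0) (fun k => b k 0) ζ * expPhase n t ζ;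
        0, 0] := by
  obtain ⟨M, hM⟩ := hd |t|
  have ht := hM t le_rfl
  have hres := tendsto_sub_mul_innerM hab hd n t hζ
  obtain ⟨hζ0, hζ1, -⟩ := hζ
  have hz0 : (ζ : ℂ) ≠ 0 := by exact_mod_cast hζ0
  have hz1 : ‖(ζ : ℂ)‖ < 1 := by rwa [Complex.norm_real, Real.norm_eq_abs]
  have hz1' : 1 < ‖(ζ : ℂ)⁻¹‖ := by
    rw [norm_inv]; exact (one_lt_inv₀ (norm_pos_iff.mpr hz0)).mpr hz1
  set ν := (ζ : ℂ)⁻¹ * normingConst (fun k => a k 0) (fun k => b k 0) ζ * expPhase n t ζ with hν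
  have hev : ∀ᶠ z : ℂ in 𝓝[≠] (ζ : ℂ)⁻¹, 1 < ‖z‖ :=
    (continuous_norm.continuousAt.eventually_const_lt hz1').filter_mono nhdsWithin_le_nhds
  have hinv := tendsto_inv_punctured hz0
  have h1 : Tendsto (fun z : ℂ => innerM (fun k => a k t) (fun k => b k t) n z⁻¹ 1)
      (𝓝[≠] (ζ : ℂ)⁻¹) (𝓝 (innerM (fun k => a k t) (fun k => b k t) n ζ 1)) :=
    (((differentiableAt_jostG ht n hz1).continuousAt.tendsto.const_mul _).mono_left
      nhdsWithin_le_nhds).comp hinv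
  refine ⟨![0, innerM (fun k => a k t) (fun k => b k t) n ζ 1 * ν], ?_, ?_⟩
  · rw [tendsto_pi_nhds]
    intro i
    fin_cases i
    · refine tendsto_const_nhds.congr fun z => ?_
      rw [vecMul_of_two]
      simp
    · refine (h1.mul_const ν).congr' ?_
      filter_upwards [hev] with z hz
      rw [mJost_of_one_lt ht hz, vecMul_of_two]
      simp [swapVec]
  · rw [tendsto_pi_nhds]
    intro i
    fin_cases i
    · have h2 : Tendsto (fun z : ℂ => z - (ζ : ℂ)⁻¹) (𝓝[≠] (ζ : ℂ)⁻¹)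
          (𝓝 ((ζ : ℂ)⁻¹ - (ζ : ℂ)⁻¹)) :=
        ((continuous_id.sub continuous_const).tendsto _).mono_left nhdsWithin_le_nhds
      have h3 := h2.mul h1
      rw [sub_self, zero_mul] at h3
      refine h3.congr' ?_
      filter_upwards [hev] with z hz
      rw [mJost_of_one_lt ht hz]
      simp [swapVec]
    · have h2 : Tendsto (fun z : ℂ => -(z / (ζ : ℂ))) (𝓝[≠] (ζ : ℂ)⁻¹)
          (𝓝 (-((ζ : ℂ)⁻¹ / ζ))) :=
        (((continuous_id.div_const _).neg).tendsto _).mono_left nhdsWithin_le_nhds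
      have h3 := h2.mul (hres.comp hinv)
      refine (h3.congr' ?_).trans_eq ?_
      · filter_upwards [hev] with z hz
        have hz' : z ≠ 0 := by rintro rfl; simp at hz; linarith
        rw [mJost_of_one_lt ht hz]
        simp only [swapVec, Function.comp_apply, Fin.mk_one, Fin.isValue, Pi.smul_apply,
          Matrix.cons_val_one, Matrix.cons_val_zero, smul_eq_mul]
        rw [← mul_assoc]
        congr 1
        generalize innerM (fun k => a k t) (fun k => b k t) n z⁻¹ 0 = q
        field_simp
        ring
      · simp only [hν, Fin.mk_one, Fin.isValue, Matrix.cons_val_one, Matrix.cons_val_zero]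
        congr 1
        field_simp

theorem differentiable_swapVec : Differentiable ℂ swapVec := by
  unfold swapVec
  rw [differentiable_pi]
  intro i
  fin_cases i
  · exact differentiable_pi.mp differentiable_id 1
  · exact differentiable_pi.mp differentiable_id 0

theorem isRHPSolution_mJost {a b : ℤ → ℝ → ℝ} (hab : IsTodaSolution a b)
    (hd : LocallyRapidDecay a b) (n : ℤ) (t : ℝ) :
    IsRHPSolution (reflection (fun k => a k 0) (fun k => b k 0))
      (eigenPoints (fun k => a k 0) (fun k => b k 0))
      (normingConst (fun k => a k 0) (fun k => b k 0)) n t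
      (mJost (fun k => a k t) (fun k => b k t) n) := by
  obtain ⟨M, hM⟩ := hd |t|
  have ht := hM t le_rfl
  refine ⟨fun z hz hzp => ?_, fun z hz => exists_jump_mJost hab hd n t hz,
    fun ζ hζ => poleCondition_mJost hab hd n t hζ,
    fun ζ hζ => poleCondition_inv_mJost hab hd n t hζ, fun z hz0 hz hzp => ?_, ?_⟩
  · rcases lt_or_gt_of_ne hz with hz1 | hz1
    · refine (differentiableAt_innerM ht n hz1
        (jostW_ne_zero_of_notMem_poleSet hab hd t hz1 hzp)).congr_of_eventuallyEq ?_
      filter_upwards [isOpen_norm_lt_one.mem_nhds hz1] with w hw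
      exact mJost_of_norm_lt ht hw n
    · have hz0 : z ≠ 0 := by rintro rfl; simp at hz1; linarith
      have hi : ‖z⁻¹‖ < 1 := by rw [norm_inv]; exact inv_lt_one_of_one_lt₀ hz1
      have hip : z⁻¹ ∉ poleSet (eigenPoints (fun k => a k 0) (fun k => b k 0)) := fun h =>
        hzp (by simpa using inv_mem_poleSet h)
      have h1 : DifferentiableAt ℂ (fun z => innerM (fun k => a k t) (fun k => b k t) n z⁻¹) z :=
        (differentiableAt_innerM ht n hi
          (jostW_ne_zero_of_notMem_poleSet hab hd t hi hip)).comp z (differentiableAt_inv hz0)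
      refine ((differentiable_swapVec _).comp z h1).congr_of_eventuallyEq ?_
      filter_upwards [(isOpen_lt continuous_const continuous_norm).mem_nhds hz1] with w hw
      exact mJost_of_one_lt ht hw n
  · rw [vecMul_swap]
    rcases lt_or_gt_of_ne hz with hz1 | hz1
    · have hi : 1 < ‖z⁻¹‖ := by
        rw [norm_inv]; exact (one_lt_inv₀ (norm_pos_iff.mpr hz0)).mpr hz1
      rw [mJost_of_one_lt ht hi, mJost_of_norm_lt ht hz1, inv_inv]
    · have hi : ‖z⁻¹‖ < 1 := by rw [norm_inv]; exact inv_lt_one_of_one_lt₀ hz1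
      rw [mJost_of_one_lt ht hz1, mJost_of_norm_lt ht hi]
      ext i
      fin_cases i <;> simp [swapVec]
  · rw [mJost_of_norm_lt ht (by simp)]
    have hA := jostAmp_pos (fun k => a k t) n
    have hA' : (jostAmp (fun k => a k t) n : ℂ) ≠ 0 := by exact_mod_cast hA.ne'
    simp only [innerM, jostW_zero, jostGMinus, jostG_zero, Matrix.cons_val_zero,
      Matrix.cons_val_one]
    refine ⟨?_, (jostAmp (fun k => a k t) n)⁻¹, inv_pos.mpr hA, ?_⟩
    · field_simp
      simp
    · push_cast
      simp

/-! ### Finiteness of the discrete spectrum -/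

/-- Zeros of the Wronskian accumulate neither inside the disc nor at its boundary. -/
theorem finite_eigenPoints {M : ℝ} {a b : ℤ → ℝ} (h : RapidDecay M a b) :
    (eigenPoints a b).Finite := by
  -- every point of the closed disc has a neighbourhood without zeros of `W`, except for itself
  have hloc : ∀ w ∈ Metric.closedBall (0 : ℂ) 1,
      ∀ᶠ z in 𝓝[Metric.closedBall 0 1 \ {w}] w, jostW a b z ≠ 0 := by
    intro w hw
    rw [mem_closedBall_zero_iff] at hw
    rcases hw.lt_or_eq with hw1 | hw1
    · have hdiff : DifferentiableOn ℂ (jostW a b) (Metric.ball 0 1) := fun z hz =>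
        (differentiableAt_jostW h (by simpa using hz)).differentiableWithinAt
      have han := hdiff.analyticOnNhd Metric.isOpen_ball
      have hwb : w ∈ Metric.ball (0 : ℂ) 1 := by simpa using hw1
      rcases (han w hwb).eventually_eq_zero_or_eventually_ne_zero with h0 | h0
      · have := han.eqOn_zero_of_preconnected_of_eventuallyEq_zero
          (convex_ball (0 : ℂ) 1).isPreconnected hwb h0 (x := 0) (by simp)
        rw [jostW_zero] at this
        exact absurd this one_ne_zero
      · exact h0.filter_mono (nhdsWithin_mono w fun z hz => hz.2)
    · obtain ⟨-, -, h0⟩ := exists_tendsto_one_sub_sq_div_jostW h hw1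
      exact h0
  have hfin : {z ∈ Metric.closedBall (0 : ℂ) 1 | jostW a b z = 0}.Finite := by
    by_contra hinf
    obtain ⟨w, hw, hacc⟩ := Set.Infinite.exists_accPt_of_subset_isCompact hinf
      (isCompact_closedBall (0 : ℂ) 1) (fun z hz => hz.1)
    have h1 := hloc w hw
    rw [eventually_nhdsWithin_iff] at h1
    obtain ⟨z, ⟨hzw, hz1, hz2⟩, hz3⟩ := ((accPt_iff_frequently.mp hacc).and_eventually h1).exists
    exact hz3 ⟨hz1, hzw⟩ hz2
  refine Set.Finite.of_finite_image (f := ((↑) : ℝ → ℂ)) (hfin.subset ?_)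
    Complex.ofReal_injective.injOn
  rintro _ ⟨ζ, hζ, rfl⟩
  obtain ⟨-, h1, h2⟩ := (mem_eigenPoints_iff h ζ).mp hζ
  exact ⟨by simpa using h1.le, h2⟩

/-! ### Function theory in the unit disc -/

theorem eventually_notMem_of_finite {S : Set ℂ} (hS : S.Finite) (p : ℂ) :
    ∀ᶠ z in 𝓝[≠] p, z ∉ S := by
  have h1 : (S \ {p})ᶜ ∈ 𝓝 p := (hS.subset Set.sdiff_subset).isClosed.isOpen_compl.mem_nhds
    (fun h => h.2 rfl)
  filter_upwards [nhdsWithin_le_nhds h1, self_mem_nhdsWithin] with z hz hzp hzS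
  exact hz ⟨hzS, hzp⟩

/-- A holomorphic function in the punctured disc which is `o(1/|z - p|)` at finitely many
punctures and has boundary values extends continuously to the closed disc. -/
theorem exists_diffContOnCl_extension {S : Set ℂ} (hS : S.Finite) {f : ℂ → ℂ}
    (hf : ∀ z, ‖z‖ < 1 → z ∉ S → DifferentiableAt ℂ f z)
    (hpole : ∀ p ∈ S, Tendsto (fun z => (z - p) * f z) (𝓝[≠] p) (𝓝 0))
    (hb : ∀ w, ‖w‖ = 1 → ∃ L, Tendsto f (𝓝[{z | ‖z‖ < 1}] w) (𝓝 L)) :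
    ∃ F : ℂ → ℂ, DiffContOnCl ℂ F (Metric.ball 0 1) ∧
      (∀ z, ‖z‖ < 1 → z ∉ S → F z = f z) ∧
      ∀ w L, ‖w‖ = 1 → Tendsto f (𝓝[{z | ‖z‖ < 1}] w) (𝓝 L) → F w = L := by
  set A : Set ℂ := {z | ‖z‖ < 1} ∩ Sᶜ with hA
  have hAo : IsOpen A := isOpen_norm_lt_one.inter hS.isClosed.isOpen_compl
  have hball : {z : ℂ | ‖z‖ < 1} = Metric.ball 0 1 := by ext; simp
  have hcl : Metric.closedBall (0 : ℂ) 1 ⊆ closure A := by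
    have h1 : Dense Sᶜ := hS.countable.dense_compl ℝ
    have h2 := closure_mono (h1.open_subset_closure_inter isOpen_norm_lt_one)
    rw [closure_closure, hball, closure_ball (0 : ℂ) one_ne_zero, ← hball] at h2
    exact h2
  have hdA : ∀ z ∈ A, DifferentiableAt ℂ f z := fun z hz => hf z hz.1 hz.2
  have hpunct : ∀ w, ‖w‖ < 1 → ∀ᶠ z in 𝓝[≠] w, z ∈ A := fun w hw => by
    filter_upwards [eventually_notMem_of_finite hS w,
      nhdsWithin_le_nhds (isOpen_norm_lt_one.mem_nhds hw)] with z hz hz'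
    exact ⟨hz', hz⟩
  have hlim : ∀ w ∈ Metric.closedBall (0 : ℂ) 1, ∃ L, Tendsto f (𝓝[A] w) (𝓝 L) := by
    intro w hw
    rw [mem_closedBall_zero_iff] at hw
    rcases hw.lt_or_eq with hw1 | hw1
    · by_cases hwS : w ∈ S
      · have ho : (fun z => f z - f w) =o[𝓝[≠] w] fun z => (z - w)⁻¹ := by
          rw [Asymptotics.isLittleO_iff_tendsto']
          · have h1 : Tendsto (fun z : ℂ => (z - w) * f w) (𝓝[≠] w) (𝓝 ((w - w) * f w)) :=
              (((continuous_id.sub continuous_const).mul continuous_const).tendsto w).mono_left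
                nhdsWithin_le_nhds
            rw [sub_self, zero_mul] at h1
            have h2 := (hpole w hwS).sub h1
            rw [sub_zero] at h2
            refine h2.congr fun z => ?_
            rw [div_inv_eq_mul]; ring
          · filter_upwards [self_mem_nhdsWithin] with z hz h0
            exact absurd (sub_eq_zero.mp (inv_eq_zero.mp h0)) hz
        refine ⟨_, (Complex.tendsto_limUnder_of_differentiable_on_punctured_nhds_of_isLittleO
          ((hpunct w hw1).mono hdA) ho).mono_left (nhdsWithin_mono w fun z hz hzw => ?_)⟩
        rw [Set.mem_singleton_iff] at hzw
        exact hz.2 (hzw ▸ hwS)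
      · exact ⟨f w, (hf w hw1 hwS).continuousAt.mono_left nhdsWithin_le_nhds⟩
    · obtain ⟨L, hL⟩ := hb w hw1
      exact ⟨L, hL.mono_left (nhdsWithin_mono w Set.inter_subset_left)⟩
  have hcont := continuousOn_extendFrom hcl hlim
  have hext : ∀ z ∈ A, extendFrom A f z = f z := fun z hz =>
    extendFrom_eq (subset_closure hz) ((hdA z hz).continuousAt.mono_left nhdsWithin_le_nhds)
  have hdiff : ∀ z ∈ A, DifferentiableAt ℂ (extendFrom A f) z := fun z hz =>
    (hdA z hz).congr_of_eventuallyEq (eventually_of_mem (hAo.mem_nhds hz) hext)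
  refine ⟨extendFrom A f, ⟨?_, ?_⟩, fun z hz hzS => hext z ⟨hz, hzS⟩, fun w L hw hL => ?_⟩
  · intro z hz
    have hz1 : ‖z‖ < 1 := by simpa using hz
    by_cases hzA : z ∈ A
    · exact (hdiff z hzA).differentiableWithinAt
    · exact (Complex.analyticAt_of_differentiable_on_punctured_nhds_of_continuousAt
        ((hpunct z hz1).mono hdiff) (hcont.continuousAt
          (Metric.closedBall_mem_nhds_of_mem hz))).differentiableAt.differentiableWithinAt
  · rwa [closure_ball (0 : ℂ) one_ne_zero]
  · exact extendFrom_eq (hcl (by simp [hw]))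
      (hL.mono_left (nhdsWithin_mono w Set.inter_subset_left))

/-- The maximum principle for `exp (-F)`. -/
theorem re_eq_zero_of_re_nonneg {F : ℂ → ℂ} (hF : DiffContOnCl ℂ F (Metric.ball 0 1))
    (h0 : F 0 = 0) (hre : ∀ w, ‖w‖ = 1 → 0 ≤ (F w).re) {w : ℂ} (hw : ‖w‖ = 1) :
    (F w).re = 0 := by
  have hG : DiffContOnCl ℂ (fun z => Complex.exp (-F z)) (Metric.ball 0 1) :=
    Complex.differentiable_exp.comp_diffContOnCl hF.neg
  have hle : ∀ z ∈ Metric.closedBall (0 : ℂ) 1, ‖Complex.exp (-F z)‖ ≤ 1 := by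
    intro z hz
    refine Complex.norm_le_of_forall_mem_frontier_norm_le Metric.isBounded_ball hG (fun y hy => ?_)
      (by rwa [closure_ball (0 : ℂ) one_ne_zero])
    rw [frontier_ball (0 : ℂ) one_ne_zero, mem_sphere_zero_iff_norm] at hy
    rw [Complex.norm_exp, Complex.neg_re, Real.exp_le_one_iff]
    linarith [hre y hy]
  have hmax : IsMaxOn (norm ∘ fun z => Complex.exp (-F z)) (Metric.ball 0 1) 0 := by
    intro z hz
    simpa [h0] using hle z (Metric.ball_subset_closedBall hz)
  have h1 := Complex.norm_eqOn_closedBall_of_isMaxOn hG hmax (x := w) (by simp [hw])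
  simp only [Function.comp_apply, Function.const_apply, h0, neg_zero, Complex.exp_zero, norm_one,
    Complex.norm_exp, Complex.neg_re, Real.exp_eq_one_iff, neg_eq_zero] at h1
  exact h1

theorem eq_zero_of_eq_zero_on_openCircle {F : ℂ → ℂ} (hF : DiffContOnCl ℂ F (Metric.ball 0 1))
    (h0 : ∀ w ∈ openCircle, F w = 0) {z : ℂ} (hz : ‖z‖ < 1) : F z = 0 := by
  have hcont := hF.continuousOn_ball
  have h1 : ∀ w, ‖w‖ = 1 → F w = 0 := by
    intro w hw
    have hne : (𝓝[openCircle] w).NeBot :=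
      mem_closure_iff_nhdsWithin_neBot.mp (mem_closure_openCircle hw)
    have h2 : Tendsto F (𝓝[openCircle] w) (𝓝 (F w)) :=
      (hcont w (by simp [hw])).mono_left (nhdsWithin_mono w fun z hz => by simp [hz.1])
    exact tendsto_nhds_unique (h2.congr' (eventually_mem_nhdsWithin.mono h0)) tendsto_const_nhds
  have h3 := Complex.norm_le_of_forall_mem_frontier_norm_le Metric.isBounded_ball hF (C := 0)
    (fun y hy => by
      rw [frontier_ball (0 : ℂ) one_ne_zero, mem_sphere_zero_iff_norm] at hy
      rw [h1 y hy, norm_zero]) (subset_closure (by simpa using hz))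
  exact norm_le_zero_iff.mp h3

theorem re_div_sub_pos {w : ℂ} (hw : ‖w‖ = 1) {ζ : ℝ} (hζ : |ζ| < 1) :
    0 < (w / (w - ζ)).re := by
  have hne : w - ζ ≠ 0 := by
    rintro h
    rw [sub_eq_zero] at h
    rw [h, Complex.norm_real, Real.norm_eq_abs] at hw
    linarith
  have h1 : w.re ^ 2 + w.im ^ 2 = 1 := by
    have := Complex.sq_norm w
    rw [hw, Complex.normSq_apply] at this
    linarith
  have h2 := Complex.abs_re_le_norm w
  rw [hw] at h2
  have h3 : ζ * w.re < 1 := by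
    calc ζ * w.re ≤ |ζ * w.re| := le_abs_self _
      _ = |ζ| * |w.re| := abs_mul _ _
      _ ≤ |ζ| * 1 := by gcongr
      _ < 1 := by linarith
  rw [Complex.div_re, ← add_div]
  refine div_pos ?_ (Complex.normSq_pos.mpr hne)
  simp only [Complex.sub_re, Complex.sub_im, Complex.ofReal_re, Complex.ofReal_im]
  nlinarith

/-! ### The vanishing theorem and uniqueness -/

/-- The Riemann–Hilbert problem without the normalization at the origin and without the residue
condition outside of the unit disc, which follows from the one inside by symmetry. -/
structure IsHomogeneousSolution (R : ℂ → ℂ) (Z : Set ℝ) (γ : ℝ → ℝ) (n : ℤ) (t : ℝ)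
    (h : ℂ → Fin 2 → ℂ) : Prop where
  holomorphic : ∀ z, ‖z‖ ≠ 1 → z ∉ poleSet Z → DifferentiableAt ℂ h z
  jump : ∀ z, ‖z‖ = 1 → ∃ mp mm : Fin 2 → ℂ,
    Tendsto h (𝓝[{w | ‖w‖ < 1}] z) (𝓝 mp) ∧ Tendsto h (𝓝[{w | 1 < ‖w‖}] z) (𝓝 mm) ∧
      mp = mm ᵥ* jumpMatrix R n t z
  pole : ∀ ζ ∈ Z, PoleCondition h ζ !![0, 0; -ζ * γ ζ * expPhase n t ζ, 0]
  symmetric : ∀ z, z ≠ 0 → ‖z‖ ≠ 1 → z ∉ poleSet Z → h z⁻¹ = swapVec (h z)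

theorem IsRHPSolution.sub_smul {R : ℂ → ℂ} {Z : Set ℝ} {γ : ℝ → ℝ} {n : ℤ} {t : ℝ}
    {f m : ℂ → Fin 2 → ℂ} (hf : IsRHPSolution R Z γ n t f) (hm : IsRHPSolution R Z γ n t m)
    (c : ℂ) : IsHomogeneousSolution R Z γ n t fun z => f z - c • m z where
  holomorphic z hz hzp := (hf.holomorphic z hz hzp).sub ((hm.holomorphic z hz hzp).const_smul c)
  jump z hz := by
    obtain ⟨p, q, h1, h2, h3⟩ := hf.jump z hz
    obtain ⟨p', q', h1', h2', h3'⟩ := hm.jump z hz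
    refine ⟨p - c • p', q - c • q', h1.sub (h1'.const_smul c), h2.sub (h2'.const_smul c), ?_⟩
    rw [Matrix.sub_vecMul, Matrix.smul_vecMul, h3, h3']
  pole ζ hζ := by
    obtain ⟨L, h1, h2⟩ := hf.pole ζ hζ
    obtain ⟨L', h1', h2'⟩ := hm.pole ζ hζ
    refine ⟨L - c • L', ?_, ?_⟩
    · refine (h1.sub (h1'.const_smul c)).congr fun z => ?_
      rw [Matrix.sub_vecMul, Matrix.smul_vecMul]
    · refine (h2.sub (h2'.const_smul c)).congr fun z => ?_
      rw [smul_sub, smul_comm]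
  symmetric z h0 hz hzp := by
    simp only [← vecMul_swap]
    rw [hf.symmetric z h0 hz hzp, hm.symmetric z h0 hz hzp, Matrix.sub_vecMul, Matrix.smul_vecMul]

theorem expPhase_conj (n : ℤ) (t : ℝ) (z : ℂ) :
    expPhase n t (conj z) = conj (expPhase n t z) := by
  simp only [expPhase, map_mul, map_zpow₀, ← Complex.exp_conj, map_sub, map_inv₀,
    Complex.conj_ofReal]

theorem exists_expPhase_ofReal (n : ℤ) (t : ℝ) {ζ : ℝ} (hζ : ζ ≠ 0) :
    ∃ e : ℝ, 0 < e ∧ expPhase n t ζ = e := by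
  refine ⟨ζ ^ (2 * n) * Real.exp (t * (ζ - ζ⁻¹)), ?_, ?_⟩
  · refine mul_pos ?_ (Real.exp_pos _)
    exact Even.zpow_pos (even_two_mul n) hζ
  · simp [expPhase]

theorem conj_mem_image_ofReal {Z : Set ℝ} {z : ℂ} (hz : conj z ∈ Complex.ofReal '' Z) :
    z ∈ Complex.ofReal '' Z := by
  obtain ⟨ζ, hζ, h⟩ := hz
  exact ⟨ζ, hζ, by rw [← Complex.conj_conj z, ← h, Complex.conj_ofReal]⟩

theorem tendsto_conj_punctured (ζ : ℝ) :
    Tendsto (fun z : ℂ => conj z) (𝓝[≠] (ζ : ℂ)) (𝓝[≠] (ζ : ℂ)) := by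
  have h := Complex.continuous_conj.tendsto (ζ : ℂ)
  rw [Complex.conj_ofReal] at h
  refine tendsto_nhdsWithin_of_tendsto_nhds_of_eventually_within _
    (h.mono_left nhdsWithin_le_nhds) ?_
  filter_upwards [self_mem_nhdsWithin] with z hz hz'
  rw [Set.mem_singleton_iff] at hz'
  exact hz (by rw [Set.mem_singleton_iff, ← Complex.conj_conj z, hz', Complex.conj_ofReal])

theorem tendsto_conj_of_norm_lt (w : ℂ) :
    Tendsto (fun z : ℂ => conj z) (𝓝[{z | ‖z‖ < 1}] w) (𝓝[{z | ‖z‖ < 1}] (conj w)) :=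
  tendsto_nhdsWithin_of_tendsto_nhds_of_eventually_within _
    ((Complex.continuous_conj.tendsto w).mono_left nhdsWithin_le_nhds)
    (eventually_mem_nhdsWithin.mono fun z (hz : ‖z‖ < 1) => by
      change ‖conj z‖ < 1
      rwa [Complex.norm_conj])

/-- The jump condition expressed by boundary values from the inside only. -/
theorem IsHomogeneousSolution.exists_boundary {R : ℂ → ℂ} {Z : Set ℝ} {γ : ℝ → ℝ} {n : ℤ} {t : ℝ}
    {h : ℂ → Fin 2 → ℂ} (hh : IsHomogeneousSolution R Z γ n t h) (hfin : Z.Finite)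
    (hZ : ∀ ζ ∈ Z, ζ ≠ 0 ∧ |ζ| < 1) {w : ℂ} (hw : ‖w‖ = 1) :
    ∃ L K : Fin 2 → ℂ, Tendsto h (𝓝[{w | ‖w‖ < 1}] w) (𝓝 L) ∧
      Tendsto h (𝓝[{w | ‖w‖ < 1}] (conj w)) (𝓝 K) ∧
      L 0 = K 1 * (1 - (‖R w‖ : ℂ) ^ 2) + K 0 * (R w * expPhase n t w) ∧
      L 1 = K 1 * (-(conj (R w)) * (expPhase n t w)⁻¹) + K 0 := by
  obtain ⟨L, q, h1, h2, h3⟩ := hh.jump w hw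
  have hwc : ‖conj w‖ = 1 := by rwa [Complex.norm_conj]
  obtain ⟨K, -, h4, -, -⟩ := hh.jump (conj w) hwc
  have hw0 := ne_zero_of_norm_eq_one hwc
  have hpole : (poleSet Z)ᶜ ∈ 𝓝 (conj w) := by
    have hf : (poleSet Z).Finite := by
      refine ((hfin.image fun ζ : ℝ => (ζ : ℂ)).union
        (hfin.image fun ζ : ℝ => (ζ : ℂ)⁻¹)).subset ?_
      rintro z ⟨ζ, hζ, rfl | rfl⟩
      · exact Or.inl ⟨ζ, hζ, rfl⟩
      · exact Or.inr ⟨ζ, hζ, rfl⟩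
    refine hf.isClosed.isOpen_compl.mem_nhds ?_
    rintro ⟨ζ, hζ, e | e⟩
    · rw [e, Complex.norm_real, Real.norm_eq_abs] at hwc
      linarith [(hZ ζ hζ).2]
    · rw [e, norm_inv, Complex.norm_real, Real.norm_eq_abs, inv_eq_one] at hwc
      linarith [(hZ ζ hζ).2]
  have hne : (𝓝[{z : ℂ | ‖z‖ < 1}] (conj w)).NeBot := by
    have hball : {z : ℂ | ‖z‖ < 1} = Metric.ball 0 1 := by ext; simp
    rw [← mem_closure_iff_nhdsWithin_neBot, hball, closure_ball (0 : ℂ) one_ne_zero]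
    simp [hw]
  have hinv : Tendsto (fun z : ℂ => z⁻¹) (𝓝[{z | ‖z‖ < 1}] (conj w)) (𝓝[{z | 1 < ‖z‖}] w) := by
    have h5 := continuousAt_inv₀ hw0
    unfold ContinuousAt at h5
    rw [inv_eq_conj_of_norm hwc, Complex.conj_conj] at h5
    refine tendsto_nhdsWithin_of_tendsto_nhds_of_eventually_within _
      (h5.mono_left nhdsWithin_le_nhds) ?_
    filter_upwards [self_mem_nhdsWithin, nhdsWithin_le_nhds (eventually_ne_nhds hw0)] with z hz hz0
    rw [norm_inv]
    exact (one_lt_inv₀ (norm_pos_iff.mpr hz0)).mpr hz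
  have hq : q = swapVec K := by
    refine tendsto_nhds_unique_of_eventuallyEq (h2.comp hinv)
      ((continuous_swapVec.tendsto K).comp h4) ?_
    filter_upwards [self_mem_nhdsWithin, nhdsWithin_le_nhds (eventually_ne_nhds hw0),
      nhdsWithin_le_nhds hpole] with z hz hz0 hzp
    exact hh.symmetric z hz0 (ne_of_lt hz) hzp
  rw [hq, jumpMatrix, vecMul_of_two] at h3
  exact ⟨L, K, h1, h4, by rw [h3]; rfl, by rw [h3]; simp [swapVec]⟩

/-- Near a pole, the second component has a limit, and it determines the residue of the first. -/
theorem IsHomogeneousSolution.exists_residue {R : ℂ → ℂ} {Z : Set ℝ} {γ : ℝ → ℝ} {n : ℤ} {t : ℝ}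
    {h : ℂ → Fin 2 → ℂ} (hh : IsHomogeneousSolution R Z γ n t h) {ζ : ℝ} (hζ : ζ ∈ Z)
    (hζ0 : ζ ≠ 0) (hγ : 0 < γ ζ) : ∃ (β : ℂ) (κ : ℝ), 0 < κ ∧
      Tendsto (fun z => h z 1) (𝓝[≠] (ζ : ℂ)) (𝓝 β) ∧
      Tendsto (fun z => (z - ζ) * h z 0) (𝓝[≠] (ζ : ℂ)) (𝓝 (-(ζ * κ * β))) ∧
      Tendsto (fun z => (z - ζ) * h z 1) (𝓝[≠] (ζ : ℂ)) (𝓝 0) := by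
  obtain ⟨L, h1, h2⟩ := hh.pole ζ hζ
  obtain ⟨e, he, hee⟩ := exists_expPhase_ofReal n t hζ0
  have hκ : (0 : ℝ) < γ ζ * e := mul_pos hγ he
  have hne : (ζ : ℂ) * (γ ζ * e : ℝ) ≠ 0 := by
    exact_mod_cast mul_ne_zero hζ0 hκ.ne'
  simp only [vecMul_of_two, hee] at h1
  have h10 := tendsto_pi_nhds.mp h1 0
  have h11 := tendsto_pi_nhds.mp h1 1
  have h20 := tendsto_pi_nhds.mp h2 0
  have h21 := tendsto_pi_nhds.mp h2 1
  simp only [Matrix.cons_val_zero, Matrix.cons_val_one, mul_zero, zero_add, add_zero] at h10 h11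
  have hL1 : L 1 = 0 := (tendsto_nhds_unique tendsto_const_nhds h11).symm
  refine ⟨L 0 / -((ζ : ℂ) * (γ ζ * e : ℝ)), γ ζ * e, hκ, ?_, ?_, ?_⟩
  · refine (h10.div_const (-((ζ : ℂ) * (γ ζ * e : ℝ)))).congr fun z => ?_
    rw [div_eq_iff (neg_ne_zero.mpr hne)]
    push_cast
    ring
  · have e1 : -((ζ : ℂ) * (γ ζ * e : ℝ) * (L 0 / -((ζ : ℂ) * (γ ζ * e : ℝ)))) = L 0 := by
      rw [← neg_mul, mul_div_cancel₀ _ (neg_ne_zero.mpr hne)]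
    rw [e1]
    exact h20
  · rw [← hL1]
    exact h21

/-- The vanishing theorem. The function `F(z) = h₁(z) conj (h₂(conj z)) + h₂(z) conj (h₁(conj z))`,
cleared of its simple poles, has nonnegative real part on the circle and vanishes at the origin. -/
theorem IsHomogeneousSolution.eq_zero {R : ℂ → ℂ} {Z : Set ℝ} {γ : ℝ → ℝ} {n : ℤ} {t : ℝ}
    {h : ℂ → Fin 2 → ℂ} (hh : IsHomogeneousSolution R Z γ n t h) (hfin : Z.Finite)
    (hZ : ∀ ζ ∈ Z, ζ ≠ 0 ∧ |ζ| < 1) (hγ : ∀ ζ ∈ Z, 0 < γ ζ) (hR1 : ∀ w, ‖w‖ = 1 → ‖R w‖ ≤ 1)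
    (hR : ∀ w ∈ openCircle, ‖R w‖ < 1) (h0 : h 0 0 = 0) {z : ℂ} (hz : ‖z‖ ≠ 1)
    (hzp : z ∉ poleSet Z) : h z = 0 := by
  set S : Set ℂ := Complex.ofReal '' Z with hSdef
  have hS : S.Finite := hfin.image _
  have hSp : ∀ z, ‖z‖ < 1 → z ∉ S → z ∉ poleSet Z := by
    rintro z hz hzS ⟨ζ, hζ, e | e⟩
    · exact hzS ⟨ζ, hζ, e.symm⟩
    · rw [e, norm_inv, Complex.norm_real, Real.norm_eq_abs] at hz
      have := (one_lt_inv₀ (abs_pos.mpr (hZ ζ hζ).1)).mpr (hZ ζ hζ).2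
      linarith
  have hd : ∀ i, ∀ z, ‖z‖ < 1 → z ∉ S → DifferentiableAt ℂ (fun z => h z i) z := fun i z hz hzS =>
    differentiableAt_pi.mp (hh.holomorphic z hz.ne (hSp z hz hzS)) i
  have hdc : ∀ i, ∀ z, ‖z‖ < 1 → z ∉ S → DifferentiableAt ℂ (fun z => conj (h (conj z) i)) z := by
    intro i z hz hzS
    have h1 := (hd i (conj z) (by rwa [Complex.norm_conj])
      fun hc => hzS (conj_mem_image_ofReal hc)).conj_conj
    rwa [Complex.conj_conj] at h1
  choose! β κ hκ hβ hres hres' using fun ζ hζ =>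
    hh.exists_residue (ζ := ζ) hζ (hZ ζ hζ).1 (hγ ζ hζ)
  set F : ℂ → ℂ := fun z => h z 0 * conj (h (conj z) 1) + h z 1 * conj (h (conj z) 0) with hF
  -- the residue of `F` at `ζ` is `-2 ζ κ |β|²`
  set P : ℂ → ℂ := fun z => F z + ∑ ζ ∈ hfin.toFinset,
    (2 * κ ζ * ‖β ζ‖ ^ 2 : ℝ) * (z / (z - ζ)) with hP
  have hdP : ∀ z, ‖z‖ < 1 → z ∉ S → DifferentiableAt ℂ P z := by
    intro z hz hzS
    refine (((hd 0 z hz hzS).mul (hdc 1 z hz hzS)).add ((hd 1 z hz hzS).mul (hdc 0 z hz hzS))).add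
      (DifferentiableAt.fun_sum fun ζ hζ => ?_)
    refine (differentiableAt_id.div (differentiableAt_id.sub_const _) fun h => hzS ?_).const_mul _
    exact ⟨ζ, hfin.mem_toFinset.mp hζ, (sub_eq_zero.mp h).symm⟩
  have hpoleP : ∀ p ∈ S, Tendsto (fun z => (z - p) * P z) (𝓝[≠] p) (𝓝 0) := by
    rintro _ ⟨ζ, hζ, rfl⟩
    have hc := tendsto_conj_punctured ζ
    have c1 := (Complex.continuous_conj.tendsto _).comp ((hβ ζ hζ).comp hc)
    have c2 := (Complex.continuous_conj.tendsto _).comp ((hres ζ hζ).comp hc)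
    have hsum : Tendsto (fun z : ℂ => ∑ ξ ∈ hfin.toFinset,
        (z - ζ) * ((2 * κ ξ * ‖β ξ‖ ^ 2 : ℝ) * (z / (z - ξ)))) (𝓝[≠] (ζ : ℂ))
        (𝓝 (∑ ξ ∈ hfin.toFinset, if ξ = ζ then ((2 * κ ζ * ‖β ζ‖ ^ 2 : ℝ) * ζ : ℂ) else 0)) := by
      refine tendsto_finsetSum _ fun ξ hξ => ?_
      have hid : Tendsto (fun z : ℂ => z) (𝓝[≠] (ζ : ℂ)) (𝓝 (ζ : ℂ)) := nhdsWithin_le_nhds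
      split_ifs with hξζ
      · subst hξζ
        refine (hid.const_mul _).congr' ?_
        filter_upwards [self_mem_nhdsWithin] with z hz
        have hz' : z - ξ ≠ 0 := sub_ne_zero.mpr hz
        field_simp
      · have hne : (ζ : ℂ) - ξ ≠ 0 := sub_ne_zero.mpr fun h => hξζ (by exact_mod_cast h.symm)
        have h1 := (hid.sub_const (ζ : ℂ)).mul
          ((hid.div (hid.sub_const (ξ : ℂ)) hne).const_mul ((2 * κ ξ * ‖β ξ‖ ^ 2 : ℝ) : ℂ))
        rwa [sub_self, zero_mul] at h1
    rw [Finset.sum_ite_eq', if_pos (hfin.mem_toFinset.mpr hζ)] at hsum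
    have key := (((hres ζ hζ).mul c1).add ((hβ ζ hζ).mul c2)).add hsum
    refine (key.congr fun z => ?_).trans_eq ?_
    · simp only [hP, hF, Function.comp_apply, map_mul, map_sub, Complex.conj_conj,
        Complex.conj_ofReal, ← Finset.mul_sum]
      ring
    · congr 1
      have := Complex.mul_conj' (β ζ)
      simp only [map_neg, map_mul, Complex.conj_ofReal]
      push_cast
      linear_combination (-2 * (ζ : ℂ) * κ ζ) * this
  choose! L K hL hK hLK0 hLK1 using fun w hw => hh.exists_boundary hfin hZ (w := w) hw
  have hbP : ∀ w, ‖w‖ = 1 → Tendsto P (𝓝[{z | ‖z‖ < 1}] w)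
      (𝓝 (L w 0 * conj (K w 1) + L w 1 * conj (K w 0) +
        ∑ ζ ∈ hfin.toFinset, (2 * κ ζ * ‖β ζ‖ ^ 2 : ℝ) * (w / (w - ζ)))) := by
    intro w hw
    have hL' := tendsto_pi_nhds.mp (hL w hw)
    have hK' := tendsto_pi_nhds.mp ((hK w hw).comp (tendsto_conj_of_norm_lt w))
    have hKc := fun i => (Complex.continuous_conj.tendsto _).comp (hK' i)
    refine (((hL' 0).mul (hKc 1)).add ((hL' 1).mul (hKc 0))).add
      (tendsto_finsetSum _ fun ζ hζ => ?_)
    have hid : Tendsto (fun z : ℂ => z) (𝓝[{z | ‖z‖ < 1}] w) (𝓝 w) := nhdsWithin_le_nhds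
    refine (hid.div (hid.sub_const _) fun h => ?_).const_mul _
    rw [sub_eq_zero.mp h, Complex.norm_real, Real.norm_eq_abs] at hw
    linarith [(hZ ζ (hfin.mem_toFinset.mp hζ)).2]
  obtain ⟨Q, hQ, hQP, hQb⟩ := exists_diffContOnCl_extension hS hdP hpoleP
    fun w hw => ⟨_, hbP w hw⟩
  have hreF : ∀ w, ‖w‖ = 1 → (L w 0 * conj (K w 1) + L w 1 * conj (K w 0)).re =
      (1 - ‖R w‖ ^ 2) * ‖K w 1‖ ^ 2 + ‖K w 0‖ ^ 2 := by
    intro w hw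
    have he : (expPhase n t w)⁻¹ = conj (expPhase n t w) := by
      rw [← expPhase_inv, inv_eq_conj_of_norm hw, expPhase_conj]
    have e1 : L w 0 * conj (K w 1) + L w 1 * conj (K w 0) =
        (((1 - ‖R w‖ ^ 2) * ‖K w 1‖ ^ 2 + ‖K w 0‖ ^ 2 : ℝ) : ℂ) +
        (K w 0 * conj (K w 1) * R w * expPhase n t w -
          conj (K w 0 * conj (K w 1) * R w * expPhase n t w)) := by
      have k0 := Complex.mul_conj' (K w 0)
      have k1 := Complex.mul_conj' (K w 1)
      rw [hLK0 w hw, hLK1 w hw, he]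
      simp only [map_mul, Complex.conj_conj]
      push_cast
      rw [← k0, ← k1]
      ring
    rw [e1, Complex.add_re, Complex.ofReal_re, Complex.sub_re, Complex.conj_re, sub_self, add_zero]
  have hterm : ∀ w, ‖w‖ = 1 → ∀ ζ ∈ hfin.toFinset,
      0 ≤ 2 * κ ζ * ‖β ζ‖ ^ 2 * (w / (w - (ζ : ℂ))).re := by
    intro w hw ζ hζ
    rw [hfin.mem_toFinset] at hζ
    have h1 := hκ ζ hζ
    have h2 := re_div_sub_pos hw (hZ ζ hζ).2
    positivity
  have hreQ : ∀ w, ‖w‖ = 1 → (Q w).re = ((1 - ‖R w‖ ^ 2) * ‖K w 1‖ ^ 2 + ‖K w 0‖ ^ 2) +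
      ∑ ζ ∈ hfin.toFinset, 2 * κ ζ * ‖β ζ‖ ^ 2 * (w / (w - (ζ : ℂ))).re := by
    intro w hw
    rw [hQb w _ hw (hbP w hw), Complex.add_re, hreF w hw, Complex.re_sum]
    simp only [Complex.re_ofReal_mul]
  have hsq : ∀ w, ‖w‖ = 1 → 0 ≤ (1 - ‖R w‖ ^ 2) * ‖K w 1‖ ^ 2 + ‖K w 0‖ ^ 2 := by
    intro w hw
    have h1 : ‖R w‖ ^ 2 ≤ 1 := pow_le_one₀ (norm_nonneg _) (hR1 w hw)
    have h2 : 0 ≤ 1 - ‖R w‖ ^ 2 := by linarith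
    positivity
  have hQ0 : Q 0 = 0 := by
    rw [hQP 0 (by simp) (fun ⟨ζ, hζ, e⟩ => (hZ ζ hζ).1 (by exact_mod_cast e))]
    simp [hP, hF, h0]
  have hQre : ∀ w, ‖w‖ = 1 → (Q w).re = 0 := fun w hw =>
    re_eq_zero_of_re_nonneg hQ hQ0 (fun w hw => by
      rw [hreQ w hw]
      exact add_nonneg (hsq w hw) (Finset.sum_nonneg (hterm w hw))) hw
  -- the two nonnegative contributions to the real part vanish separately
  have hβ0 : ∀ ζ ∈ Z, β ζ = 0 := by
    intro ζ hζ
    have h1 : ‖(1 : ℂ)‖ = 1 := norm_one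
    have h2 := hQre 1 h1
    rw [hreQ 1 h1] at h2
    have h3 := Finset.sum_nonneg (hterm 1 h1)
    have h4 : ∑ ζ ∈ hfin.toFinset, 2 * κ ζ * ‖β ζ‖ ^ 2 * ((1 : ℂ) / (1 - (ζ : ℂ))).re = 0 := by
      linarith [hsq 1 h1]
    have h5 := (Finset.sum_eq_zero_iff_of_nonneg (hterm 1 h1)).mp h4 ζ (hfin.mem_toFinset.mpr hζ)
    have h6 := re_div_sub_pos h1 (hZ ζ hζ).2
    have h7 := hκ ζ hζ
    rw [mul_eq_zero, or_iff_left h6.ne', mul_eq_zero, or_iff_right (by positivity)] at h5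
    exact norm_eq_zero.mp (pow_eq_zero_iff two_ne_zero |>.mp h5)
  have hL0 : ∀ w ∈ openCircle, L w 0 = 0 ∧ L w 1 = 0 := by
    intro w hw
    have h2 := hQre w hw.1
    rw [hreQ w hw.1] at h2
    have h3 := Finset.sum_nonneg (hterm w hw.1)
    have h4 : 0 < 1 - ‖R w‖ ^ 2 := by
      have := pow_lt_one₀ (norm_nonneg _) (hR w hw) two_ne_zero
      linarith
    have h5 : 0 ≤ (1 - ‖R w‖ ^ 2) * ‖K w 1‖ ^ 2 := by positivity
    have h6 : 0 ≤ ‖K w 0‖ ^ 2 := by positivity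
    have h7 : (1 - ‖R w‖ ^ 2) * ‖K w 1‖ ^ 2 = 0 := by linarith
    have h8 : ‖K w 0‖ ^ 2 = 0 := by linarith
    rw [mul_eq_zero, or_iff_right h4.ne'] at h7
    have k0 : K w 0 = 0 := norm_eq_zero.mp (pow_eq_zero_iff two_ne_zero |>.mp h8)
    have k1 : K w 1 = 0 := norm_eq_zero.mp (pow_eq_zero_iff two_ne_zero |>.mp h7)
    rw [hLK0 w hw.1, hLK1 w hw.1, k0, k1]
    simp
  have hin : ∀ z, ‖z‖ < 1 → z ∉ S → h z = 0 := by
    intro z hz hzS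
    have hi : ∀ i, h z i = 0 := by
      intro i
      have hp : ∀ p ∈ S, Tendsto (fun z => (z - p) * h z i) (𝓝[≠] p) (𝓝 0) := by
        rintro _ ⟨ζ, hζ, rfl⟩
        fin_cases i
        · have := hres ζ hζ
          rw [hβ0 ζ hζ, mul_zero, neg_zero] at this
          exact this
        · exact hres' ζ hζ
      have hb := fun w hw => tendsto_pi_nhds.mp (hL w hw) i
      obtain ⟨G, hG, hGh, hGb⟩ := exists_diffContOnCl_extension hS (hd i) hp
        fun w hw => ⟨_, hb w hw⟩
      rw [← hGh z hz hzS]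
      refine eq_zero_of_eq_zero_on_openCircle hG (fun w hw => ?_) hz
      rw [hGb w _ hw.1 (hb w hw.1)]
      fin_cases i
      · exact (hL0 w hw).1
      · exact (hL0 w hw).2
    exact funext hi
  rcases lt_or_gt_of_ne hz with hz1 | hz1
  · exact hin z hz1 fun ⟨ζ, hζ, e⟩ => hzp ⟨ζ, hζ, Or.inl e.symm⟩
  · have hz0 : z ≠ 0 := by rintro rfl; simp at hz1; linarith
    have hi : ‖z⁻¹‖ < 1 := by rw [norm_inv]; exact inv_lt_one_of_one_lt₀ hz1
    have h1 : h z⁻¹ = 0 := hin _ hi fun ⟨ζ, hζ, e⟩ =>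
      hzp ⟨ζ, hζ, Or.inr (by rw [e, inv_inv])⟩
    rw [hh.symmetric z hz0 hz hzp] at h1
    have e0 := congrFun h1 0
    have e1 := congrFun h1 1
    ext i
    fin_cases i
    · exact e1
    · exact e0

theorem norm_reflection_le_one {M : ℝ} {a b : ℤ → ℝ} (h : RapidDecay M a b) {w : ℂ}
    (hw : ‖w‖ = 1) : ‖reflection a b w‖ ≤ 1 := by
  have hne : (𝓝[openCircle] w).NeBot :=
    mem_closure_iff_nhdsWithin_neBot.mp (mem_closure_openCircle hw)
  refine le_of_tendsto (tendsto_reflection h hw).norm (eventually_mem_nhdsWithin.mono fun z hz => ?_)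
  rw [reflection_eq h hz]
  exact (norm_jostR_lt_one h hz).le

/-- Two solutions differ, up to a positive factor, by a homogeneous one, and the normalization
fixes the factor. -/
theorem IsRHPSolution.eq_of_normalized {R : ℂ → ℂ} {Z : Set ℝ} {γ : ℝ → ℝ} {n : ℤ} {t : ℝ}
    {f m : ℂ → Fin 2 → ℂ} (hf : IsRHPSolution R Z γ n t f) (hm : IsRHPSolution R Z γ n t m)
    (hfin : Z.Finite) (hZ : ∀ ζ ∈ Z, ζ ≠ 0 ∧ |ζ| < 1) (hγ : ∀ ζ ∈ Z, 0 < γ ζ)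
    (hR1 : ∀ w, ‖w‖ = 1 → ‖R w‖ ≤ 1) (hR : ∀ w ∈ openCircle, ‖R w‖ < 1) {z : ℂ}
    (hz : ‖z‖ ≠ 1) (hzp : z ∉ poleSet Z) : f z = m z := by
  obtain ⟨hf1, A, hA, hfA⟩ := hf.normalized
  obtain ⟨hm1, B, hB, hmB⟩ := hm.normalized
  have hA' : (A : ℂ) ≠ 0 := by exact_mod_cast hA.ne'
  have hB' : (B : ℂ) ≠ 0 := by exact_mod_cast hB.ne'
  have hvan : ∀ z, ‖z‖ ≠ 1 → z ∉ poleSet Z → f z - ((A : ℂ) / B) • m z = 0 :=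
    fun z hz hzp => (hf.sub_smul hm (A / B)).eq_zero hfin hZ hγ hR1 hR
      (by simp [hfA, hmB, hB']) hz hzp
  have h0 := congrFun (hvan 0 (by simp) (by
    rintro ⟨ζ, hζ, e | e⟩
    · exact (hZ ζ hζ).1 (by exact_mod_cast e.symm)
    · exact (hZ ζ hζ).1 (by exact_mod_cast inv_eq_zero.mp e.symm))) 1
  simp only [Pi.sub_apply, Pi.smul_apply, smul_eq_mul, Pi.zero_apply] at h0
  rw [hfA] at hf1
  rw [hmB] at hm1
  -- comparison of the second components at the origin gives `A ^ 2 = B ^ 2`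
  have h1 : (A : ℂ) ^ 2 = (B : ℂ) ^ 2 := by
    have h2 : (B : ℂ) * (A * f 0 1) = A * (A * (B * m 0 1)) / B := by
      rw [sub_eq_zero] at h0
      rw [h0]
      field_simp
    rw [hf1, hm1] at h2
    field_simp at h2
    exact h2.symm
  have h2 : A ^ 2 = B ^ 2 := by exact_mod_cast h1
  have h3 : A = B := (pow_left_inj₀ hA.le hB.le two_ne_zero).mp h2
  have h4 := hvan z hz hzp
  rw [h3, div_self hB', one_smul, sub_eq_zero] at h4
  exact h4

end TodaRHP

end

theorem corollary3p2 (a b : ℤ → ℝ → ℝ) (hab : TodaRHP.IsTodaSolution a b)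
    (t₀ : ℝ) (hdecay : TodaRHP.HasDecay (fun k => a k t₀) (fun k => b k t₀))
    (n : ℤ) (t : ℝ) :
    TodaRHP.IsRHPSolution
        (TodaRHP.reflection (fun k => a k 0) (fun k => b k 0))
        (TodaRHP.eigenPoints (fun k => a k 0) (fun k => b k 0))
        (TodaRHP.normingConst (fun k => a k 0) (fun k => b k 0)) n t
        (TodaRHP.mJost (fun k => a k t) (fun k => b k t) n) ∧
      ∀ f : ℂ → Fin 2 → ℂ,
        TodaRHP.IsRHPSolution
          (TodaRHP.reflection (fun k => a k 0) (fun k => b k 0))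
          (TodaRHP.eigenPoints (fun k => a k 0) (fun k => b k 0))
          (TodaRHP.normingConst (fun k => a k 0) (fun k => b k 0)) n t f →
        ∀ z : ℂ, ‖z‖ ≠ 1 →
          z ∉ TodaRHP.poleSet (TodaRHP.eigenPoints (fun k => a k 0) (fun k => b k 0)) →
            f z = TodaRHP.mJost (fun k => a k t) (fun k => b k t) n z := by
  have hd : TodaRHP.LocallyRapidDecay a b := hab.exists_rapidDecay hdecay
  obtain ⟨M, hM⟩ := hd 0
  have h0 := hM 0 (by simp)
  have hm := TodaRHP.isRHPSolution_mJost hab hd n t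
  refine ⟨hm, fun f hf z hz hzp => hf.eq_of_normalized hm (TodaRHP.finite_eigenPoints h0)
    (fun ζ hζ => ⟨hζ.1, hζ.2.1⟩) (fun ζ hζ => ?_)
    (fun w hw => TodaRHP.norm_reflection_le_one h0 hw) (fun w hw => ?_) hz hzp⟩
  · obtain ⟨hζ0, hζ1, hW⟩ := (TodaRHP.mem_eigenPoints_iff h0 ζ).mp hζ
    have hz0 : (ζ : ℂ) ≠ 0 := by exact_mod_cast hζ0
    have hz1 : ‖(ζ : ℂ)‖ < 1 := by rwa [Complex.norm_real, Real.norm_eq_abs]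
    rw [TodaRHP.normingConst, TodaRHP.jostPlus_eq h0 hz0 hz1.le]
    exact inv_pos.mpr (TodaRHP.tsum_norm_psiPlus_sq_pos h0 hz0 hz1 hW)
  · rw [TodaRHP.reflection_eq h0 hw]
    exact TodaRHP.norm_jostR_lt_one h0 hw
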